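/- Let $W,V,f:\mathbb R\to\mathbb R$, where $W,V$ are $C^2$, $W''\ge\delta$ for some $\delta>0$, and $V(x+1)=V(x)$. Suppose that either $f$ is constant (DC case), or $f(t+1)=f(t)$ and $W,V,f$ are real analytic (AC case). Consider the driven overdamped Frenkel--Kontorova chain $$\frac{d}{dt}u_j(t)=W'(u_{j+1}-u_j)-W'(u_j-u_{j-1})+V'(u_j)+f(t),\qquad j\in\mathbb Z. \qquad (*)$$ A configuration $u=(u_j)_{j\in\mathbb Z}\in\mathbb R^{\mathbb Z}$ has bounded width with mean spacing $\rho\in\mathbb R$ if $\sup_{m,n\in\mathbb Z}|u_m-u_n-(m-n)\rho|<\infty$. Let $\mathcal X$ be the set of configurations of bounded width modulo the relation $u\sim u+n$, $n\in\mathbb Z$, with the (quotient of the) topology of pointwise convergence and its Borel $\sigma$-algebra, and let $\mathcal X_\rho\subset\mathcal X$ be the set of classes of configurations with mean spacing $\rho$. Let $S:\mathcal X\to\mathcal X$ be the spatial translation $(Su)_j=u_{j-1}$, and let $T:\mathcal X\to\mathcal X$ be the time-one map $u(0)\mapsto u(1)$ of $(*)$, where solutions are taken among configurations of bounded width, the width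 being bounded on bounded time intervals. An $S,T$-invariant measure with mean spacing $\rho$ is a Borel probability measure $\mu$ on $\mathcal X$ with $\mu(\mathcal X_\rho)=1$ which is invariant under $S$ and under $T$; it is ergodic if $\mu(A)\in\{0,1\}$ for every Borel set $A$ with $S^{-1}A=A=T^{-1}A$. Two configurations $u\ne v$ intersect if $(v_{j+1}-u_{j+1})(v_j-u_j)\le 0$ for some $j\in\mathbb Z$. Such a measure $\mu$ is synchronized if no two configurations whose classes lie in $\operatorname{supp}\mu$ intersect. The system $(*)$ is in the depinned phase for $\rho$ if there is a synchronized measure $\mu$ with mean spacing $\rho$ such that the map $\operatorname{supp}\mu\to\mathbb R/\mathbb Z$, $u\mapsto u_0$, is onto. If $\rho$ is irrational and $(*)$ is in the depinned phase for $\rho$, then there is exactly one ergodic $S,T$-invariant measure with mean spacing $\rho$. -/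

import Mathlib

open MeasureTheory Set

noncomputable section

namespace FrenkelKontorova

/-- `u` has bounded width and mean spacing `ρ`. -/
def BoundedWidth (ρ : ℝ) (u : ℤ → ℝ) : Prop :=
  ∃ K : ℝ, ∀ m n : ℤ, |u m - u n - ((m : ℝ) - (n : ℝ)) * ρ| ≤ K

/-- Configurations of bounded width, with the topology of pointwise convergence
(the topology induced by the product topology on `ℤ → ℝ`). -/
abbrev Config : Type := {u : ℤ → ℝ // ∃ ρ : ℝ, BoundedWidth ρ u}

/-- Configurations are identified when they differ by an integer constant. -/
instance configSetoid : Setoid Config where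
  r u v := ∃ n : ℤ, ∀ j : ℤ, v.1 j = u.1 j + n
  iseqv :=
    { refl := fun u => ⟨0, fun j => by simp⟩
      symm := by
        rintro u v ⟨n, h⟩
        exact ⟨-n, fun j => by rw [h j]; push_cast; ring⟩
      trans := by
        rintro u v w ⟨n, h⟩ ⟨k, h'⟩
        exact ⟨n + k, fun j => by rw [h' j, h j]; push_cast; ring⟩ }

/-- The state space: configurations of bounded width modulo integer constants. -/
def StateSpace : Type := Quotient configSetoid

instance : TopologicalSpace StateSpace :=
  inferInstanceAs (TopologicalSpace (Quotient configSetoid))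

instance : MeasurableSpace StateSpace := borel StateSpace

instance : BorelSpace StateSpace := ⟨rfl⟩

/-- The class of a configuration in the state space. -/
def proj (u : Config) : StateSpace := Quotient.mk configSetoid u

/-- The classes of the configurations with mean spacing `ρ`. -/
def withSpacing (ρ : ℝ) : Set StateSpace :=
  {x | ∃ u : Config, proj u = x ∧ BoundedWidth ρ u.1}

/-- The spatial translation `(S u)_j = u_{j-1}` on configurations. -/
def shiftConfig (u : Config) : Config :=
  ⟨fun j => u.1 (j - 1), by
    obtain ⟨ρ, K, h⟩ := u.2
    refine ⟨ρ, K, fun m n => ?_⟩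
    have := h (m - 1) (n - 1)
    push_cast at this
    have e : (m : ℝ) - 1 - ((n : ℝ) - 1) = (m : ℝ) - n := by ring
    rwa [e] at this⟩

/-- The spatial translation `S` on the state space. -/
def shift : StateSpace → StateSpace :=
  Quotient.map shiftConfig (by
    rintro u v ⟨n, h⟩
    exact ⟨n, fun j => h (j - 1)⟩)

/-- The coordinate `u ↦ u_0` as a map to the circle `ℝ / ℤ`. -/
def coordZero : StateSpace → UnitAddCircle :=
  Quotient.lift (fun u : Config => ((u.1 0 : ℝ) : UnitAddCircle)) (by
    rintro u v ⟨n, h⟩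
    simp only [h 0]
    rw [AddCircle.coe_add]
    have : ((n : ℝ) : UnitAddCircle) = 0 := by
      rw [AddCircle.coe_eq_zero_iff]
      exact ⟨n, by simp⟩
    rw [this, add_zero])

/-- The right-hand side of the equation of motion of the particle `j`, for the coupling `W`,
the on-site potential `V` and the driving force `f`. -/
def force (W V f : ℝ → ℝ) (t : ℝ) (u : ℤ → ℝ) (j : ℤ) : ℝ :=
  deriv W (u (j + 1) - u j) - deriv W (u j - u (j - 1)) + deriv V (u j) + f t

/-- `u` solves the equations of motion for times `t ≥ 0`, within the configurations of bounded
width: the width stays bounded on bounded time intervals, so that `u` is a curve in the Banach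
space of bounded perturbations of `j ↦ j * ρ`. -/
structure IsSolution (W V f : ℝ → ℝ) (u : ℝ → ℤ → ℝ) : Prop where
  width : ∃ ρ : ℝ, ∀ τ : ℝ, ∃ K : ℝ, ∀ t ∈ Icc 0 τ, ∀ m n : ℤ,
    |u t m - u t n - ((m : ℝ) - (n : ℝ)) * ρ| ≤ K
  hasDeriv : ∀ t ∈ Ici (0 : ℝ), ∀ j : ℤ,
    HasDerivWithinAt (fun s => u s j) (force W V f t (u t) j) (Ici 0) t

/-- Some solution starts at (a representative of) `x` at time `0` and is at (a representative
of) `y` at time `t`. -/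
def Evolves (W V f : ℝ → ℝ) (t : ℝ) (x y : StateSpace) : Prop :=
  ∃ (u : ℝ → ℤ → ℝ) (a b : Config), IsSolution W V f u ∧
    a.1 = u 0 ∧ b.1 = u t ∧ proj a = x ∧ proj b = y

open Classical in
/-- The time evolution from time `0` to time `t ≥ 0`. For the systems considered here the solution
with given initial value exists for all `t ≥ 0` and is unique, so that the choice is forced and
the second case is void. -/
def evolution (W V f : ℝ → ℝ) (t : ℝ) (x : StateSpace) : StateSpace :=
  if h : ∃ y, Evolves W V f t x y then h.choose else x

/-- The time-one map `T`. -/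
def timeOne (W V f : ℝ → ℝ) : StateSpace → StateSpace := evolution W V f 1

/-- An `S,T`-invariant Borel probability measure with mean spacing `ρ`. -/
structure IsInvariant (W V f : ℝ → ℝ) (ρ : ℝ) (μ : Measure StateSpace) : Prop where
  prob : IsProbabilityMeasure μ
  spacing : ∀ᵐ x ∂μ, x ∈ withSpacing ρ
  shift : MeasurePreserving shift μ μ
  time : MeasurePreserving (timeOne W V f) μ μ

/-- An `S,T`-invariant measure with mean spacing `ρ` that is ergodic for the joint action of
`S` and `T`. -/
structure IsErgodicInvariant (W V f : ℝ → ℝ) (ρ : ℝ) (μ : Measure StateSpace) : Prop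
    extends IsInvariant W V f ρ μ where
  ergodic : ∀ A : Set StateSpace, MeasurableSet A →
    FrenkelKontorova.shift ⁻¹' A = A → timeOne W V f ⁻¹' A = A → μ A = 0 ∨ μ A = 1

/-- Two distinct configurations whose graphs intersect. -/
def Intersect (u v : ℤ → ℝ) : Prop :=
  u ≠ v ∧ ∃ j : ℤ, (v (j + 1) - u (j + 1)) * (v j - u j) ≤ 0

/-- A synchronized measure with mean spacing `ρ`: an `S,T`-invariant measure such that no two
configurations in its support intersect. -/
structure IsSynchronized (W V f : ℝ → ℝ) (ρ : ℝ) (μ : Measure StateSpace) : Prop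
    extends IsInvariant W V f ρ μ where
  not_intersect : ∀ u v : Config, proj u ∈ μ.support → proj v ∈ μ.support →
    ¬ Intersect u.1 v.1

/-- The depinned phase for the mean spacing `ρ`. -/
def Depinned (W V f : ℝ → ℝ) (ρ : ℝ) : Prop :=
  ∃ μ : Measure StateSpace, IsSynchronized W V f ρ μ ∧ coordZero '' μ.support = univ

end FrenkelKontorova

end

noncomputable section

open MeasureTheory Set Filter Topology

namespace FrenkelKontorova

/-! ### Comparison principle and global existence for infinite lattice systems. -/

section

/-! Every invariant measure with mean spacing `ρ` is shown to be carried by one and the same circle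
of configurations, on which `S` is an irrational rotation.

The circle comes from the synchronized measure. Its support is totally ordered, and particle 0 takes
every position, so the maps "position of particle 0 to position of particle n" are lifts of circle
homeomorphisms and form a group. The translation number of the generator is `ρ`. Poincaré's
semiconjugacy, made a conjugacy by recurrence, writes the support as the leaves `j ↦ ψ (c + j * ρ)`.
The time-one map preserves their order and commutes with a dense group of phase translations, so it
moves every phase `c` by the same amount (`exists_hull_function`, `Admissible.exists_foliation`).

Now let `ν` be invariant and compare a `ν`-random trajectory with all leaves, the phase `c` being
distributed by Lebesgue measure. The difference of two solutions obeys a cooperative linear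
equation, so its sign changes can only disappear. `S` and `T` alter the comparison merely by a
translation of `c`, so the mean number of sign changes per site is constant in time and none may
disappear. Smoothing the sign at scale `ε` and letting `ε → 0` with Fatou's lemma turns this into
`Foliation.ae_not_touch`: almost surely no leaf is touched from below.

If the phase of a configuration, measured leaf by leaf, exceeds its values at both ends of a block,
the strong maximum principle produces touchings for a whole interval of leaves
(`Foliation.exists_touch`). Hence almost every phase sequence falls and then rises, so its total
variation is bounded. By `S`-invariance the mean phase increment then vanishes, and the
configuration is a leaf (`Foliation.ae_phase_eq`, `Foliation.ae_eq_leaf`). The phase distribution is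
invariant under an irrational rotation, hence uniform; this gives uniqueness, and ergodicity of the
rotation gives ergodicity. -/

/-- Comparison principle for subsolutions of cooperative nearest-neighbour linear systems. -/
theorem nonpos_of_subsolution {I : Set ℤ} {y y' : ℝ → ℤ → ℝ} {τ L B : ℝ} (hL : 0 ≤ L)
    (hc : ∀ j ∈ I, ContinuousOn (fun s => y s j) (Icc 0 τ))
    (hd : ∀ j ∈ I, ∀ t ∈ Ico 0 τ, HasDerivWithinAt (fun s => y s j) (y' t j) (Ici t) t)
    (hineq : ∀ j ∈ I, ∀ t ∈ Ico 0 τ, ∃ a b c : ℝ, 0 ≤ a ∧ a ≤ L ∧ 0 ≤ b ∧ b ≤ L ∧ |c| ≤ L ∧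
      y' t j ≤ a * y t (j + 1) + b * y t (j - 1) + c * y t j)
    (hB : ∀ t ∈ Icc 0 τ, ∀ j, y t j ≤ B)
    (h0 : ∀ j ∈ I, y 0 j ≤ 0) (hout : ∀ j ∉ I, ∀ t ∈ Icc 0 τ, y t j ≤ 0) :
    ∀ t ∈ Icc 0 τ, ∀ j, y t j ≤ 0 := by
  -- On an infinite chain a maximum need not be attained, so the a priori bound `B` is improved
  -- iteratively. The factor `exp (L * t)` makes the diagonal coefficient `L + c` nonnegative. A
  -- bound on all particles then reproduces itself as `4 * L = L + L + 2 * L` times its time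
  -- integral, which yields the Taylor terms `(4 * L * t) ^ n / n!`, tending to zero.
  set B' : ℝ := max B 0 * Real.exp (L * τ) with hB'
  have hB'0 : 0 ≤ B' := by positivity
  have key : ∀ n : ℕ, ∀ t ∈ Icc 0 τ, ∀ j,
      Real.exp (L * t) * y t j ≤ B' * ((4 * L * t) ^ n / n.factorial) := by
    intro n
    induction n with
    | zero =>
      intro t ht j
      have h1 : Real.exp (L * t) ≤ Real.exp (L * τ) :=
        Real.exp_le_exp.2 (mul_le_mul_of_nonneg_left ht.2 hL)
      have h2 : y t j ≤ max B 0 := (hB t ht j).trans (le_max_left _ _)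
      calc Real.exp (L * t) * y t j ≤ Real.exp (L * t) * max B 0 :=
            mul_le_mul_of_nonneg_left h2 (Real.exp_pos _).le
        _ ≤ Real.exp (L * τ) * max B 0 := mul_le_mul_of_nonneg_right h1 (le_max_right _ _)
        _ = B' * ((4 * L * t) ^ 0 / (Nat.factorial 0)) := by simp [hB', mul_comm]
    | succ n ih =>
      intro t ht j
      by_cases hj : j ∈ I
      · have hexp : ∀ s : ℝ, HasDerivAt (fun s => Real.exp (L * s)) (Real.exp (L * s) * L) s := by
          intro s
          simpa using ((hasDerivAt_id s).const_mul L).exp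
        have hpow : ∀ s : ℝ, HasDerivAt
            (fun s => B' * ((4 * L * s) ^ (n + 1) / (n + 1).factorial))
            (4 * L * (B' * ((4 * L * s) ^ n / n.factorial))) s := by
          intro s
          have h := ((((hasDerivAt_id s).const_mul (4 * L)).pow (n + 1)).div_const
            ((n + 1).factorial : ℝ)).const_mul B'
          refine h.congr_deriv ?_
          rw [Nat.factorial_succ]
          have : (n.factorial : ℝ) ≠ 0 := by positivity
          push_cast
          simp only [id]
          field_simp
        refine image_le_of_deriv_right_le_deriv_boundary
          (f := fun s => Real.exp (L * s) * y s j)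
          (f' := fun s => Real.exp (L * s) * L * y s j + Real.exp (L * s) * y' s j)
          (B := fun s => B' * ((4 * L * s) ^ (n + 1) / (n + 1).factorial))
          (B' := fun s => 4 * L * (B' * ((4 * L * s) ^ n / n.factorial)))
          (a := 0) (b := τ) ?_ ?_ ?_ ?_ ?_ ?_ ht
        · exact (by fun_prop : Continuous fun s => Real.exp (L * s)).continuousOn.mul (hc j hj)
        · intro s hs
          exact (hexp s).hasDerivWithinAt.mul (hd j hj s hs)
        · simpa using h0 j hj
        · exact fun s _ => (hpow s).continuousAt.continuousWithinAt
        · exact fun s _ => (hpow s).hasDerivWithinAt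
        · intro s hs
          obtain ⟨a, b, c, ha, haL, hb, hbL, hcL, hle⟩ := hineq j hj s hs
          have hsI : s ∈ Icc 0 τ := ⟨hs.1, hs.2.le⟩
          set m := B' * ((4 * L * s) ^ n / n.factorial) with hm
          have hs0 := hs.1
          have hm0 : 0 ≤ m := by positivity
          have hE := Real.exp_pos (L * s)
          set E := Real.exp (L * s)
          have i1 := ih s hsI (j + 1)
          have i2 := ih s hsI (j - 1)
          have i3 := ih s hsI j
          have hcL' := abs_le.1 hcL
          have e1 : a * (E * y s (j + 1)) ≤ L * m :=
            (mul_le_mul_of_nonneg_left i1 ha).trans (mul_le_mul_of_nonneg_right haL hm0)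
          have e2 : b * (E * y s (j - 1)) ≤ L * m :=
            (mul_le_mul_of_nonneg_left i2 hb).trans (mul_le_mul_of_nonneg_right hbL hm0)
          have e3 : (L + c) * (E * y s j) ≤ 2 * L * m :=
            (mul_le_mul_of_nonneg_left i3 (by linarith)).trans
              (mul_le_mul_of_nonneg_right (by linarith) hm0)
          have e4 := mul_le_mul_of_nonneg_left hle hE.le
          show E * L * y s j + E * y' s j ≤ 4 * L * m
          linarith
      · have h1 : Real.exp (L * t) * y t j ≤ 0 :=
          mul_nonpos_of_nonneg_of_nonpos (Real.exp_pos _).le (hout j hj t ht)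
        have h2 : 0 ≤ B' * ((4 * L * t) ^ (n + 1) / (n + 1).factorial) := by
          have := ht.1
          positivity
        exact h1.trans h2
  intro t ht j
  have hlim : Tendsto (fun n : ℕ => B' * ((4 * L * t) ^ n / n.factorial)) atTop (𝓝 (B' * 0)) :=
    (FloorSemiring.tendsto_pow_div_factorial_atTop (4 * L * t)).const_mul B'
  rw [mul_zero] at hlim
  have : Real.exp (L * t) * y t j ≤ 0 := ge_of_tendsto' hlim fun n => key n t ht j
  exact nonpos_of_mul_nonpos_right this (Real.exp_pos _)

/-- Global existence for lattice systems with a locally bounded Lipschitz constant. -/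
theorem exists_lattice_solution (G : ℝ → (ℤ → ℝ) → ℤ → ℝ) (x₀ : ℤ → ℝ)
    (hLip : ∀ τ : ℝ, 0 ≤ τ → ∃ L : ℝ, 0 < L ∧ ∀ t ∈ Icc 0 τ, ∀ (x y : ℤ → ℝ) (D : ℝ),
      (∀ j, |x j - y j| ≤ D) → ∀ j, |G t x j - G t y j| ≤ L * D)
    (hcont : ∀ x : ℝ → ℤ → ℝ, (∀ j, ContinuousOn (fun t => x t j) (Ici 0)) →
      ∀ j, ContinuousOn (fun t => G t (x t) j) (Ici 0))
    (hbdd : ∀ τ : ℝ, 0 ≤ τ → ∃ C : ℝ, ∀ t ∈ Icc 0 τ, ∀ j, |G t x₀ j| ≤ C) :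
    ∃ x : ℝ → ℤ → ℝ, x 0 = x₀ ∧
      (∀ t ∈ Ici (0 : ℝ), ∀ j, HasDerivWithinAt (fun s => x s j) (G t (x t) j) (Ici 0) t) ∧
      ∀ τ : ℝ, 0 ≤ τ → ∃ B : ℝ, ∀ t ∈ Icc 0 τ, ∀ j, |x t j - x₀ j| ≤ B := by
  have hint : ∀ h : ℝ → ℝ, ContinuousOn h (Ici 0) → ∀ t ∈ Ici (0 : ℝ),
      HasDerivWithinAt (fun s => ∫ r in (0 : ℝ)..s, h r) (h t) (Ici 0) t := by
    intro h hh t ht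
    -- Freezing `h` at `h 0` for negative times makes the two-sided fundamental theorem available at
    -- the endpoint 0.
    have hc : Continuous fun r : ℝ => h (max r 0) :=
      hh.comp_continuous (by fun_prop) fun r => le_max_right r 0
    have h1 : HasDerivAt (fun s => ∫ r in (0 : ℝ)..s, h (max r 0)) (h (max t 0)) t :=
      intervalIntegral.integral_hasDerivAt_right (hc.intervalIntegrable _ _)
        (hc.stronglyMeasurableAtFilter _ _) hc.continuousAt
    rw [max_eq_left (mem_Ici.1 ht)] at h1
    have heq : ∀ s ∈ Ici (0 : ℝ), ∫ r in (0 : ℝ)..s, h r = ∫ r in (0 : ℝ)..s, h (max r 0) := by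
      intro s hs
      refine intervalIntegral.integral_congr fun r hr => ?_
      rw [uIcc_of_le (mem_Ici.1 hs)] at hr
      simp only [max_eq_left hr.1]
    exact h1.hasDerivWithinAt.congr heq (heq t ht)
  have hii : ∀ h : ℝ → ℝ, ContinuousOn h (Ici 0) → ∀ t : ℝ, 0 ≤ t →
      IntervalIntegrable h volume 0 t := by
    intro h hh t ht
    refine (hh.mono ?_).intervalIntegrable
    rw [uIcc_of_le ht]
    exact fun r hr => hr.1
  let X : ℕ → ℝ → ℤ → ℝ := fun n => Nat.rec (fun _ => x₀)
    (fun _ Y t j => x₀ j + ∫ s in (0 : ℝ)..t, G s (Y s) j) n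
  have X0 : ∀ t, X 0 t = x₀ := fun t => rfl
  have XS : ∀ n t j, X (n + 1) t j = x₀ j + ∫ s in (0 : ℝ)..t, G s (X n s) j := fun n t j => rfl
  have Xc : ∀ n j, ContinuousOn (fun t => X n t j) (Ici 0) := by
    intro n
    induction n with
    | zero => exact fun j => continuousOn_const
    | succ n ih =>
      intro j t ht
      exact ((hint _ (hcont _ ih j) t ht).const_add (x₀ j)).continuousWithinAt
  -- With the weight `exp (2 * L * t)` the Picard map contracts by `1 / 2` on all of `[0, τ]`, so no
  -- local solutions have to be glued.
  have step : ∀ τ : ℝ, 0 ≤ τ → ∃ C K : ℝ, 0 ≤ C ∧ 0 < K ∧ ∀ n, ∀ t ∈ Icc 0 τ, ∀ j,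
      |X (n + 1) t j - X n t j| ≤ C * (1 / 2) ^ n * Real.exp (K * t) := by
    intro τ hτ
    obtain ⟨L, hL, hLip⟩ := hLip τ hτ
    obtain ⟨C, hC⟩ := hbdd τ hτ
    have hC0 : 0 ≤ C := (abs_nonneg _).trans (hC 0 ⟨le_rfl, hτ⟩ 0)
    refine ⟨C * τ, 2 * L, by positivity, by positivity, fun n => ?_⟩
    induction n with
    | zero =>
      intro t ht j
      rw [XS, X0]
      simp only [X0]
      have h1 : ‖∫ s in (0 : ℝ)..t, G s x₀ j‖ ≤ C * |t - 0| := by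
        refine intervalIntegral.norm_integral_le_of_norm_le_const fun s hs => ?_
        rw [uIoc_of_le ht.1] at hs
        exact hC s ⟨hs.1.le, hs.2.trans ht.2⟩ j
      rw [sub_zero, abs_of_nonneg ht.1, Real.norm_eq_abs] at h1
      have h2 : 1 ≤ Real.exp (2 * L * t) := Real.one_le_exp (by have := ht.1; positivity)
      have h3 : C * t ≤ C * τ := mul_le_mul_of_nonneg_left ht.2 hC0
      have h4 : 0 ≤ C * τ := by positivity
      simp only [add_sub_cancel_left, pow_zero, mul_one]
      nlinarith
    | succ n ih =>
      intro t ht j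
      rw [XS (n + 1), XS n, add_sub_add_left_eq_sub,
        ← intervalIntegral.integral_sub (hii _ (hcont _ (Xc (n + 1)) j) t ht.1)
          (hii _ (hcont _ (Xc n) j) t ht.1)]
      have hexp : ∀ s : ℝ, HasDerivAt (fun s => Real.exp (2 * L * s))
          (Real.exp (2 * L * s) * (2 * L)) s := by
        intro s
        simpa using ((hasDerivAt_id s).const_mul (2 * L)).exp
      have hI : ∫ s in (0 : ℝ)..t, Real.exp (2 * L * s) * (2 * L) = Real.exp (2 * L * t) - 1 := by
        rw [intervalIntegral.integral_eq_sub_of_hasDerivAt (fun s _ => hexp s)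
          ((by fun_prop : Continuous fun s => Real.exp (2 * L * s) * (2 * L)).intervalIntegrable _ _)]
        simp
      have h1 : ‖∫ s in (0 : ℝ)..t, (G s (X (n + 1) s) j - G s (X n s) j)‖ ≤
          ∫ s in (0 : ℝ)..t, C * τ * (1 / 2) ^ (n + 1) * (Real.exp (2 * L * s) * (2 * L)) := by
        refine intervalIntegral.norm_integral_le_of_norm_le ht.1 (ae_of_all _ fun s hs => ?_)
          (Continuous.intervalIntegrable (by fun_prop) _ _)
        have hs' : s ∈ Icc 0 τ := ⟨hs.1.le, hs.2.trans ht.2⟩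
        refine (hLip s hs' _ _ _ (ih s hs') j).trans (le_of_eq ?_)
        ring
      rw [intervalIntegral.integral_const_mul, hI] at h1
      refine h1.trans (mul_le_mul_of_nonneg_left (by linarith) (by positivity))
  have hlim : ∀ t : ℝ, 0 ≤ t → ∀ j, ∃ y, Tendsto (fun n => X n t j) atTop (𝓝 y) := by
    intro t ht j
    obtain ⟨C, K, hC, hK, hb⟩ := step t ht
    refine cauchySeq_tendsto_of_complete (cauchySeq_of_le_geometric (1 / 2)
      (C * Real.exp (K * t)) (by norm_num) fun n => ?_)
    rw [dist_comm, Real.dist_eq]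
    refine (hb n t ⟨ht, le_rfl⟩ j).trans (le_of_eq (by ring))
  choose! x hx using hlim
  have herr : ∀ τ : ℝ, 0 ≤ τ → ∃ C : ℝ, 0 ≤ C ∧ ∀ n, ∀ t ∈ Icc 0 τ, ∀ j,
      |X n t j - x t j| ≤ C * (1 / 2) ^ n := by
    intro τ hτ
    obtain ⟨C, K, hC, hK, hb⟩ := step τ hτ
    refine ⟨2 * (C * Real.exp (K * τ)), by positivity, fun n t ht j => ?_⟩
    have := dist_le_of_le_geometric_of_tendsto (1 / 2) (C * Real.exp (K * τ)) (by norm_num)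
      (fun n => ?_) (hx t ht.1 j) n
    · rw [Real.dist_eq] at this
      refine this.trans (le_of_eq (by ring))
    · rw [dist_comm, Real.dist_eq]
      refine (hb n t ht j).trans ?_
      have : Real.exp (K * t) ≤ Real.exp (K * τ) :=
        Real.exp_le_exp.2 (mul_le_mul_of_nonneg_left ht.2 hK.le)
      calc C * (1 / 2) ^ n * Real.exp (K * t) ≤ C * (1 / 2) ^ n * Real.exp (K * τ) :=
            mul_le_mul_of_nonneg_left this (by positivity)
        _ = _ := by ring
  have hgeo : ∀ C : ℝ, Tendsto (fun n : ℕ => C * (1 / 2 : ℝ) ^ n) atTop (𝓝 0) := by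
    intro C
    simpa using (tendsto_pow_atTop_nhds_zero_of_lt_one (r := (1 / 2 : ℝ)) (by norm_num)
      (by norm_num)).const_mul C
  have xc : ∀ j, ContinuousOn (fun t => x t j) (Ici 0) := by
    intro j t ht
    obtain ⟨C, hC, hb⟩ := herr (t + 1) (by have := mem_Ici.1 ht; linarith)
    have hu : TendstoUniformlyOn (fun n t => X n t j) (fun t => x t j) atTop (Icc 0 (t + 1)) := by
      rw [Metric.tendstoUniformlyOn_iff]
      intro ε hε
      filter_upwards [(hgeo C).eventually (gt_mem_nhds hε)] with n hn s hs
      rw [dist_comm, Real.dist_eq]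
      exact (hb n s hs j).trans_lt hn
    have h1 := hu.continuousOn (Eventually.of_forall fun n =>
      (Xc n j).mono (fun s hs => hs.1)).frequently
    refine (h1 t ⟨ht, by linarith⟩).mono_of_mem_nhdsWithin ?_
    rw [← Ici_inter_Iic]
    exact inter_mem self_mem_nhdsWithin (mem_nhdsWithin_of_mem_nhds (Iic_mem_nhds (by linarith)))
  have hxint : ∀ t ∈ Ici (0 : ℝ), ∀ j, x t j = x₀ j + ∫ s in (0 : ℝ)..t, G s (x s) j := by
    intro t ht j
    have ht0 : (0 : ℝ) ≤ t := ht
    obtain ⟨C, hC, hb⟩ := herr t ht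
    obtain ⟨L, hL, hLip⟩ := hLip t ht
    have h1 : Tendsto (fun n => X (n + 1) t j) atTop (𝓝 (x t j)) :=
      (hx t ht j).comp (tendsto_add_atTop_nat 1)
    refine tendsto_nhds_unique h1 ?_
    simp only [XS]
    refine Tendsto.const_add _ ?_
    rw [tendsto_iff_norm_sub_tendsto_zero]
    refine squeeze_zero (fun n => norm_nonneg _) (fun n => ?_) (hgeo (L * C * t))
    rw [← intervalIntegral.integral_sub (hii _ (hcont _ (Xc n) j) t ht)
          (hii _ (hcont _ xc j) t ht)]
    have h2 : ‖∫ s in (0 : ℝ)..t, (G s (X n s) j - G s (x s) j)‖ ≤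
        (L * (C * (1 / 2) ^ n)) * |t - 0| := by
      refine intervalIntegral.norm_integral_le_of_norm_le_const fun s hs => ?_
      rw [uIoc_of_le ht0] at hs
      have hs' : s ∈ Icc 0 t := ⟨hs.1.le, hs.2⟩
      exact hLip s hs' _ _ _ (hb n s hs') j
    rw [sub_zero, abs_of_nonneg ht0] at h2
    refine h2.trans (le_of_eq (by ring))
  refine ⟨x, ?_, ?_, ?_⟩
  · ext j
    rw [hxint 0 self_mem_Ici j]
    simp
  · intro t ht j
    exact ((hint _ (hcont _ xc j) t ht).const_add (x₀ j)).congr (fun s hs => hxint s hs j)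
      (hxint t ht j)
  · intro τ hτ
    obtain ⟨C, hC, hb⟩ := herr τ hτ
    refine ⟨C, fun t ht j => ?_⟩
    have := hb 0 t ht j
    rw [X0, abs_sub_comm] at this
    simpa using this

end

/-! ### Mean spacing, the linearized force, and order preservation. -/

section

/-- `u` has mean spacing `ρ` and width at most `K`. -/
def HasWidth (ρ K : ℝ) (u : ℤ → ℝ) : Prop :=
  ∀ m n : ℤ, |u m - u n - ((m : ℝ) - (n : ℝ)) * ρ| ≤ K

theorem HasWidth.mono {ρ K K' : ℝ} {u : ℤ → ℝ} (h : HasWidth ρ K u) (hK : K ≤ K') :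
    HasWidth ρ K' u := fun m n => (h m n).trans hK

theorem HasWidth.nonneg {ρ K : ℝ} {u : ℤ → ℝ} (h : HasWidth ρ K u) : 0 ≤ K :=
  (abs_nonneg _).trans (h 0 0)

theorem HasWidth.increment {ρ K : ℝ} {u : ℤ → ℝ} (h : HasWidth ρ K u) (j : ℤ) :
    |u (j + 1) - u j - ρ| ≤ K := by
  have := h (j + 1) j
  push_cast at this
  rwa [add_sub_cancel_left, one_mul] at this

theorem HasWidth.increment_le {ρ K : ℝ} {u : ℤ → ℝ} (h : HasWidth ρ K u) (j : ℤ) :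
    |u (j + 1) - u j| ≤ |ρ| + K := by
  have h1 := h.increment j
  have h2 := abs_add_le (u (j + 1) - u j - ρ) ρ
  rw [sub_add_cancel] at h2
  linarith

/-- The mean spacing is unique. -/
theorem HasWidth.spacing_unique {ρ ρ' K K' : ℝ} {u : ℤ → ℝ} (h : HasWidth ρ K u)
    (h' : HasWidth ρ' K' u) : ρ = ρ' := by
  by_contra hne
  have hpos : 0 < |ρ - ρ'| := abs_pos.2 (sub_ne_zero.2 hne)
  obtain ⟨n, hn⟩ := exists_nat_gt ((K + K') / |ρ - ρ'|)
  rw [div_lt_iff₀ hpos] at hn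
  have h1 := h n 0
  have h2 := h' n 0
  push_cast at h1 h2
  have h3 := abs_sub (u n - u 0 - ((n : ℝ) - 0) * ρ') (u n - u 0 - ((n : ℝ) - 0) * ρ)
  have h4 : u n - u 0 - ((n : ℝ) - 0) * ρ' - (u n - u 0 - ((n : ℝ) - 0) * ρ) = n * (ρ - ρ') := by
    ring
  rw [h4, abs_mul, Nat.abs_cast] at h3
  linarith

/-- The properties of the coupling `W`, the potential `V` and the driving `f` on which the
dynamics depends. -/
structure Admissible (W V f : ℝ → ℝ) (δ C : ℝ) : Prop where
  pos : 0 < δ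
  contW : Continuous (deriv W)
  coupling : ∀ R : ℝ, ∃ L : ℝ, ∀ p q : ℝ, |p| ≤ R → |q| ≤ R →
    ∃ a : ℝ, δ ≤ a ∧ a ≤ L ∧ deriv W p - deriv W q = a * (p - q)
  contV : Continuous (deriv V)
  pot_bdd : ∀ x, |deriv V x| ≤ C
  pot_lip : ∃ L : ℝ, ∀ x y : ℝ, ∃ k : ℝ, |k| ≤ L ∧ deriv V x - deriv V y = k * (x - y)
  pot_per : ∀ (x : ℝ) (n : ℤ), deriv V (x + n) = deriv V x
  contf : Continuous f

theorem exists_deriv_mul_sub {g : ℝ → ℝ} (hg : Differentiable ℝ g) (p q : ℝ) :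
    ∃ c ∈ uIcc p q, g p - g q = deriv g c * (p - q) := by
  rcases lt_trichotomy p q with h | h | h
  · obtain ⟨c, hc, hc'⟩ := exists_deriv_eq_slope g h hg.continuous.continuousOn
      hg.differentiableOn
    refine ⟨c, Icc_subset_uIcc ⟨hc.1.le, hc.2.le⟩, ?_⟩
    have : q - p ≠ 0 := by linarith
    rw [hc']
    field_simp
    ring
  · exact ⟨p, left_mem_uIcc, by simp [h]⟩
  · obtain ⟨c, hc, hc'⟩ := exists_deriv_eq_slope g h hg.continuous.continuousOn
      hg.differentiableOn
    refine ⟨c, Icc_subset_uIcc' ⟨hc.1.le, hc.2.le⟩, ?_⟩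
    have : p - q ≠ 0 := by linarith
    rw [hc']
    field_simp

/-- Periodicity makes `V'` and `V''` globally bounded, whereas `W''` is bounded above only on
compact sets; this is why the slope bound in `coupling` depends on `R`. -/
theorem exists_admissible {W V f : ℝ → ℝ}
    (hW : ContDiff ℝ 2 W) (hconvex : ∃ δ : ℝ, 0 < δ ∧ ∀ p : ℝ, δ ≤ deriv (deriv W) p)
    (hV : ContDiff ℝ 2 V) (hVper : ∀ x : ℝ, V (x + 1) = V x) (hf : Continuous f) :
    ∃ δ C, Admissible W V f δ C := by
  obtain ⟨δ, hδ, hδW⟩ := hconvex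
  have hW1 : ContDiff ℝ 1 (deriv W) := ((contDiff_succ_iff_deriv (n := 1)).1 hW).2.2
  have hV1 : ContDiff ℝ 1 (deriv V) := ((contDiff_succ_iff_deriv (n := 1)).1 hV).2.2
  have hW2 : Continuous (deriv (deriv W)) := hW1.continuous_deriv le_rfl
  have hV2 : Continuous (deriv (deriv V)) := hV1.continuous_deriv le_rfl
  have hper1 : ∀ x, deriv V (x + 1) = deriv V x := by
    intro x
    rw [← deriv_comp_add_const]
    simp only [hVper]
  have hper2 : ∀ x, deriv (deriv V) (x + 1) = deriv (deriv V) x := by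
    intro x
    rw [← deriv_comp_add_const]
    simp only [hper1]
  have hb : ∀ g : ℝ → ℝ, Continuous g → (∀ x, g (x + 1) = g x) → ∃ C, ∀ x, |g x| ≤ C := by
    intro g hg hp
    obtain ⟨C, hC⟩ := (isCompact_Icc (a := (0 : ℝ)) (b := 1)).exists_bound_of_continuousOn
      hg.continuousOn
    refine ⟨C, fun x => ?_⟩
    have h := Function.Periodic.sub_int_mul_eq (f := g) (c := 1) hp (x := x) ⌊x⌋
    rw [← h, mul_one]
    exact hC _ ⟨Int.fract_nonneg x, (Int.fract_lt_one x).le⟩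
  obtain ⟨C, hC⟩ := hb _ hV1.continuous hper1
  obtain ⟨L, hL⟩ := hb _ hV2 hper2
  refine ⟨δ, C, hδ, hW1.continuous, fun R => ?_, hV1.continuous, hC, ⟨L, fun x y => ?_⟩, ?_, hf⟩
  · obtain ⟨M, hM⟩ := (isCompact_Icc (a := -R) (b := R)).exists_bound_of_continuousOn
      hW2.continuousOn
    refine ⟨M, fun p q hp hq => ?_⟩
    obtain ⟨c, hc, he⟩ := exists_deriv_mul_sub (hW1.differentiable one_ne_zero) p q
    refine ⟨_, hδW c, ?_, he⟩
    refine (le_abs_self _).trans (hM c ?_)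
    exact (uIcc_subset_Icc (abs_le.1 hp) (abs_le.1 hq)) hc
  · obtain ⟨c, hc, he⟩ := exists_deriv_mul_sub (hV1.differentiable one_ne_zero) x y
    exact ⟨_, hL c, he⟩
  · intro x n
    have := Function.Periodic.int_mul (f := deriv V) (c := 1) hper1 n x
    simpa using this

variable {W V f : ℝ → ℝ} {δ C ρ : ℝ}

/-- The difference of the forces on two configurations is a cooperative linear function of the
difference of the configurations. -/
theorem Admissible.exists_linearization (h : Admissible W V f δ C) (R : ℝ) :
    ∃ L : ℝ, 0 ≤ L ∧ ∀ (t : ℝ) (u v : ℤ → ℝ), (∀ j, |u (j + 1) - u j| ≤ R) →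
      (∀ j, |v (j + 1) - v j| ≤ R) → ∀ j, ∃ a b k : ℝ, δ ≤ a ∧ a ≤ L ∧ δ ≤ b ∧ b ≤ L ∧ |k| ≤ L ∧
        force W V f t u j - force W V f t v j =
          a * (u (j + 1) - v (j + 1)) + b * (u (j - 1) - v (j - 1)) + k * (u j - v j) := by
  obtain ⟨L, hL⟩ := h.coupling R
  obtain ⟨M, hM⟩ := h.pot_lip
  have hM0 : 0 ≤ M := by
    obtain ⟨k, hk, -⟩ := hM 0 0
    exact (abs_nonneg _).trans hk
  refine ⟨2 * |L| + M, by positivity, fun t u v hu hv j => ?_⟩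
  obtain ⟨a, ha, haL, ha'⟩ := hL _ _ (hu j) (hv j)
  have hu' := hu (j - 1)
  have hv' := hv (j - 1)
  rw [sub_add_cancel] at hu' hv'
  obtain ⟨b, hb, hbL, hb'⟩ := hL _ _ hu' hv'
  obtain ⟨k, hk, hk'⟩ := hM (u j) (v j)
  have := h.pos
  have hLL := le_abs_self L
  have hk2 := abs_le.1 hk
  refine ⟨a, b, k - a - b, ha, by linarith, hb, by linarith, abs_le.2 ⟨by linarith, by linarith⟩, ?_⟩
  unfold force
  linear_combination ha' - hb' + hk'

theorem IsSolution.continuousOn {u : ℝ → ℤ → ℝ} (hu : IsSolution W V f u) (j : ℤ) :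
    ContinuousOn (fun t => u t j) (Ici 0) :=
  fun t ht => (hu.hasDeriv t ht j).continuousWithinAt

theorem IsSolution.exists_hasWidth {u : ℝ → ℤ → ℝ} {K : ℝ} (hu : IsSolution W V f u)
    (h0 : HasWidth ρ K (u 0)) (τ : ℝ) : ∃ K, ∀ t ∈ Icc 0 τ, HasWidth ρ K (u t) := by
  obtain ⟨ρ', h⟩ := hu.width
  obtain ⟨K', hK'⟩ := h 0
  have : HasWidth ρ' K' (u 0) := hK' 0 ⟨le_rfl, le_rfl⟩
  obtain rfl := h0.spacing_unique this
  obtain ⟨K, hK⟩ := h τ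
  exact ⟨K, hK⟩

theorem IsSolution.exists_dist_le {u v : ℝ → ℤ → ℝ} {K K' : ℝ} (hu : IsSolution W V f u)
    (hv : IsSolution W V f v) (hu0 : HasWidth ρ K (u 0)) (hv0 : HasWidth ρ K' (v 0)) (τ : ℝ) :
    ∃ B, ∀ t ∈ Icc 0 τ, ∀ j, |u t j - v t j| ≤ B := by
  obtain ⟨K₁, h₁⟩ := hu.exists_hasWidth hu0 τ
  obtain ⟨K₂, h₂⟩ := hv.exists_hasWidth hv0 τ
  have hc : ContinuousOn (fun t => u t 0 - v t 0) (Icc 0 τ) :=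
    ((hu.continuousOn 0).sub (hv.continuousOn 0)).mono fun t ht => ht.1
  obtain ⟨M, hM⟩ := isCompact_Icc.exists_bound_of_continuousOn hc
  refine ⟨K₁ + K₂ + M, fun t ht j => ?_⟩
  have e1 := h₁ t ht j 0
  have e2 := h₂ t ht j 0
  have e3 := hM t ht
  rw [Real.norm_eq_abs] at e3
  rw [abs_le] at *
  constructor <;> linarith [e1.1, e1.2, e2.1, e2.2, e3.1, e3.2]

/-- Solutions with the same mean spacing are ordered if their initial values are; the estimate
allows for an additional weight. -/
theorem Admissible.sub_le_weight (h : Admissible W V f δ C) {R τ : ℝ} :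
    ∃ Λ : ℝ, ∀ (u v : ℝ → ℤ → ℝ) (K K' : ℝ), IsSolution W V f u → IsSolution W V f v →
      HasWidth ρ K (u 0) → HasWidth ρ K' (v 0) →
      (∀ t ∈ Icc 0 τ, ∀ j, |u t (j + 1) - u t j| ≤ R) →
      (∀ t ∈ Icc 0 τ, ∀ j, |v t (j + 1) - v t j| ≤ R) →
      ∀ ε : ℝ, 0 ≤ ε → (∀ j : ℤ, u 0 j - v 0 j ≤ ε * 2 ^ j.natAbs) →
      ∀ t ∈ Icc 0 τ, ∀ j : ℤ, u t j - v t j ≤ ε * 2 ^ j.natAbs * Real.exp (Λ * t) := by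
  obtain ⟨L, hL, hlin⟩ := h.exists_linearization R
  have hδ := h.pos
  -- The weight `2 ^ |j|` at most doubles at a neighbour, so `ε * 2 ^ |j| * exp (5 * L * t)` is a
  -- supersolution: `5 * L = 2 * L + 2 * L + L`. The exponent depends on the solutions only through
  -- `R`, which later gives continuity for pointwise convergence.
  refine ⟨5 * L, fun u v K K' hu hv hu0 hv0 huR hvR ε hε h0 => ?_⟩
  obtain ⟨B, hB⟩ := hu.exists_dist_le hv hu0 hv0 τ
  have hexp : ∀ s : ℝ, HasDerivAt (fun s => Real.exp (5 * L * s))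
      (Real.exp (5 * L * s) * (5 * L)) s := by
    intro s
    simpa using ((hasDerivAt_id s).const_mul (5 * L)).exp
  have hd : ∀ j : ℤ, ∀ t ∈ Ici (0 : ℝ), HasDerivWithinAt
      (fun s => u s j - v s j - ε * 2 ^ j.natAbs * Real.exp (5 * L * s))
      (force W V f t (u t) j - force W V f t (v t) j -
        ε * 2 ^ j.natAbs * (Real.exp (5 * L * t) * (5 * L))) (Ici 0) t := fun j t ht =>
    ((hu.hasDeriv t ht j).sub (hv.hasDeriv t ht j)).sub
      ((hexp t).hasDerivWithinAt.const_mul _)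
  have hpow : ∀ i j : ℤ, j.natAbs ≤ i.natAbs + 1 → (2 : ℝ) ^ j.natAbs ≤ 2 * 2 ^ i.natAbs := by
    intro i j hij
    rw [← pow_succ']
    exact pow_le_pow_right₀ (by norm_num) hij
  have key := nonpos_of_subsolution (I := univ) (τ := τ) (L := L) (B := B)
    (y := fun t j => u t j - v t j - ε * 2 ^ j.natAbs * Real.exp (5 * L * t))
    (y' := fun t j => force W V f t (u t) j - force W V f t (v t) j -
        ε * 2 ^ j.natAbs * (Real.exp (5 * L * t) * (5 * L)))
    hL (fun j _ t ht => (hd j t ht.1).continuousWithinAt.mono fun s hs => hs.1)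
    (fun j _ t ht => (hd j t ht.1).mono (Ici_subset_Ici.2 ht.1)) ?_ ?_ ?_ (by simp)
  · intro t ht j
    have := key t ht j
    linarith
  · intro j _ t ht
    have ht' : t ∈ Icc 0 τ := ⟨ht.1, ht.2.le⟩
    obtain ⟨a, b, k, ha, haL, hb, hbL, hk, he⟩ := hlin t (u t) (v t) (huR t ht') (hvR t ht') j
    refine ⟨a, b, k, by linarith, haL, by linarith, hbL, hk, ?_⟩
    rw [he]
    have p1 := hpow j (j + 1) (by omega)
    have p2 := hpow j (j - 1) (by omega)
    set P : ℝ := 2 ^ j.natAbs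
    have hP : 0 ≤ P := by positivity
    have hE := (Real.exp_pos (5 * L * t)).le
    set E := Real.exp (5 * L * t)
    have hk2 := abs_le.1 hk
    have q1 : a * (2 : ℝ) ^ (j + 1).natAbs ≤ L * (2 * P) :=
      mul_le_mul haL p1 (by positivity) hL
    have q2 : b * (2 : ℝ) ^ (j - 1).natAbs ≤ L * (2 * P) :=
      mul_le_mul hbL p2 (by positivity) hL
    have q3 : k * P ≤ L * P := mul_le_mul_of_nonneg_right hk2.2 hP
    have q4 := mul_le_mul_of_nonneg_left (add_le_add (add_le_add q1 q2) q3)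
      (mul_nonneg hε hE)
    linarith
  · intro t ht j
    have := (abs_le.1 (hB t ht j)).2
    have : 0 ≤ ε * 2 ^ j.natAbs * Real.exp (5 * L * t) := by positivity
    linarith
  · intro j _
    have := h0 j
    simp only [mul_zero, Real.exp_zero, mul_one]
    linarith

theorem Admissible.le_of_le (h : Admissible W V f δ C) {u v : ℝ → ℤ → ℝ} {K K' : ℝ}
    (hu : IsSolution W V f u) (hv : IsSolution W V f v)
    (hu0 : HasWidth ρ K (u 0)) (hv0 : HasWidth ρ K' (v 0)) (h0 : ∀ j, u 0 j ≤ v 0 j)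
    {t : ℝ} (ht : 0 ≤ t) (j : ℤ) : u t j ≤ v t j := by
  obtain ⟨K₁, h₁⟩ := hu.exists_hasWidth hu0 t
  obtain ⟨K₂, h₂⟩ := hv.exists_hasWidth hv0 t
  obtain ⟨Λ, hΛ⟩ := h.sub_le_weight (ρ := ρ) (R := |ρ| + max K₁ K₂) (τ := t)
  have := hΛ u v K K' hu hv hu0 hv0
    (fun s hs j => ((h₁ s hs).mono (le_max_left _ _)).increment_le j)
    (fun s hs j => ((h₂ s hs).mono (le_max_right _ _)).increment_le j) 0 le_rfl
    (fun j => by simpa using h0 j) t ⟨ht, le_rfl⟩ j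
  simpa using this

theorem Admissible.solution_unique (h : Admissible W V f δ C) {u v : ℝ → ℤ → ℝ} {K : ℝ}
    (hu : IsSolution W V f u) (hv : IsSolution W V f v)
    (hu0 : HasWidth ρ K (u 0)) (h0 : u 0 = v 0) {t : ℝ} (ht : 0 ≤ t) : u t = v t := by
  have hv0 : HasWidth ρ K (v 0) := h0 ▸ hu0
  ext j
  exact le_antisymm (h.le_of_le hu hv hu0 hv0 (fun j => by rw [h0]) ht j)
    (h.le_of_le hv hu hv0 hu0 (fun j => by rw [h0]) ht j)

end

/-! ### Existence of solutions of bounded width. -/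

section

theorem exists_clamp_slope (l r p q : ℝ) : ∃ θ : ℝ, 0 ≤ θ ∧ θ ≤ 1 ∧
    max l (min p r) - max l (min q r) = θ * (p - q) := by
  have hmono : Monotone fun x : ℝ => max l (min x r) := by
    intro x y hxy
    simp only
    gcongr
  have hlip : ∀ x y : ℝ, x ≤ y → max l (min y r) - max l (min x r) ≤ y - x := by
    intro x y hxy
    rcases le_total y r with h1 | h1 <;> rcases le_total x r with h2 | h2 <;>
      simp only [h1, h2, min_eq_left, min_eq_right, max_def] <;> split_ifs <;> linarith
  rcases lt_trichotomy p q with h | h | h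
  · refine ⟨(max l (min q r) - max l (min p r)) / (q - p), ?_, ?_, ?_⟩
    · exact div_nonneg (sub_nonneg.2 (hmono h.le)) (by linarith)
    · exact (div_le_one (by linarith)).2 (hlip _ _ h.le)
    · have : q - p ≠ 0 := by linarith
      field_simp
      ring
  · exact ⟨0, le_rfl, zero_le_one, by simp [h]⟩
  · refine ⟨(max l (min p r) - max l (min q r)) / (p - q), ?_, ?_, ?_⟩
    · exact div_nonneg (sub_nonneg.2 (hmono h.le)) (by linarith)
    · exact (div_le_one (by linarith)).2 (hlip _ _ h.le)
    · have : p - q ≠ 0 := by linarith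
      field_simp

variable {W V f : ℝ → ℝ} {δ C ρ : ℝ}

theorem Admissible.bound_nonneg (h : Admissible W V f δ C) : 0 ≤ C :=
  (abs_nonneg _).trans (h.pot_bdd 0)

theorem Admissible.exists_clamped_slope (h : Admissible W V f δ C) (R : ℝ) :
    ∃ L : ℝ, 0 < L ∧ ∀ l r p q : ℝ, |l| ≤ R → |r| ≤ R → ∃ a : ℝ, 0 ≤ a ∧ a ≤ L ∧
      deriv W (max l (min p r)) - deriv W (max l (min q r)) = a * (p - q) := by
  obtain ⟨L, hL⟩ := h.coupling R
  refine ⟨|L| + 1, by positivity, fun l r p q hl hr => ?_⟩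
  have hcl : ∀ p : ℝ, |max l (min p r)| ≤ R := by
    intro p
    rw [abs_le] at *
    exact ⟨hl.1.trans (le_max_left _ _), max_le hl.2 ((min_le_right _ _).trans hr.2)⟩
  obtain ⟨a, ha, haL, he⟩ := hL _ _ (hcl p) (hcl q)
  obtain ⟨θ, h0, h1, hθ⟩ := exists_clamp_slope l r p q
  have ha0 : 0 ≤ a := h.pos.le.trans ha
  refine ⟨a * θ, mul_nonneg ha0 h0, ?_, by rw [he, hθ, mul_assoc]⟩
  have := le_abs_self L
  nlinarith

/-- `W'` need not be globally Lipschitz, so the increments are first clamped to `[ρ - r t, ρ + r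
t]`, where `r t = 2 * K + 2 * C * t`. The clamped system has a global solution, whose width turns
out to be at most `r t`, so the clamp never acts. -/
theorem Admissible.exists_solution (h : Admissible W V f δ C) {K : ℝ} {u₀ : ℤ → ℝ}
    (hu₀ : HasWidth ρ K u₀) : ∃ u, IsSolution W V f u ∧ u 0 = u₀ ∧
      ∀ t, 0 ≤ t → HasWidth ρ (2 * K + 2 * C * t) (u t) := by
  have hK := hu₀.nonneg
  have hC := h.bound_nonneg
  set r : ℝ → ℝ := fun t => 2 * K + 2 * C * t with hr
  have hr0 : ∀ t, 0 ≤ t → 0 ≤ r t := fun t ht => by simp only [hr]; positivity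
  have hrmono : ∀ t τ, t ≤ τ → r t ≤ r τ := fun t τ htτ => by simp only [hr]; gcongr
  have hrlim : ∀ t ∈ Ici (0 : ℝ), ∀ τ, t ≤ τ → |ρ - r t| ≤ |ρ| + r τ ∧ |ρ + r t| ≤ |ρ| + r τ := by
    intro t ht τ htτ
    have h1 := hr0 t ht
    have h2 := hrmono t τ htτ
    have h3 := abs_sub ρ (r t)
    have h4 := abs_add_le ρ (r t)
    rw [abs_of_nonneg h1] at h3 h4
    constructor <;> linarith
  set w : ℝ → ℝ → ℝ := fun t p => deriv W (max (ρ - r t) (min p (ρ + r t))) with hw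
  set G : ℝ → (ℤ → ℝ) → ℤ → ℝ := fun t x j =>
    w t (x (j + 1) - x j) - w t (x j - x (j - 1)) + deriv V (x j) + f t with hG
  obtain ⟨M, hM⟩ := h.pot_lip
  have hM0 : 0 ≤ M := by
    obtain ⟨k, hk, -⟩ := hM 0 0
    exact (abs_nonneg _).trans hk
  have hex := exists_lattice_solution G u₀ ?_ ?_ ?_
  · obtain ⟨x, hx0, hxd, hxb⟩ := hex
    have hxc : ∀ j, ContinuousOn (fun t => x t j) (Ici 0) :=
      fun j t ht => (hxd t ht j).continuousWithinAt
    have hF : ∀ t : ℝ, HasDerivAt (fun s => ∫ q in (0 : ℝ)..s, f q) (f t) t := fun t =>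
      intervalIntegral.integral_hasDerivAt_right (h.contf.intervalIntegrable _ _)
        (h.contf.stronglyMeasurableAtFilter _ _) h.contf.continuousAt
    -- In the equally spaced configuration `j * ρ + u₀ 0 + ∫ f` the coupling forces cancel. The
    -- deviation from it obeys a cooperative system with source `V'`, bounded by `C`, and so stays
    -- within `K + C * t`; both signs come from `σ = ±1`. Two particles together give the width `2 *
    -- K + 2 * C * t`.
    have main : ∀ σ : ℝ, |σ| = 1 → ∀ t, 0 ≤ t → ∀ j : ℤ,
        σ * (x t j - j * ρ - u₀ 0 - ∫ q in (0 : ℝ)..t, f q) - K - C * t ≤ 0 := by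
      intro σ hσ τ hτ j
      have hσ2 : σ * σ = 1 := by rw [← abs_mul_abs_self, hσ, one_mul]
      obtain ⟨L, hL, hslope⟩ := h.exists_clamped_slope (|ρ| + r τ)
      obtain ⟨B, hB⟩ := hxb τ hτ
      obtain ⟨F, hFb⟩ := (isCompact_Icc (a := (0 : ℝ)) (b := τ)).exists_bound_of_continuousOn
        (fun t _ => (hF t).continuousAt.continuousWithinAt)
      have hd : ∀ j : ℤ, ∀ t ∈ Ici (0 : ℝ), HasDerivWithinAt
          (fun s => σ * (x s j - j * ρ - u₀ 0 - ∫ q in (0 : ℝ)..s, f q) - K - C * s)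
          (σ * (G t (x t) j - f t) - C) (Ici 0) t := by
        intro j t ht
        have h1 := (((((hxd t ht j).sub_const (j * ρ)).sub_const (u₀ 0)).sub
          (hF t).hasDerivWithinAt).const_mul σ).sub_const K
        have h2 := ((hasDerivAt_id t).const_mul C).hasDerivWithinAt (s := Ici 0)
        rw [mul_one] at h2
        exact h1.sub h2
      have hb0 : ∀ j : ℤ, |u₀ j - j * ρ - u₀ 0| ≤ K := by
        intro j
        have := hu₀ j 0
        push_cast at this
        rw [sub_zero] at this
        rwa [sub_right_comm] at this
      refine nonpos_of_subsolution (I := univ) (τ := τ) (L := 2 * L) (B := B + K + F)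
        (y := fun t j => σ * (x t j - j * ρ - u₀ 0 - ∫ q in (0 : ℝ)..t, f q) - K - C * t)
        (y' := fun t j => σ * (G t (x t) j - f t) - C) (by positivity)
        (fun j _ t ht => (hd j t ht.1).continuousWithinAt.mono fun s hs => hs.1)
        (fun j _ t ht => (hd j t ht.1).mono (Ici_subset_Ici.2 ht.1)) ?_ ?_ ?_ (by simp)
        τ ⟨hτ, le_rfl⟩ j
      · intro j _ t ht
        obtain ⟨l1, l2⟩ := hrlim t ht.1 τ ht.2.le
        obtain ⟨a, ha, haL, hae⟩ := hslope _ _ (x t (j + 1) - x t j) ρ l1 l2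
        obtain ⟨b, hb, hbL, hbe⟩ := hslope _ _ (x t j - x t (j - 1)) ρ l1 l2
        refine ⟨a, b, -(a + b), ha, by linarith, hb, by linarith, ?_, ?_⟩
        · rw [abs_neg, abs_of_nonneg (by linarith)]
          linarith
        · have hV : σ * deriv V (x t j) ≤ C := by
            refine (le_abs_self _).trans ?_
            rw [abs_mul, hσ, one_mul]
            exact h.pot_bdd _
          have e : G t (x t) j - f t = a * (x t (j + 1) - x t j - ρ) -
              b * (x t j - x t (j - 1) - ρ) + deriv V (x t j) := by
            simp only [hG, hw]
            linear_combination hae - hbe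
          rw [e]
          push_cast
          nlinarith
      · intro t ht j
        have h1 := hB t ht j
        have h2 := hFb t ht
        have h3 := hb0 j
        have h4 : |σ * (x t j - j * ρ - u₀ 0 - ∫ q in (0 : ℝ)..t, f q)| ≤ B + K + F := by
          rw [abs_mul, hσ, one_mul]
          rw [Real.norm_eq_abs] at h2
          rw [abs_le] at *
          constructor <;> linarith [h1.1, h1.2, h2.1, h2.2, h3.1, h3.2]
        have h5 := (abs_le.1 h4).2
        have h6 : 0 ≤ C * t := mul_nonneg hC ht.1
        linarith
      · intro j _
        have h4 : |σ * (u₀ j - j * ρ - u₀ 0)| ≤ K := by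
          rw [abs_mul, hσ, one_mul]
          exact hb0 j
        have h5 := (abs_le.1 h4).2
        simp only [hx0, intervalIntegral.integral_same, sub_zero, mul_zero]
        linarith
    have hwidth : ∀ t, 0 ≤ t → HasWidth ρ (2 * K + 2 * C * t) (x t) := by
      intro t ht m n
      have h1 := main 1 (by simp) t ht m
      have h2 := main 1 (by simp) t ht n
      have h3 := main (-1) (by simp) t ht m
      have h4 := main (-1) (by simp) t ht n
      rw [abs_le]
      constructor <;> linarith
    refine ⟨x, ⟨⟨ρ, fun τ => ⟨2 * K + 2 * C * τ, fun t ht => ?_⟩⟩, fun t ht j => ?_⟩, hx0, hwidth⟩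
    · exact (hwidth t ht.1).mono (hrmono t τ ht.2)
    · have hcl : ∀ i, w t (x t (i + 1) - x t i) = deriv W (x t (i + 1) - x t i) := by
        intro i
        have := abs_le.1 ((hwidth t ht).increment i)
        simp only [hw]
        rw [min_eq_left (by simp only [hr]; linarith), max_eq_right (by simp only [hr]; linarith)]
      have h2 := hcl (j - 1)
      rw [sub_add_cancel] at h2
      have h3 := hxd t ht j
      simp only [hG] at h3
      rw [hcl j, h2] at h3
      exact h3
  · intro τ hτ
    obtain ⟨L, hL, hslope⟩ := h.exists_clamped_slope (|ρ| + r τ)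
    refine ⟨4 * L + M + 1, by positivity, fun t ht p q D hD j => ?_⟩
    obtain ⟨l1, l2⟩ := hrlim t ht.1 τ ht.2
    obtain ⟨a, ha, haL, hae⟩ := hslope _ _ (p (j + 1) - p j) (q (j + 1) - q j) l1 l2
    obtain ⟨b, hb, hbL, hbe⟩ := hslope _ _ (p j - p (j - 1)) (q j - q (j - 1)) l1 l2
    obtain ⟨k, hk, hke⟩ := hM (p j) (q j)
    have hD0 : 0 ≤ D := (abs_nonneg _).trans (hD 0)
    have e : G t p j - G t q j = a * (p (j + 1) - q (j + 1)) + b * (p (j - 1) - q (j - 1)) +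
        (k - a - b) * (p j - q j) := by
      simp only [hG, hw]
      linear_combination hae - hbe + hke
    have hk2 : |k - a - b| ≤ 2 * L + M := by
      rw [abs_le] at *
      constructor <;> linarith [hk.1, hk.2]
    rw [e]
    refine (abs_add_three _ _ _).trans ?_
    rw [abs_mul, abs_mul, abs_mul, abs_of_nonneg ha, abs_of_nonneg hb]
    have e1 := mul_le_mul haL (hD (j + 1)) (abs_nonneg _) hL.le
    have e2 := mul_le_mul hbL (hD (j - 1)) (abs_nonneg _) hL.le
    have e3 := mul_le_mul hk2 (hD j) (abs_nonneg _) (by positivity)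
    nlinarith
  · intro x hx j
    have hcw : ∀ p : ℝ → ℝ, ContinuousOn p (Ici 0) →
        ContinuousOn (fun t => w t (p t)) (Ici 0) := by
      intro p hp
      refine h.contW.comp_continuousOn ?_
      have : Continuous r := by simp only [hr]; fun_prop
      exact ((continuous_const.sub this).continuousOn).sup
        (hp.inf (continuous_const.add this).continuousOn)
    exact (((hcw _ ((hx _).sub (hx _))).sub (hcw _ ((hx _).sub (hx _)))).add
      (h.contV.comp_continuousOn (hx j))).add h.contf.continuousOn
  · intro τ hτ
    obtain ⟨A, hA⟩ := (isCompact_Icc (a := -(|ρ| + r τ)) (b := |ρ| + r τ)).exists_bound_of_continuousOn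
      h.contW.continuousOn
    obtain ⟨F, hF⟩ := (isCompact_Icc (a := (0 : ℝ)) (b := τ)).exists_bound_of_continuousOn
      h.contf.continuousOn
    have hwb : ∀ t ∈ Icc 0 τ, ∀ p, |w t p| ≤ A := by
      intro t ht p
      obtain ⟨l1, l2⟩ := hrlim t ht.1 τ ht.2
      rw [abs_le] at l1 l2
      exact hA _ ⟨l1.1.trans (le_max_left _ _), max_le l1.2 ((min_le_right _ _).trans l2.2)⟩
    refine ⟨A + A + C + F, fun t ht j => ?_⟩
    have e1 := hwb t ht (u₀ (j + 1) - u₀ j)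
    have e2 := hwb t ht (u₀ j - u₀ (j - 1))
    have e3 := h.pot_bdd (u₀ j)
    have e4 := hF t ht
    rw [Real.norm_eq_abs] at e4
    simp only [hG]
    rw [abs_le] at *
    constructor <;> linarith [e1.1, e1.2, e2.1, e2.2, e3.1, e3.2, e4.1, e4.2]

end

/-! ### The flow: symmetries, strict monotonicity, continuity. -/

section

variable {W V f : ℝ → ℝ} {δ C ρ : ℝ}

open Classical in
/-- The solution with a given initial value. -/
def flow (W V f : ℝ → ℝ) (u : ℤ → ℝ) : ℝ → ℤ → ℝ :=
  if h : ∃ x, IsSolution W V f x ∧ x 0 = u then h.choose else fun _ => u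

theorem Admissible.flow_spec (h : Admissible W V f δ C) {K : ℝ} {u : ℤ → ℝ}
    (hu : HasWidth ρ K u) : IsSolution W V f (flow W V f u) ∧ flow W V f u 0 = u := by
  have hex : ∃ x, IsSolution W V f x ∧ x 0 = u := by
    obtain ⟨x, hx, hx0, -⟩ := h.exists_solution hu
    exact ⟨x, hx, hx0⟩
  rw [flow, dif_pos hex]
  exact hex.choose_spec

theorem Admissible.flow_isSolution (h : Admissible W V f δ C) {K : ℝ} {u : ℤ → ℝ}
    (hu : HasWidth ρ K u) : IsSolution W V f (flow W V f u) := (h.flow_spec hu).1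

theorem Admissible.flow_zero (h : Admissible W V f δ C) {K : ℝ} {u : ℤ → ℝ}
    (hu : HasWidth ρ K u) : flow W V f u 0 = u := (h.flow_spec hu).2

theorem Admissible.eq_flow (h : Admissible W V f δ C) {K : ℝ} {u : ℤ → ℝ}
    (hu : HasWidth ρ K u) {x : ℝ → ℤ → ℝ} (hx : IsSolution W V f x) (hx0 : x 0 = u)
    {t : ℝ} (ht : 0 ≤ t) : x t = flow W V f u t :=
  h.solution_unique hx (h.flow_isSolution hu) (hx0 ▸ hu) (by rw [hx0, h.flow_zero hu]) ht

theorem Admissible.flow_hasWidth (h : Admissible W V f δ C) {K : ℝ} {u : ℤ → ℝ}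
    (hu : HasWidth ρ K u) {t : ℝ} (ht : 0 ≤ t) :
    HasWidth ρ (2 * K + 2 * C * t) (flow W V f u t) := by
  obtain ⟨x, hx, hx0, hw⟩ := h.exists_solution hu
  rw [← h.eq_flow hu hx hx0 ht]
  exact hw t ht

theorem Admissible.flow_mono (h : Admissible W V f δ C) {K K' : ℝ} {u v : ℤ → ℝ}
    (hu : HasWidth ρ K u) (hv : HasWidth ρ K' v) (huv : ∀ j, u j ≤ v j) {t : ℝ} (ht : 0 ≤ t)
    (j : ℤ) : flow W V f u t j ≤ flow W V f v t j := by
  refine h.le_of_le (ρ := ρ) (h.flow_isSolution hu) (h.flow_isSolution hv) (K := K) (K' := K') ?_ ?_ ?_ ht j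
  · rwa [h.flow_zero hu]
  · rwa [h.flow_zero hv]
  · rwa [h.flow_zero hu, h.flow_zero hv]

theorem HasWidth.add_int {K : ℝ} {u : ℤ → ℝ} (hu : HasWidth ρ K u) (n : ℤ) :
    HasWidth ρ K (fun j => u j + n) := fun i j => by
  have := hu i j
  rwa [add_sub_add_right_eq_sub]

theorem HasWidth.translate {K : ℝ} {u : ℤ → ℝ} (hu : HasWidth ρ K u) (n : ℤ) :
    HasWidth ρ K (fun j => u (j + n)) := fun i j => by
  have := hu (i + n) (j + n)
  push_cast at this
  rwa [add_sub_add_right_eq_sub] at this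

theorem Admissible.flow_add_int (h : Admissible W V f δ C) {K : ℝ} {u : ℤ → ℝ}
    (hu : HasWidth ρ K u) (n : ℤ) {t : ℝ} (ht : 0 ≤ t) :
    flow W V f (fun j => u j + n) t = fun j => flow W V f u t j + n := by
  have hs := h.flow_isSolution hu
  refine (h.eq_flow (hu.add_int n) (x := fun t j => flow W V f u t j + n) ⟨?_, ?_⟩ ?_ ht).symm
  · obtain ⟨r, hr⟩ := hs.width
    refine ⟨r, fun τ => ?_⟩
    obtain ⟨K, hK⟩ := hr τ
    exact ⟨K, fun t ht => (show HasWidth r K _ from hK t ht).add_int n⟩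
  · intro t ht j
    have h1 := (hs.hasDeriv t ht j).add_const (n : ℝ)
    have e : force W V f t (fun j => flow W V f u t j + n) j = force W V f t (flow W V f u t) j := by
      simp only [force, h.pot_per, add_sub_add_right_eq_sub]
    rwa [e]
  · rw [h.flow_zero hu]

theorem Admissible.flow_translate (h : Admissible W V f δ C) {K : ℝ} {u : ℤ → ℝ}
    (hu : HasWidth ρ K u) (n : ℤ) {t : ℝ} (ht : 0 ≤ t) :
    flow W V f (fun j => u (j + n)) t = fun j => flow W V f u t (j + n) := by
  have hs := h.flow_isSolution hu
  refine (h.eq_flow (hu.translate n) (x := fun t j => flow W V f u t (j + n)) ⟨?_, ?_⟩ ?_ ht).symm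
  · obtain ⟨r, hr⟩ := hs.width
    refine ⟨r, fun τ => ?_⟩
    obtain ⟨K, hK⟩ := hr τ
    exact ⟨K, fun t ht => (show HasWidth r K _ from hK t ht).translate n⟩
  · intro t ht j
    have h1 := hs.hasDeriv t ht (j + n)
    have e : force W V f t (fun j => flow W V f u t (j + n)) j =
        force W V f t (flow W V f u t) (j + n) := by
      simp only [force, add_right_comm j 1 n, show j - 1 + n = j + n - 1 by ring]
    rwa [e]
  · rw [h.flow_zero hu]

theorem IsSolution.exists_linearization (h : Admissible W V f δ C) {u v : ℝ → ℤ → ℝ} {K K' : ℝ}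
    (hu : IsSolution W V f u) (hv : IsSolution W V f v)
    (hu0 : HasWidth ρ K (u 0)) (hv0 : HasWidth ρ K' (v 0)) (τ : ℝ) :
    ∃ L : ℝ, 0 ≤ L ∧ ∀ t ∈ Icc 0 τ, ∀ j, ∃ a b k : ℝ, δ ≤ a ∧ a ≤ L ∧ δ ≤ b ∧ b ≤ L ∧ |k| ≤ L ∧
        force W V f t (u t) j - force W V f t (v t) j =
          a * (u t (j + 1) - v t (j + 1)) + b * (u t (j - 1) - v t (j - 1)) +
            k * (u t j - v t j) := by
  obtain ⟨K₁, h₁⟩ := hu.exists_hasWidth hu0 τ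
  obtain ⟨K₂, h₂⟩ := hv.exists_hasWidth hv0 τ
  obtain ⟨L, hL, hlin⟩ := h.exists_linearization (|ρ| + max K₁ K₂)
  exact ⟨L, hL, fun t ht j => hlin t _ _
    (fun j => ((h₁ t ht).mono (le_max_left _ _)).increment_le j)
    (fun j => ((h₂ t ht).mono (le_max_right _ _)).increment_le j) j⟩

/-- Strict inequalities propagate in time and to the right neighbour. -/
theorem Admissible.lt_of_le_of_lt (h : Admissible W V f δ C) {u v : ℝ → ℤ → ℝ} {K K' : ℝ}
    (hu : IsSolution W V f u) (hv : IsSolution W V f v)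
    (hu0 : HasWidth ρ K (u 0)) (hv0 : HasWidth ρ K' (v 0)) {τ : ℝ} {j : ℤ}
    (h1 : ∀ t ∈ Icc 0 τ, u t (j - 1) ≤ v t (j - 1)) (h2 : ∀ t ∈ Icc 0 τ, u t j ≤ v t j)
    (h3 : ∀ t ∈ Icc 0 τ, u t (j + 1) ≤ v t (j + 1))
    (h4 : u 0 j < v 0 j ∨ ∀ t ∈ Ioo 0 τ, u t (j - 1) < v t (j - 1)) (hτ : 0 < τ) :
    u τ j < v τ j := by
  obtain ⟨L, hL, hlin⟩ := hu.exists_linearization h hv hu0 hv0 τ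
  have hδ := h.pos
  -- The factor `exp (L * s)` absorbs the diagonal term, so the weighted difference cannot increase.
  -- It strictly decreases while the left neighbour is strictly ordered, because that neighbour acts
  -- with strength at least `δ > 0`.
  have hd : ∀ t ∈ Ioo 0 τ, ∃ d, HasDerivAt (fun s => Real.exp (L * s) * (u s j - v s j)) d t ∧
      d ≤ 0 ∧ (u t (j - 1) < v t (j - 1) → d < 0) := by
    intro t ht
    have hexp : HasDerivAt (fun s => Real.exp (L * s)) (Real.exp (L * t) * L) t := by
      simpa using ((hasDerivAt_id t).const_mul L).exp
    have ht' : t ∈ Icc 0 τ := ⟨ht.1.le, ht.2.le⟩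
    have e1 := (hu.hasDeriv t ht.1.le j).hasDerivAt (Ici_mem_nhds ht.1)
    have e2 := (hv.hasDeriv t ht.1.le j).hasDerivAt (Ici_mem_nhds ht.1)
    obtain ⟨a, b, k, ha, haL, hb, hbL, hk, he⟩ := hlin t ht' j
    have hd := hexp.mul (e1.sub e2)
    have g1 := h1 t ht'
    have g2 := h2 t ht'
    have g3 := h3 t ht'
    have hk2 := abs_le.1 hk
    have hE := Real.exp_pos (L * t)
    have q1 : a * (u t (j + 1) - v t (j + 1)) ≤ 0 :=
      mul_nonpos_of_nonneg_of_nonpos (by linarith) (by linarith)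
    have q2 : b * (u t (j - 1) - v t (j - 1)) ≤ 0 :=
      mul_nonpos_of_nonneg_of_nonpos (by linarith) (by linarith)
    have q3 : (L + k) * (u t j - v t j) ≤ 0 :=
      mul_nonpos_of_nonneg_of_nonpos (by linarith) (by linarith)
    have e : Real.exp (L * t) * L * (u t j - v t j) +
        Real.exp (L * t) * (force W V f t (u t) j - force W V f t (v t) j) =
        Real.exp (L * t) * (a * (u t (j + 1) - v t (j + 1)) + b * (u t (j - 1) - v t (j - 1)) +
            (L + k) * (u t j - v t j)) := by rw [he]; ring
    refine ⟨_, hd, ?_, fun hlt => ?_⟩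
    · refine e.trans_le ?_
      exact mul_nonpos_of_nonneg_of_nonpos hE.le (by linarith)
    · refine e.trans_lt ?_
      have : b * (u t (j - 1) - v t (j - 1)) < 0 :=
        mul_neg_of_pos_of_neg (by linarith) (by linarith)
      exact mul_neg_of_pos_of_neg hE (by linarith)
  have hcont : ContinuousOn (fun s => Real.exp (L * s) * (u s j - v s j)) (Icc 0 τ) :=
    (by fun_prop : Continuous fun s => Real.exp (L * s)).continuousOn.mul
      (((hu.continuousOn j).sub (hv.continuousOn j)).mono fun s hs => hs.1)
  have hz0 : Real.exp (L * 0) * (u 0 j - v 0 j) = u 0 j - v 0 j := by simp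
  have l0 : (0 : ℝ) ∈ Icc 0 τ := ⟨le_rfl, hτ.le⟩
  have lτ : τ ∈ Icc 0 τ := ⟨hτ.le, le_rfl⟩
  have hfin : Real.exp (L * τ) * (u τ j - v τ j) < 0 := by
    rcases h4 with h4 | h4
    · have := antitoneOn_of_deriv_nonpos (convex_Icc 0 τ) hcont
        (fun t ht => by
          rw [interior_Icc] at ht
          obtain ⟨d, hd, -⟩ := hd t ht
          exact hd.differentiableAt.differentiableWithinAt)
        (fun t ht => by
          rw [interior_Icc] at ht
          obtain ⟨d, hd, hd', -⟩ := hd t ht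
          rwa [hd.deriv]) l0 lτ hτ.le
      simp only [hz0] at this
      linarith
    · have := strictAntiOn_of_deriv_neg (convex_Icc 0 τ) hcont
        (fun t ht => by
          rw [interior_Icc] at ht
          obtain ⟨d, hd, -, hd'⟩ := hd t ht
          rw [hd.deriv]
          exact hd' (h4 t ht)) l0 lτ hτ
      simp only [hz0] at this
      have := h2 0 l0
      linarith
  have := neg_of_mul_neg_right hfin (Real.exp_pos _).le
  linarith

theorem Admissible.flow_strictMono (h : Admissible W V f δ C) {K K' : ℝ} {u v : ℤ → ℝ}
    (hu : HasWidth ρ K u) (hv : HasWidth ρ K' v) (huv : ∀ j, u j < v j) {t : ℝ} (ht : 0 ≤ t)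
    (j : ℤ) : flow W V f u t j < flow W V f v t j := by
  rcases ht.eq_or_lt with rfl | ht'
  · rw [h.flow_zero hu, h.flow_zero hv]
    exact huv j
  have hm : ∀ s ∈ Icc 0 t, ∀ i, flow W V f u s i ≤ flow W V f v s i := fun s hs i =>
    h.flow_mono hu hv (fun i => (huv i).le) hs.1 i
  refine h.lt_of_le_of_lt (ρ := ρ) (h.flow_isSolution hu) (h.flow_isSolution hv) (K := K) (K' := K') ?_ ?_
    (fun s hs => hm s hs _) (fun s hs => hm s hs _) (fun s hs => hm s hs _) (Or.inl ?_) ht'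
  · rwa [h.flow_zero hu]
  · rwa [h.flow_zero hv]
  · rw [h.flow_zero hu, h.flow_zero hv]
    exact huv j

theorem Admissible.flow_close (h : Admissible W V f δ C) (ρ K τ : ℝ) :
    ∃ Λ : ℝ, ∀ u v : ℤ → ℝ, HasWidth ρ K u → HasWidth ρ K v → ∀ ε : ℝ, 0 ≤ ε →
      (∀ j : ℤ, |u j - v j| ≤ ε * 2 ^ j.natAbs) → ∀ t ∈ Icc 0 τ, ∀ j : ℤ,
      |flow W V f u t j - flow W V f v t j| ≤ ε * 2 ^ j.natAbs * Real.exp (Λ * t) := by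
  obtain ⟨Λ, hΛ⟩ := h.sub_le_weight (ρ := ρ) (R := |ρ| + (2 * K + 2 * C * τ)) (τ := τ)
  have hinc : ∀ u, HasWidth ρ K u → ∀ t ∈ Icc 0 τ, ∀ j,
      |flow W V f u t (j + 1) - flow W V f u t j| ≤ |ρ| + (2 * K + 2 * C * τ) := by
    intro u hu t ht j
    refine ((h.flow_hasWidth hu ht.1).mono ?_).increment_le j
    have := mul_le_mul_of_nonneg_left ht.2 h.bound_nonneg
    linarith
  have key : ∀ u v : ℤ → ℝ, HasWidth ρ K u → HasWidth ρ K v → ∀ ε : ℝ, 0 ≤ ε →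
      (∀ j : ℤ, u j - v j ≤ ε * 2 ^ j.natAbs) → ∀ t ∈ Icc 0 τ, ∀ j : ℤ,
      flow W V f u t j - flow W V f v t j ≤ ε * 2 ^ j.natAbs * Real.exp (Λ * t) := by
    intro u v hu hv ε hε huv
    refine hΛ _ _ K K (h.flow_isSolution hu) (h.flow_isSolution hv) ?_ ?_ (hinc u hu) (hinc v hv)
      ε hε ?_
    · rwa [h.flow_zero hu]
    · rwa [h.flow_zero hv]
    · rwa [h.flow_zero hu, h.flow_zero hv]
  refine ⟨Λ, fun u v hu hv ε hε huv t ht j => abs_le.2 ⟨?_, ?_⟩⟩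
  · have := key v u hv hu ε hε (fun j => by linarith [(abs_le.1 (huv j)).1]) t ht j
    linarith
  · exact key u v hu hv ε hε (fun j => (abs_le.1 (huv j)).2) t ht j

/-- The flow is continuous on configurations of uniformly bounded width, with respect to pointwise
convergence. -/
theorem Admissible.flow_continuousOn (h : Admissible W V f δ C) (ρ K τ : ℝ) (j : ℤ) :
    ContinuousOn (fun p : (ℤ → ℝ) × ℝ => flow W V f p.1 p.2 j)
      ({u | HasWidth ρ K u} ×ˢ Icc 0 τ) := by
  obtain ⟨Λ, hΛ⟩ := h.flow_close ρ K τ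
  rintro ⟨u, t⟩ ⟨hu : HasWidth ρ K u, ht : t ∈ Icc 0 τ⟩
  have hK := hu.nonneg
  rw [ContinuousWithinAt, Metric.tendsto_nhds]
  intro ε hε
  obtain ⟨η, hη, hη'⟩ : ∃ η : ℝ, 0 < η ∧ η * 2 ^ j.natAbs * Real.exp (|Λ| * τ) < ε / 2 := by
    have hP : 0 < 2 ^ j.natAbs * Real.exp (|Λ| * τ) := by positivity
    refine ⟨ε / 4 / (2 ^ j.natAbs * Real.exp (|Λ| * τ)), by positivity, ?_⟩
    rw [mul_assoc, div_mul_cancel₀ _ hP.ne']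
    linarith
  -- Beyond distance `J` the weight exceeds the a priori bound: closeness at particle 0 and the
  -- common width give `|q.1 i - u i| ≤ η + 2 * K`. Thus closeness at finitely many particles is
  -- closeness in the weighted norm.
  obtain ⟨J, hJ⟩ : ∃ J : ℕ, (η + 2 * K) / η < 2 ^ J := pow_unbounded_of_one_lt _ (by norm_num)
  rw [div_lt_iff₀ hη] at hJ
  have ev1 : ∀ᶠ q : (ℤ → ℝ) × ℝ in 𝓝 (u, t), ∀ i ∈ Finset.Icc (-(J : ℤ)) J, |q.1 i - u i| < η := by
    rw [Filter.eventually_all_finset]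
    intro i _
    have : Tendsto (fun q : (ℤ → ℝ) × ℝ => q.1 i) (𝓝 (u, t)) (𝓝 (u i)) :=
      (by fun_prop : Continuous fun q : (ℤ → ℝ) × ℝ => q.1 i).tendsto (u, t)
    exact (Metric.tendsto_nhds.1 this) η hη
  have ev2 : ∀ᶠ q : (ℤ → ℝ) × ℝ in 𝓝[{u | HasWidth ρ K u} ×ˢ Icc 0 τ] (u, t),
      dist (flow W V f u q.2 j) (flow W V f u t j) < ε / 2 := by
    have h1 : Tendsto (fun s => flow W V f u s j) (𝓝[Icc 0 τ] t) (𝓝 (flow W V f u t j)) :=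
      ((h.flow_isSolution hu).continuousOn j t ht.1).mono fun s hs => hs.1
    have h2 : Tendsto (fun q : (ℤ → ℝ) × ℝ => q.2) (𝓝[{u | HasWidth ρ K u} ×ˢ Icc 0 τ] (u, t))
        (𝓝[Icc 0 τ] t) :=
      tendsto_nhdsWithin_iff.2 ⟨(continuous_snd.tendsto (u, t)).mono_left nhdsWithin_le_nhds,
        eventually_mem_nhdsWithin.mono fun q hq => hq.2⟩
    exact (Metric.tendsto_nhds.1 (h1.comp h2)) (ε / 2) (by positivity)
  filter_upwards [self_mem_nhdsWithin, mem_nhdsWithin_of_mem_nhds ev1, ev2] with q hq h1 h2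
  have hq1 : HasWidth ρ K q.1 := hq.1
  have hclose : ∀ i : ℤ, |q.1 i - u i| ≤ η * 2 ^ i.natAbs := by
    intro i
    by_cases hi : i ∈ Finset.Icc (-(J : ℤ)) J
    · refine (h1 i hi).le.trans ?_
      have : (1 : ℝ) ≤ 2 ^ i.natAbs := one_le_pow₀ (by norm_num)
      nlinarith
    · have hJi : J ≤ i.natAbs := by
        rw [Finset.mem_Icc] at hi
        omega
      have h3 : (2 : ℝ) ^ J ≤ 2 ^ i.natAbs := pow_le_pow_right₀ (by norm_num) hJi
      have h4 := h1 0 (by rw [Finset.mem_Icc]; omega)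
      have h5 := hq1 i 0
      have h6 := hu i 0
      have h7 : |q.1 i - u i| ≤ η + 2 * K := by
        rw [abs_lt] at h4
        rw [abs_le] at *
        constructor <;> linarith [h5.1, h5.2, h6.1, h6.2, h4.1, h4.2]
      nlinarith
  have h3 := hΛ q.1 u hq1 hu η hη.le hclose q.2 hq.2 j
  have h4 : Real.exp (Λ * q.2) ≤ Real.exp (|Λ| * τ) := by
    refine Real.exp_le_exp.2 ((mul_le_mul_of_nonneg_right (le_abs_self Λ) hq.2.1).trans ?_)
    exact mul_le_mul_of_nonneg_left hq.2.2 (abs_nonneg _)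
  have h5 : η * 2 ^ j.natAbs * Real.exp (Λ * q.2) ≤ η * 2 ^ j.natAbs * Real.exp (|Λ| * τ) :=
    mul_le_mul_of_nonneg_left h4 (by positivity)
  have h6 := dist_triangle (flow W V f q.1 q.2 j) (flow W V f u q.2 j) (flow W V f u t j)
  rw [Real.dist_eq (flow W V f q.1 q.2 j) (flow W V f u q.2 j)] at h6
  linarith

end

/-! ### The quotient state space, its Borel section `rep`, and the time-one map. -/

section

variable {W V f : ℝ → ℝ} {δ C ρ : ℝ}

/-- The configuration given by a sequence of bounded width. -/
def HasWidth.config {K : ℝ} {u : ℤ → ℝ} (hu : HasWidth ρ K u) : Config := ⟨u, ρ, K, hu⟩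

/-- Adding an integer constant to a configuration. -/
def addInt (n : ℤ) (u : Config) : Config :=
  ⟨fun j => u.1 j + n, by
    obtain ⟨ρ, K, h⟩ := u.2
    exact ⟨ρ, K, HasWidth.add_int h n⟩⟩

/-- The configuration `j ↦ u (j + n)`. -/
def translateConfig (n : ℤ) (u : Config) : Config :=
  ⟨fun j => u.1 (j + n), by
    obtain ⟨ρ, K, h⟩ := u.2
    exact ⟨ρ, K, HasWidth.translate h n⟩⟩

theorem continuous_coord (j : ℤ) : Continuous fun u : Config => u.1 j :=
  (continuous_apply j).comp continuous_subtype_val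

theorem continuous_config {X : Type*} [TopologicalSpace X] {g : X → Config}
    (hg : ∀ j, Continuous fun x => (g x).1 j) : Continuous g :=
  Continuous.subtype_mk (continuous_pi hg) fun x => (g x).2

theorem proj_eq_iff {u v : Config} : proj u = proj v ↔ ∃ n : ℤ, ∀ j, v.1 j = u.1 j + n :=
  Quotient.eq (r := configSetoid)

theorem proj_surjective (x : StateSpace) : ∃ u, proj u = x := Quotient.exists_rep x

theorem proj_addInt (n : ℤ) (u : Config) : proj (addInt n u) = proj u :=
  (proj_eq_iff.2 ⟨n, fun _ => rfl⟩).symm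

theorem continuous_proj : Continuous proj := continuous_quotient_mk'

theorem isQuotientMap_proj : IsQuotientMap proj := isQuotientMap_quotient_mk'

theorem isOpenMap_proj : IsOpenMap proj := by
  intro U hU
  have h : proj ⁻¹' (proj '' U) = ⋃ n : ℤ, addInt n ⁻¹' U := by
    ext v
    simp only [mem_preimage, mem_image, mem_iUnion]
    constructor
    · rintro ⟨u, hu, huv⟩
      obtain ⟨n, hn⟩ := proj_eq_iff.1 huv.symm
      refine ⟨n, ?_⟩
      have : addInt n v = u := Subtype.ext (funext fun j => (hn j).symm)
      rwa [this]
    · rintro ⟨n, hn⟩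
      exact ⟨_, hn, proj_addInt n v⟩
  refine isQuotientMap_proj.isOpen_preimage.1 ?_
  rw [h]
  refine isOpen_iUnion fun n => hU.preimage (continuous_config fun j => ?_)
  exact (continuous_coord j).add continuous_const

/-- Second countability ensures that the support of a measure carries it. -/
instance : SecondCountableTopology StateSpace :=
  haveI : SecondCountableTopology Config :=
    TopologicalSpace.Subtype.secondCountableTopology {u : ℤ → ℝ | ∃ ρ : ℝ, BoundedWidth ρ u}
  isQuotientMap_proj.secondCountableTopology isOpenMap_proj

/-- The spatial translation by `n` on the state space. -/
def translate (n : ℤ) : StateSpace → StateSpace :=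
  Quotient.map (translateConfig n) (by
    rintro u v ⟨k, h⟩
    exact ⟨k, fun j => h (j + n)⟩)

theorem translate_proj (n : ℤ) (u : Config) : translate n (proj u) = proj (translateConfig n u) :=
  rfl

theorem continuous_translate (n : ℤ) : Continuous (translate n) :=
  isQuotientMap_proj.continuous_iff.2
    (continuous_proj.comp (continuous_config fun j => continuous_coord (j + n)))

theorem shift_eq_translate : shift = translate (-1) := rfl

theorem translate_translate (m n : ℤ) (x : StateSpace) :
    translate m (translate n x) = translate (m + n) x := by
  obtain ⟨u, rfl⟩ := proj_surjective x
  simp only [translate_proj]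
  congr 1
  exact Subtype.ext (funext fun j => congrArg u.1 (add_assoc j m n))

theorem translate_zero (x : StateSpace) : translate 0 x = x := by
  obtain ⟨u, rfl⟩ := proj_surjective x
  rw [translate_proj]
  congr 1
  exact Subtype.ext (funext fun j => congrArg u.1 (add_zero j))

/-- The spatial translation as a homeomorphism. -/
def shiftHomeomorph : StateSpace ≃ₜ StateSpace where
  toFun := shift
  invFun := translate 1
  left_inv x := by
    rw [shift_eq_translate, translate_translate, show (1 : ℤ) + -1 = 0 by norm_num, translate_zero]
  right_inv x := by
    rw [shift_eq_translate, translate_translate, show (-1 : ℤ) + 1 = 0 by norm_num, translate_zero]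
  continuous_toFun := continuous_translate (-1)
  continuous_invFun := continuous_translate 1

theorem shift_proj (u : Config) : shift (proj u) = proj (translateConfig (-1) u) := rfl

theorem coordZero_proj (u : Config) : coordZero (proj u) = ((u.1 0 : ℝ) : UnitAddCircle) := rfl

theorem continuous_coordZero : Continuous coordZero :=
  isQuotientMap_proj.continuous_iff.2 ((AddCircle.continuous_mk' 1).comp (continuous_coord 0))

/-- The distance of the particle `j` from the particle `0`. -/
def relCoord (j : ℤ) : StateSpace → ℝ :=
  Quotient.lift (fun u : Config => u.1 j - u.1 0) (by
    rintro u v ⟨n, h⟩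
    simp only [h, add_sub_add_right_eq_sub])

theorem continuous_relCoord (j : ℤ) : Continuous (relCoord j) :=
  isQuotientMap_proj.continuous_iff.2 ((continuous_coord j).sub (continuous_coord 0))

/-- The representative whose particle `0` lies in `[0, 1)`. -/
def rep (x : StateSpace) : ℤ → ℝ := fun j => AddCircle.equivIco 1 0 (coordZero x) + relCoord j x

theorem rep_proj (u : Config) (j : ℤ) : rep (proj u) j = u.1 j + ((-⌊u.1 0⌋ : ℤ) : ℝ) := by
  have h : (AddCircle.equivIco 1 0 (coordZero (proj u)) : ℝ) = Int.fract (u.1 0 / 1) * 1 :=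
    AddCircle.coe_equivIco_mk_apply 1 (u.1 0)
  have h2 : relCoord j (proj u) = u.1 j - u.1 0 := rfl
  rw [rep, h, h2, div_one, mul_one, Int.fract]
  push_cast
  ring

theorem rep_proj_eq (u : Config) : ∃ n : ℤ, rep (proj u) = fun j => u.1 j + n :=
  ⟨_, funext fun j => rep_proj u j⟩

theorem rep_zero_mem (x : StateSpace) : rep x 0 ∈ Ico (0 : ℝ) 1 := by
  obtain ⟨u, rfl⟩ := proj_surjective x
  rw [rep_proj]
  push_cast
  exact ⟨Int.fract_nonneg (u.1 0), Int.fract_lt_one (u.1 0)⟩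

theorem exists_proj_rep (x : StateSpace) : ∃ u : Config, u.1 = rep x ∧ proj u = x := by
  obtain ⟨u, rfl⟩ := proj_surjective x
  obtain ⟨n, hn⟩ := rep_proj_eq u
  exact ⟨addInt n u, hn.symm, proj_addInt n u⟩

theorem measurable_rep : Measurable rep := by
  refine measurable_pi_lambda _ fun j => ?_
  exact (measurable_subtype_coe.comp ((AddCircle.measurableEquivIco 1 0).measurable.comp
    continuous_coordZero.measurable)).add (continuous_relCoord j).measurable

theorem rep_translate (n : ℤ) (x : StateSpace) :
    ∃ k : ℤ, rep (translate n x) = fun j => rep x (j + n) + k := by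
  obtain ⟨u, hu, rfl⟩ := exists_proj_rep x
  rw [← hu]
  exact rep_proj_eq (translateConfig n u)

theorem mem_withSpacing_iff {x : StateSpace} : x ∈ withSpacing ρ ↔ ∃ K, HasWidth ρ K (rep x) := by
  constructor
  · rintro ⟨u, rfl, K, hK⟩
    obtain ⟨n, hn⟩ := rep_proj_eq u
    rw [hn]
    exact ⟨K, HasWidth.add_int hK n⟩
  · rintro ⟨K, hK⟩
    obtain ⟨u, hu, hx⟩ := exists_proj_rep x
    exact ⟨u, hx, K, hu ▸ hK⟩

/-- On classes of bounded width, the time-one map is induced by the flow. -/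
theorem Admissible.timeOne_proj (h : Admissible W V f δ C) {K : ℝ} {u : Config}
    (hu : HasWidth ρ K u.1) :
    timeOne W V f (proj u) = proj (h.flow_hasWidth hu zero_le_one).config := by
  have hev : ∃ y, Evolves W V f 1 (proj u) y :=
    ⟨_, flow W V f u.1, u, (h.flow_hasWidth hu zero_le_one).config, h.flow_isSolution hu,
      (h.flow_zero hu).symm, rfl, rfl, rfl⟩
  rw [timeOne, evolution, dif_pos hev]
  -- The chosen solution may start at another representative; it differs from `u` by an integer,
  -- which the flow transports unchanged, so uniqueness fixes the final class.
  obtain ⟨x, a, b, hx, ha, hb, hpa, hpb⟩ := hev.choose_spec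
  rw [← hpb]
  obtain ⟨n, hn⟩ := proj_eq_iff.1 hpa.symm
  have ha' : a.1 = fun j => u.1 j + n := funext hn
  refine (proj_eq_iff.2 ⟨n, fun j => ?_⟩).symm
  have h1 : x 1 = flow W V f a.1 1 := by
    refine h.eq_flow (ρ := ρ) (K := K) ?_ hx ha.symm zero_le_one
    rw [ha']
    exact hu.add_int n
  rw [hb, h1, ha', h.flow_add_int hu n zero_le_one]
  rfl

theorem Admissible.rep_timeOne (h : Admissible W V f δ C) {K : ℝ} {x : StateSpace}
    (hx : HasWidth ρ K (rep x)) :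
    ∃ n : ℤ, rep (timeOne W V f x) = fun j => flow W V f (rep x) 1 j + n := by
  obtain ⟨u, hu, rfl⟩ := exists_proj_rep x
  rw [← hu] at hx ⊢
  rw [h.timeOne_proj hx]
  exact rep_proj_eq _

end

/-! ### The support of a synchronized measure as a foliation with a common hull function. -/

section

variable {W V f : ℝ → ℝ} {δ C ρ : ℝ}

/-- The configuration with hull function `ψ`, mean spacing `ρ` and phase `c`. -/
def leaf (ψ : ℝ ≃o ℝ) (ρ c : ℝ) (j : ℤ) : ℝ := ψ (c + j * ρ)

theorem pos_of_mul_pos_succ {d : ℤ → ℝ} (h : ∀ j, 0 < d (j + 1) * d j) {i : ℤ} (hi : 0 < d i)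
    (j : ℤ) : 0 < d j := by
  induction j using Int.inductionOn' (b := i) with
  | zero => exact hi
  | succ k _ ih => exact pos_of_mul_pos_left (h k) ih.le
  | pred k _ ih =>
    have := h (k - 1)
    rw [sub_add_cancel] at this
    exact pos_of_mul_pos_right this ih.le

/-- A totally ordered, translation invariant family of configurations parametrized by the position
of the particle `0`, with irrational mean spacing and without wandering intervals, consists of the
configurations with a common hull function. -/
theorem exists_hull_function (hρ : Irrational ρ) {Γ : Set (ℤ → ℝ)}
    (hord : ∀ u ∈ Γ, ∀ v ∈ Γ, u = v ∨ ∀ j, 0 < (v (j + 1) - u (j + 1)) * (v j - u j))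
    (hex : ∀ x : ℝ, ∃ u ∈ Γ, u 0 = x)
    (htr : ∀ u ∈ Γ, ∀ n : ℤ, (fun j => u (j + n)) ∈ Γ)
    (hint : ∀ u ∈ Γ, ∀ n : ℤ, (fun j => u j + n) ∈ Γ)
    (hsp : ∃ u ∈ Γ, ∃ K, HasWidth ρ K u)
    (hrec : ∀ x y : ℝ, x < y → ∃ u ∈ Γ, u 0 ∈ Ioo x y ∧
      ∃ m : ℤ, m ≠ 0 ∧ ∃ n : ℤ, u m + n ∈ Ioo x y) :
    ∃ ψ : ℝ ≃o ℝ, (∀ c, ψ (c + 1) = ψ c + 1) ∧ Γ = range (leaf ψ ρ) := by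
  choose γ hγ hγ0 using hex
  have huniq : ∀ u ∈ Γ, u = γ (u 0) := by
    intro u hu
    rcases hord u hu _ (hγ (u 0)) with h | h
    · exact h
    · have := h 0
      rw [hγ0, sub_self, mul_zero] at this
      exact absurd this (lt_irrefl _)
  have hlt : ∀ x y, x < y → ∀ j, γ x j < γ y j := by
    intro x y hxy j
    rcases hord _ (hγ x) _ (hγ y) with h | h
    · have := congrFun h 0
      rw [hγ0, hγ0] at this
      exact absurd this hxy.ne
    · have := pos_of_mul_pos_succ (d := fun j => γ y j - γ x j) h (i := 0)
        (by rw [hγ0, hγ0]; linarith) j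
      linarith
  have htrans : ∀ u ∈ Γ, ∀ j n, u (j + n) = γ (u j) n := by
    intro u hu j n
    have := congrFun (huniq _ (htr u hu j)) n
    simp only [zero_add] at this
    rw [← this, add_comm]
  -- An element of the ordered family is determined by the position of its particle 0, and `G n`
  -- maps this position to that of particle `n`. Translation invariance makes `n ↦ G n` an action of
  -- `ℤ`; bounded width gives `G 1` the translation number `ρ`.
  let G : ℤ → CircleDeg1Lift := fun n =>
    { toFun := fun x => γ x n
      monotone' := fun x y hxy => by
        rcases hxy.eq_or_lt with rfl | h
        · exact le_rfl
        · exact (hlt x y h n).le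
      map_add_one' := fun x => by
        have := congrFun (huniq _ (hint _ (hγ x) 1)) n
        simp only [hγ0, Int.cast_one] at this
        exact this.symm }
  have hG : ∀ n x, G n x = γ x n := fun n x => rfl
  have hGG : ∀ m n x, G m (G n x) = G (n + m) x := fun m n x => by
    rw [hG, hG, hG, htrans _ (hγ x) n m]
  have hG0 : ∀ x, G 0 x = x := fun x => hγ0 x
  have hunit : IsUnit (G 1) := by
    refine CircleDeg1Lift.isUnit_iff_bijective.2 (Function.bijective_iff_has_inverse.2
      ⟨G (-1), fun x => ?_, fun x => ?_⟩)
    · rw [hGG, show (1 : ℤ) + -1 = 0 by norm_num, hG0]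
    · rw [hGG, show (-1 : ℤ) + 1 = 0 by norm_num, hG0]
  have hpow : ∀ (n : ℕ) (x : ℝ), (G 1 ^ n) x = G n x := by
    intro n
    induction n with
    | zero => intro x; rw [Nat.cast_zero, hG0]; rfl
    | succ n ih =>
      intro x
      rw [pow_succ', CircleDeg1Lift.mul_apply, ih, hGG]
      push_cast
      rfl
  have hτ : (G 1).translationNumber = ρ := by
    obtain ⟨u, hu, K, hK⟩ := hsp
    refine tendsto_nhds_unique ((G 1).tendsto_translationNumber (u 0)) ?_
    have hb : ∀ n : ℕ, 0 < n → |((G 1 ^ n) (u 0) - u 0) / n - ρ| ≤ K / n := by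
      intro n hn
      have hn' : (0 : ℝ) < n := by exact_mod_cast hn
      have h1 := hK n 0
      rw [show u n = (G 1 ^ n) (u 0) by rw [hpow, hG, ← huniq u hu]] at h1
      push_cast at h1
      rw [sub_zero] at h1
      have : ((G 1 ^ n) (u 0) - u 0) / n - ρ = ((G 1 ^ n) (u 0) - u 0 - n * ρ) / n := by
        field_simp
      rw [this, abs_div, abs_of_pos hn']
      exact div_le_div_of_nonneg_right h1 hn'.le
    rw [tendsto_iff_norm_sub_tendsto_zero]
    refine squeeze_zero' (Eventually.of_forall fun n => norm_nonneg _)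
      ((eventually_gt_atTop 0).mono hb) (tendsto_const_div_atTop_nhds_zero_nat K)
  -- Poincaré's theorem: `F` semiconjugates `G 1` to the translation by `ρ`, so it assigns a phase
  -- to each position. The hull function will be its inverse.
  obtain ⟨F, hF⟩ := CircleDeg1Lift.semiconj_of_isUnit_of_translationNumber_eq hunit
    (CircleDeg1Lift.translate (Multiplicative.ofAdd ρ)).isUnit
    (hτ.trans (CircleDeg1Lift.translationNumber_translate ρ).symm)
  have hF1 : ∀ x, F (G 1 x) = ρ + F x := fun x => hF x
  have hFu : ∀ u ∈ Γ, ∀ j : ℤ, F (u j) = F (u 0) + j * ρ := by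
    intro u hu j
    have step : ∀ k : ℤ, F (u (k + 1)) = ρ + F (u k) := fun k => by
      rw [htrans u hu k 1, ← hG, hF1]
    induction j using Int.induction_on with
    | zero => simp
    | succ k ih => rw [step, ih]; push_cast; ring
    | pred k ih =>
      have := step (-k - 1)
      rw [sub_add_cancel, ih] at this
      push_cast at this ⊢
      linarith
  -- The range contains a translate of the dense group `ℤρ + ℤ`, and a monotone map with dense range
  -- is continuous.
  have hdense : DenseRange F := by
    have h1 : Dense (AddSubgroup.closure {ρ, 1} : Set ℝ) :=
      dense_addSubgroupClosure_pair_iff.2 (by rwa [div_one])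
    have h2 : Dense ((fun y => F 0 + y) '' (AddSubgroup.closure {ρ, 1} : Set ℝ)) :=
      (Homeomorph.addLeft (F 0)).surjective.denseRange.dense_image
        (Homeomorph.addLeft (F 0)).continuous h1
    refine h2.mono ?_
    rintro _ ⟨y, hy, rfl⟩
    obtain ⟨a, b, rfl⟩ := AddSubgroup.mem_closure_pair.1 hy
    refine ⟨γ 0 a + b, ?_⟩
    rw [F.map_add_int, hFu _ (hγ 0), hγ0]
    simp only [zsmul_eq_mul, mul_one]
    ring
  have hcont : Continuous F := F.monotone.continuous_of_denseRange hdense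
  have hsurj : Function.Surjective F := hcont.surjective F.tendsto_atTop F.tendsto_atBot
  -- If `F` were constant on an interval, a configuration returning to it, with both `u 0` and `u m
  -- + n` inside and `m ≠ 0`, would make `m * ρ` an integer.
  have hmono : StrictMono F := by
    intro x y hxy
    refine (F.monotone hxy.le).lt_of_ne fun heq => ?_
    have hconst : ∀ z ∈ Ioo x y, F z = F x := fun z hz =>
      le_antisymm ((F.monotone hz.2.le).trans heq.ge) (F.monotone hz.1.le)
    obtain ⟨u, hu, hu0, m, hm, n, hmn⟩ := hrec x y hxy
    have h1 := hconst _ hmn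
    rw [F.map_add_int, hFu u hu, hconst _ hu0] at h1
    have h2 : (m : ℝ) * ρ = ((-n : ℤ) : ℝ) := by push_cast; linarith
    exact (hρ.intCast_mul hm).ne_int _ h2
  let Φ := hmono.orderIsoOfSurjective F hsurj
  have hΦ : ∀ x, Φ x = F x := fun x => rfl
  refine ⟨Φ.symm, fun c => ?_, ?_⟩
  · rw [Φ.symm_apply_eq, hΦ, F.map_add_one, ← hΦ, Φ.apply_symm_apply]
  · have hleaf : ∀ u ∈ Γ, u = leaf Φ.symm ρ (F (u 0)) := by
      intro u hu
      ext j
      rw [leaf, ← hFu u hu j, ← hΦ, Φ.symm_apply_apply]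
    refine Subset.antisymm (fun u hu => ⟨_, (hleaf u hu).symm⟩) ?_
    rintro _ ⟨c, rfl⟩
    have h1 := hleaf _ (hγ (Φ.symm c))
    rw [hγ0, ← hΦ, Φ.apply_symm_apply] at h1
    rw [← h1]
    exact hγ _

theorem map_mem_support_of_measurePreserving {X : Type*} [TopologicalSpace X] [MeasurableSpace X]
    [OpensMeasurableSpace X] {μ : Measure X} {T : X → X} (hT : MeasurePreserving T μ μ)
    (hc : Continuous T) {x : X} (hx : x ∈ μ.support) : T x ∈ μ.support := by
  rw [Measure.support_eq_forall_isOpen] at hx ⊢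
  intro U hU hUo
  rw [← hT.measure_preimage hUo.measurableSet.nullMeasurableSet]
  exact hx _ hU (hUo.preimage hc)

/-- A monotone function commuting with a dense group of translations is a translation. -/
theorem monotone_eq_add_of_dense {H : ℝ → ℝ} (hH : Monotone H) {s : Set ℝ} (hs : Dense s)
    (hcomm : ∀ a ∈ s, H a = H 0 + a) (c : ℝ) : H c = c + H 0 := by
  rcases lt_trichotomy (H c) (c + H 0) with h | h | h
  · obtain ⟨a, ha, h1, h2⟩ := hs.exists_between (show H c - H 0 < c by linarith)
    have := hH h2.le
    rw [hcomm a ha] at this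
    linarith
  · exact h
  · obtain ⟨a, ha, h1, h2⟩ := hs.exists_between (show c < H c - H 0 by linarith)
    have := hH h1.le
    rw [hcomm a ha] at this
    linarith

theorem hull_add_int {ψ : ℝ ≃o ℝ} (hψ : ∀ c, ψ (c + 1) = ψ c + 1) (c : ℝ) (n : ℤ) :
    ψ (c + n) = ψ c + n := by
  induction n using Int.induction_on with
  | zero => simp
  | succ k ih => push_cast at *; rw [← add_assoc, hψ, ih, add_assoc]
  | pred k ih =>
    have := hψ (c + ((-(k : ℤ) - 1 : ℤ) : ℝ))
    push_cast at *
    rw [show c + (-(k : ℝ) - 1) + 1 = c + -k by ring, ih] at this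
    linarith

theorem abs_hull_sub_le {ψ : ℝ ≃o ℝ} (hψ : ∀ c, ψ (c + 1) = ψ c + 1) (c : ℝ) :
    |ψ c - c| ≤ |ψ 0| + 1 := by
  have h1 := hull_add_int hψ (Int.fract c) ⌊c⌋
  rw [Int.fract_add_floor] at h1
  have h2 : ψ 0 ≤ ψ (Int.fract c) := ψ.monotone (Int.fract_nonneg c)
  have h3 : ψ (Int.fract c) ≤ ψ (0 + 1) := ψ.monotone (by linarith [Int.fract_lt_one c])
  rw [hψ] at h3
  have h4 := Int.fract_add_floor c
  have h5 := Int.fract_nonneg c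
  have h6 := Int.fract_lt_one c
  have h7 := le_abs_self (ψ 0)
  have h8 := neg_abs_le (ψ 0)
  rw [abs_le]
  constructor <;> linarith

theorem hasWidth_leaf {ψ : ℝ ≃o ℝ} (hψ : ∀ c, ψ (c + 1) = ψ c + 1) (ρ c : ℝ) :
    HasWidth ρ (2 * (|ψ 0| + 1)) (leaf ψ ρ c) := by
  intro m n
  have h1 := abs_le.1 (abs_hull_sub_le hψ (c + m * ρ))
  have h2 := abs_le.1 (abs_hull_sub_le hψ (c + n * ρ))
  unfold leaf
  rw [abs_le]
  constructor <;> linarith [h1.1, h1.2, h2.1, h2.2]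

theorem leaf_translate (ψ : ℝ ≃o ℝ) (ρ c : ℝ) (n : ℤ) :
    (fun j => leaf ψ ρ c (j + n)) = leaf ψ ρ (c + n * ρ) := by
  ext j
  unfold leaf
  push_cast
  congr 1
  ring

theorem leaf_add_int {ψ : ℝ ≃o ℝ} (hψ : ∀ c, ψ (c + 1) = ψ c + 1) (ρ c : ℝ) (n : ℤ) :
    (fun j => leaf ψ ρ c j + n) = leaf ψ ρ (c + n) := by
  ext j
  unfold leaf
  rw [← hull_add_int hψ, add_right_comm]

theorem continuous_leaf (ψ : ℝ ≃o ℝ) (ρ : ℝ) : Continuous fun c => leaf ψ ρ c :=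
  continuous_pi fun j => ψ.continuous.comp (by fun_prop)

theorem leaf_strictMono (ψ : ℝ ≃o ℝ) (ρ : ℝ) {c c' : ℝ} (h : c < c') (j : ℤ) :
    leaf ψ ρ c j < leaf ψ ρ c' j := ψ.strictMono (by linarith)

theorem HasWidth.isClosed (ρ K : ℝ) : IsClosed {u : ℤ → ℝ | HasWidth ρ K u} := by
  simp only [HasWidth, ofPred_forall]
  exact isClosed_iInter fun m => isClosed_iInter fun n =>
    isClosed_le (by fun_prop) continuous_const

/-- The support of a synchronized measure in the depinned phase is foliated by configurations with
a common hull function, which drift uniformly. -/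
theorem Admissible.exists_foliation (h : Admissible W V f δ C) (hρ : Irrational ρ)
    {μ : Measure StateSpace} (hμ : IsSynchronized W V f ρ μ)
    (honto : coordZero '' μ.support = univ) :
    ∃ (ψ : ℝ ≃o ℝ) (α : ℝ), (∀ c, ψ (c + 1) = ψ c + 1) ∧
      (∀ c, flow W V f (leaf ψ ρ c) 1 = leaf ψ ρ (c + α)) ∧
      ∀ u : Config, proj u ∈ μ.support ↔ ∃ c, u.1 = leaf ψ ρ c := by
  have := hμ.prob
  have hshift : ∀ x ∈ μ.support, shift x ∈ μ.support := fun x hx =>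
    map_mem_support_of_measurePreserving hμ.shift (continuous_translate (-1)) hx
  have hunshift : ∀ x ∈ μ.support, translate 1 x ∈ μ.support := fun x hx =>
    map_mem_support_of_measurePreserving
      (hμ.shift.symm shiftHomeomorph.toMeasurableEquiv) (continuous_translate 1) hx
  have htransl : ∀ n : ℤ, ∀ x ∈ μ.support, translate n x ∈ μ.support := by
    intro n x hx
    induction n using Int.induction_on with
    | zero => rwa [translate_zero]
    | succ k ih =>
      rw [add_comm, ← translate_translate]
      exact hunshift _ ih
    | pred k ih =>
      rw [sub_eq_add_neg, add_comm, ← translate_translate]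
      exact hshift _ ih
  have hposopen : ∀ U : Set Config, IsOpen U → (∃ u ∈ U, proj u ∈ μ.support) →
      0 < μ (proj '' U) := by
    rintro U hU ⟨u, hu, hx⟩
    rw [Measure.support_eq_forall_isOpen] at hx
    exact hx _ (mem_image_of_mem _ hu) (isOpenMap_proj U hU)
  set Γ : Set (ℤ → ℝ) := {u | ∃ v : Config, v.1 = u ∧ proj v ∈ μ.support} with hΓ
  have hex : ∀ x : ℝ, ∃ u ∈ Γ, u 0 = x := by
    intro x
    obtain ⟨y, hy, hyx⟩ : ((x : ℝ) : UnitAddCircle) ∈ coordZero '' μ.support := by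
      rw [honto]
      trivial
    obtain ⟨u, rfl⟩ := proj_surjective y
    rw [coordZero_proj, ← sub_eq_zero, ← AddCircle.coe_sub, AddCircle.coe_eq_zero_iff] at hyx
    obtain ⟨n, hn⟩ := hyx
    rw [zsmul_eq_mul, mul_one] at hn
    refine ⟨_, ⟨addInt (-n) u, rfl, by rwa [proj_addInt]⟩, ?_⟩
    show u.1 0 + ((-n : ℤ) : ℝ) = x
    push_cast
    linarith
  have hord : ∀ u ∈ Γ, ∀ v ∈ Γ, u = v ∨ ∀ j, 0 < (v (j + 1) - u (j + 1)) * (v j - u j) := by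
    rintro _ ⟨u, rfl, hu⟩ _ ⟨v, rfl, hv⟩
    have := hμ.not_intersect u v hu hv
    unfold Intersect at this
    by_cases huv : u.1 = v.1
    · exact Or.inl huv
    · right
      intro j
      by_contra hj
      exact this ⟨huv, j, not_lt.1 hj⟩
  obtain ⟨ψ, hψ, hψΓ⟩ := exists_hull_function hρ hord hex
    (by
      rintro _ ⟨u, rfl, hu⟩ n
      exact ⟨translateConfig n u, rfl, htransl n _ hu⟩)
    (by
      rintro _ ⟨u, rfl, hu⟩ n
      exact ⟨addInt n u, rfl, by rwa [proj_addInt]⟩)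
    (by
      obtain ⟨x, ⟨u, rfl, K, hK⟩, hx⟩ := (hμ.spacing.and Measure.support_mem_ae).exists
      exact ⟨u.1, ⟨u, rfl, hx⟩, K, hK⟩)
    (by
      intro x y hxy
      have hUo : IsOpen {u : Config | u.1 0 ∈ Ioo x y} := isOpen_Ioo.preimage (continuous_coord 0)
      have hpos : 0 < μ (proj '' {u : Config | u.1 0 ∈ Ioo x y}) := by
        refine hposopen _ hUo ?_
        obtain ⟨_, ⟨u, rfl, hu⟩, hu0⟩ := hex ((x + y) / 2)
        exact ⟨u, by rw [mem_ofPred_eq, hu0]; constructor <;> linarith, hu⟩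
      have hs : μ (proj '' {u : Config | u.1 0 ∈ Ioo x y} ∩ μ.support) ≠ 0 := by
        rw [measure_inter_conull (mem_ae_iff.1 Measure.support_mem_ae)]
        exact hpos.ne'
      -- Poincaré recurrence for `S` excludes wandering intervals.
      obtain ⟨z, ⟨⟨u, hu, rfl⟩, hz⟩, m, hm, ⟨v, hv, hvm⟩, -⟩ := hμ.shift.exists_mem_iterate_mem
        ((isOpenMap_proj _ hUo).measurableSet.inter
          Measure.isClosed_support.measurableSet).nullMeasurableSet hs
      have hiter : ∀ m : ℕ, shift^[m] (proj u) = proj (translateConfig (-m) u) := by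
        intro m
        induction m with
        | zero => exact (translate_zero _).symm
        | succ m ih =>
          rw [Function.iterate_succ_apply', ih, ← translate_proj, shift_eq_translate,
            translate_translate, ← translate_proj]
          congr 1
          push_cast
          ring
      rw [hiter] at hvm
      obtain ⟨n, hn⟩ := proj_eq_iff.1 hvm.symm
      refine ⟨u.1, ⟨u, rfl, hz⟩, hu, -m, by simpa using hm, n, ?_⟩
      have := hn 0
      simp only [translateConfig, zero_add] at this
      rw [← this]
      exact hv)
  have hmem : ∀ u : Config, proj u ∈ μ.support ↔ ∃ c, u.1 = leaf ψ ρ c := by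
    intro u
    have h1 : u.1 ∈ Γ ↔ ∃ c, u.1 = leaf ψ ρ c := by
      rw [hψΓ]
      simp only [mem_range, eq_comm]
    rw [← h1]
    refine ⟨fun hu => ⟨u, rfl, hu⟩, ?_⟩
    rintro ⟨v, hv, hvm⟩
    rwa [← Subtype.ext hv]
  have hleafw := hasWidth_leaf hψ ρ
  set K := 2 * (|ψ 0| + 1)
  let Λ : ℝ → Config := fun c => (h.flow_hasWidth (hleafw c) zero_le_one).config
  have hΛ : ∀ c j, (Λ c).1 j = flow W V f (leaf ψ ρ c) 1 j := fun c j => rfl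
  have hΛc : Continuous Λ := by
    refine continuous_config fun j => ?_
    simp only [hΛ]
    exact (h.flow_continuousOn ρ K 1 j).comp_continuous
      (f := fun c => (leaf ψ ρ c, (1 : ℝ)))
      ((continuous_leaf ψ ρ).prodMk continuous_const)
      fun c => ⟨hleafw c, zero_le_one, le_rfl⟩
  -- Continuity of the flow is available only at uniformly bounded width, so invariance of the
  -- support under `T` is obtained along the leaves. The phases whose image stays in the support
  -- form a closed set, and a dense one, since every open set of phases has positive measure and
  -- almost every point of the support is mapped into it.
  have hclosed : IsClosed {c | proj (Λ c) ∈ μ.support} :=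
    Measure.isClosed_support.preimage (continuous_proj.comp hΛc)
  have hdense : Dense {c | proj (Λ c) ∈ μ.support} := by
    rw [dense_iff_inter_open]
    rintro U hU ⟨c, hc⟩
    obtain ⟨ε, hε, hball⟩ := Metric.isOpen_iff.1 hU c hc
    have hO : IsOpen {u : Config | ψ.symm (u.1 0) ∈ Metric.ball c ε} :=
      Metric.isOpen_ball.preimage (ψ.symm.continuous.comp (continuous_coord 0))
    have hpos : 0 < μ (proj '' {u : Config | ψ.symm (u.1 0) ∈ Metric.ball c ε}) := by
      refine hposopen _ hO ⟨(hleafw c).config, ?_, (hmem _).2 ⟨c, rfl⟩⟩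
      have : ψ.symm ((hleafw c).config.1 0) = c := by
        show ψ.symm (leaf ψ ρ c 0) = c
        simp [leaf]
      rw [mem_ofPred_eq, this]
      exact Metric.mem_ball_self hε
    have hae : ∀ᵐ x ∂μ, x ∈ μ.support ∧ timeOne W V f x ∈ μ.support := by
      have h1 : ∀ᵐ x ∂μ, x ∈ μ.support := Measure.support_mem_ae
      exact h1.and (hμ.time.quasiMeasurePreserving.ae h1)
    obtain ⟨x, ⟨u, hu, rfl⟩, hx, hTx⟩ :=
      ((frequently_ae_mem_iff.2 hpos.ne').and_eventually hae).exists
    obtain ⟨c', hc'⟩ := (hmem u).1 hx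
    refine ⟨c', hball ?_, ?_⟩
    · have : ψ.symm (u.1 0) = c' := by simp [hc', leaf]
      rwa [← this]
    · have huK : HasWidth ρ K u.1 := hc' ▸ hleafw c'
      rw [h.timeOne_proj huK] at hTx
      have : (h.flow_hasWidth huK zero_le_one).config = Λ c' :=
        Subtype.ext (by show flow W V f u.1 1 = flow W V f (leaf ψ ρ c') 1; rw [hc'])
      rwa [this] at hTx
  have hall : ∀ c, ∃ c', flow W V f (leaf ψ ρ c) 1 = leaf ψ ρ c' := by
    intro c
    have : c ∈ {c | proj (Λ c) ∈ μ.support} := by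
      rw [← hclosed.closure_eq, hdense.closure_eq]
      trivial
    exact (hmem (Λ c)).1 this
  choose H hH using hall
  have hinj : ∀ a b, leaf ψ ρ a = leaf ψ ρ b → a = b := by
    intro a b hab
    have := congrFun hab 0
    simpa [leaf] using this
  have hHmono : Monotone H := by
    intro a b hab
    rcases hab.eq_or_lt with rfl | hlt
    · exact le_rfl
    have h1 := h.flow_mono (hleafw a) (hleafw b) (fun j => (leaf_strictMono ψ ρ hlt j).le)
      zero_le_one 0
    rw [hH, hH] at h1
    simpa [leaf] using h1
  -- The flow commutes with spatial translations, which move the phase by `ρ`, and with integer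
  -- constants, which move it by 1.
  have hHcomm : ∀ a ∈ (AddSubgroup.closure {ρ, 1} : Set ℝ), H a = H 0 + a := by
    intro a ha
    obtain ⟨m, n, rfl⟩ := AddSubgroup.mem_closure_pair.1 ha
    apply hinj
    have h0 : ∀ c, leaf ψ ρ (c + (m * ρ + n)) = fun j => leaf ψ ρ c (j + m) + n := fun c => by
      rw [← add_assoc, ← leaf_add_int hψ, ← leaf_translate]
    rw [zsmul_eq_mul, zsmul_eq_mul, mul_one, h0, ← hH, ← hH, ← zero_add ((m : ℝ) * ρ + n), h0,
      h.flow_add_int ((hleafw 0).translate m) n zero_le_one,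
      h.flow_translate (hleafw 0) m zero_le_one]
  have hd : Dense (AddSubgroup.closure {ρ, 1} : Set ℝ) :=
    dense_addSubgroupClosure_pair_iff.2 (by rwa [div_one])
  refine ⟨ψ, H 0, hψ, fun c => ?_, hmem⟩
  rw [hH, monotone_eq_add_of_dense hHmono hd hHcomm c]

end

/-! ### A smoothed sign function and the dissipation of sign changes. -/

section

/-- The tent function. -/
def tent (x : ℝ) : ℝ := max 0 (1 - |x|)

/-- A primitive of the tent function, an odd smoothed sign function. -/
def softSign (x : ℝ) : ℝ := ∫ y in (0 : ℝ)..x, tent y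

theorem continuous_tent : Continuous tent := by unfold tent; fun_prop

theorem tent_nonneg (x : ℝ) : 0 ≤ tent x := le_max_left _ _

theorem tent_le_one (x : ℝ) : tent x ≤ 1 := max_le zero_le_one (by linarith [abs_nonneg x])

theorem tent_eq_zero {x : ℝ} (hx : 1 ≤ |x|) : tent x = 0 := max_eq_left (by linarith)

theorem half_le_tent {x : ℝ} (hx : |x| ≤ 1 / 2) : 1 / 2 ≤ tent x :=
  le_max_of_le_right (by linarith)

theorem hasDerivAt_softSign (x : ℝ) : HasDerivAt softSign (tent x) x :=
  intervalIntegral.integral_hasDerivAt_right (continuous_tent.intervalIntegrable _ _)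
    (continuous_tent.stronglyMeasurableAtFilter _ _) continuous_tent.continuousAt

theorem continuous_softSign : Continuous softSign :=
  continuous_iff_continuousAt.2 fun x => (hasDerivAt_softSign x).continuousAt

theorem softSign_mono : Monotone softSign :=
  monotone_of_hasDerivAt_nonneg hasDerivAt_softSign tent_nonneg

theorem softSign_zero : softSign 0 = 0 := intervalIntegral.integral_same

theorem softSign_neg (x : ℝ) : softSign (-x) = -softSign x := by
  have h := intervalIntegral.integral_comp_neg tent (a := 0) (b := x)
  have h2 : ∀ y, tent (-y) = tent y := fun y => by simp [tent]
  simp only [h2, neg_zero] at h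
  rw [softSign, intervalIntegral.integral_symm, ← h]
  rfl

theorem softSign_of_one_le {x : ℝ} (hx : 1 ≤ x) : softSign x = softSign 1 := by
  have h := intervalIntegral.integral_add_adjacent_intervals
    (continuous_tent.intervalIntegrable (μ := volume) 0 1)
    (continuous_tent.intervalIntegrable 1 x)
  have h0 : ∫ y in (1 : ℝ)..x, tent y = 0 := by
    refine (intervalIntegral.integral_congr (g := fun _ => 0) fun y hy => ?_).trans (by simp)
    rw [uIcc_of_le hx] at hy
    exact tent_eq_zero (hy.1.trans (le_abs_self y))
  rw [h0, add_zero] at h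
  exact h.symm

theorem softSign_of_le_neg_one {x : ℝ} (hx : x ≤ -1) : softSign x = -softSign 1 := by
  rw [← softSign_of_one_le (show 1 ≤ -x by linarith), softSign_neg, neg_neg]

theorem softSign_one_pos : 0 < softSign 1 := by
  refine intervalIntegral.intervalIntegral_pos_of_pos_on (continuous_tent.intervalIntegrable _ _)
    (fun x hx => ?_) zero_lt_one
  exact lt_max_of_lt_right (by rw [abs_of_pos hx.1]; linarith [hx.2])

theorem softSign_one_le : softSign 1 ≤ 1 := by
  have h := intervalIntegral.norm_integral_le_of_norm_le_const (a := 0) (b := 1) (C := 1) (f := tent)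
    fun x _ => by
      rw [Real.norm_of_nonneg (tent_nonneg x)]
      exact tent_le_one x
  rw [sub_zero, abs_one, mul_one] at h
  exact (le_abs_self _).trans h

theorem softSign_le (x : ℝ) : softSign x ≤ softSign 1 := by
  rcases le_total x 1 with h | h
  · exact softSign_mono h
  · exact (softSign_of_one_le h).le

theorem neg_le_softSign (x : ℝ) : -softSign 1 ≤ softSign x := by
  have := softSign_le (-x)
  rw [softSign_neg] at this
  linarith

theorem abs_softSign_le (x : ℝ) : |softSign x| ≤ 1 :=
  abs_le.2 ⟨by linarith [neg_le_softSign x, softSign_one_le],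
    (softSign_le x).trans softSign_one_le⟩

/-- The dissipation of the smoothed number of sign changes is nonnegative up to an error which is
small in the mean. -/
theorem neg_tent_le_dissipation {ε L a b k p q r : ℝ} (hε : 0 < ε) (ha : 0 ≤ a) (haL : a ≤ L)
    (hb : 0 ≤ b) (hbL : b ≤ L) (hk : |k| ≤ L) :
    -(4 * L * tent (r / ε)) ≤ tent (r / ε) / ε * (a * p + b * q + k * r) *
      (softSign (p / ε) + softSign (q / ε)) := by
  -- Where the tent does not vanish, `|r| < ε`, so the term `k * r` is only of order `ε`. It remains
  -- to bound the neighbour terms below, also up to order `ε`.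
  rcases le_or_gt 1 |r / ε| with hr | hr
  · rw [tent_eq_zero hr]
    simp
  have hL : 0 ≤ L := ha.trans haL
  rw [abs_div, abs_of_pos hε, div_lt_one hε] at hr
  have hm := softSign_one_pos
  have hm1 := softSign_one_le
  have hp1 := softSign_le (p / ε)
  have hp2 := neg_le_softSign (p / ε)
  have hq1 := softSign_le (q / ε)
  have hq2 := neg_le_softSign (q / ε)
  have sgn : ∀ y : ℝ, (0 ≤ y → 0 ≤ softSign (y / ε)) ∧ (y ≤ 0 → softSign (y / ε) ≤ 0) := by
    intro y
    refine ⟨fun hy => ?_, fun hy => ?_⟩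
    · rw [← softSign_zero]
      exact softSign_mono (div_nonneg hy hε.le)
    · rw [← softSign_zero]
      exact softSign_mono (div_nonpos_of_nonpos_of_nonneg hy hε.le)
  have sat : ∀ y : ℝ, (ε ≤ y → softSign (y / ε) = softSign 1) ∧
      (y ≤ -ε → softSign (y / ε) = -softSign 1) := by
    intro y
    refine ⟨fun hy => softSign_of_one_le ((one_le_div hε).2 hy), fun hy => ?_⟩
    exact softSign_of_le_neg_one ((div_le_iff₀ hε).2 (by linarith))
  -- For neighbours of equal sign the product is nonnegative at once. For opposite signs, suppose
  -- the sum of soft signs is nonnegative: either `q` is saturated, which forces the sum to be 0, or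
  -- `|q| < ε`, so `a * p + b * q` is at least `-L * ε`. A nonpositive sum is treated symmetrically.
  have main : ∀ p q a b : ℝ, 0 ≤ a → a ≤ L → 0 ≤ b → b ≤ L → 0 ≤ p → q ≤ 0 →
      -(2 * L * ε) ≤ (a * p + b * q) * (softSign (p / ε) + softSign (q / ε)) := by
    intro p q a b ha haL hb hbL hp hq
    have hp1 := softSign_le (p / ε)
    have hq2 := neg_le_softSign (q / ε)
    have sp := (sgn p).1 hp
    have sq := (sgn q).2 hq
    have hap := mul_nonneg ha hp
    have hbq := mul_nonpos_of_nonneg_of_nonpos hb hq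
    have hLε : 0 ≤ L * ε := by positivity
    rcases le_total 0 (softSign (p / ε) + softSign (q / ε)) with hS | hS
    · rcases le_or_gt q (-ε) with hqe | hqe
      · have : softSign (p / ε) + softSign (q / ε) = 0 := by
          rw [(sat q).2 hqe] at hS ⊢
          linarith
        rw [this, mul_zero]
        linarith
      · have h1 : -(L * ε) ≤ a * p + b * q := by nlinarith
        nlinarith
    · rcases le_or_gt ε p with hpe | hpe
      · have : softSign (p / ε) + softSign (q / ε) = 0 := by
          rw [(sat p).1 hpe] at hS ⊢
          linarith
        rw [this, mul_zero]
        linarith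
      · have h1 : a * p + b * q ≤ L * ε := by nlinarith
        nlinarith
  have hpq : -(2 * L * ε) ≤ (a * p + b * q) * (softSign (p / ε) + softSign (q / ε)) := by
    have hLε : 0 ≤ 2 * L * ε := by positivity
    rcases le_total 0 p with hp | hp <;> rcases le_total 0 q with hq | hq
    · have := mul_nonneg (add_nonneg (mul_nonneg ha hp) (mul_nonneg hb hq))
        (add_nonneg ((sgn p).1 hp) ((sgn q).1 hq))
      linarith
    · exact main p q a b ha haL hb hbL hp hq
    · have := main q p b a hb hbL ha haL hq hp
      rwa [add_comm (b * q), add_comm (softSign (q / ε))] at this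
    · have := mul_nonneg_of_nonpos_of_nonpos
        (add_nonpos (mul_nonpos_of_nonneg_of_nonpos ha hp) (mul_nonpos_of_nonneg_of_nonpos hb hq))
        (add_nonpos ((sgn p).2 hp) ((sgn q).2 hq))
      linarith
  have hkr : -(2 * L * ε) ≤ k * r * (softSign (p / ε) + softSign (q / ε)) := by
    have h1 : |k * r * (softSign (p / ε) + softSign (q / ε))| ≤ L * ε * 2 := by
      rw [abs_mul, abs_mul]
      refine mul_le_mul (mul_le_mul hk hr.le (abs_nonneg _) hL) ?_ (abs_nonneg _) (by positivity)
      exact abs_le.2 ⟨by linarith, by linarith⟩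
    linarith [(abs_le.1 h1).1]
  have hfin := mul_le_mul_of_nonneg_left (add_le_add hpq hkr)
    (div_nonneg (tent_nonneg (r / ε)) hε.le)
  have e : tent (r / ε) / ε * (-(2 * L * ε) + -(2 * L * ε)) = -(4 * L * tent (r / ε)) := by
    field_simp
    ring
  rw [e] at hfin
  linarith

variable {W V f : ℝ → ℝ} {δ C ρ : ℝ}

theorem Admissible.exists_force_bound (h : Admissible W V f δ C) (ρ K : ℝ) :
    ∃ D : ℝ, 0 ≤ D ∧ ∀ u, HasWidth ρ K u → ∀ t ∈ Icc (0 : ℝ) 1, ∀ j,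
      |force W V f t (flow W V f u t) j| ≤ D := by
  set R := |ρ| + (2 * K + 2 * C)
  obtain ⟨A, hA⟩ := (isCompact_Icc (a := -R) (b := R)).exists_bound_of_continuousOn
    h.contW.continuousOn
  obtain ⟨F, hF⟩ := (isCompact_Icc (a := (0 : ℝ)) (b := 1)).exists_bound_of_continuousOn
    h.contf.continuousOn
  refine ⟨|A + A + C + F|, abs_nonneg _, fun u hu t ht j => ?_⟩
  have hw : HasWidth ρ (2 * K + 2 * C) (flow W V f u t) := (h.flow_hasWidth hu ht.1).mono (by
    nlinarith [h.bound_nonneg, ht.2])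
  have h1 := hw.increment_le j
  have h2 := hw.increment_le (j - 1)
  rw [sub_add_cancel] at h2
  have e1 := hA _ (abs_le.1 h1)
  have e2 := hA _ (abs_le.1 h2)
  have e3 := h.pot_bdd (flow W V f u t j)
  have e4 := hF t ht
  rw [Real.norm_eq_abs] at e1 e2 e4
  refine le_trans ?_ (le_abs_self _)
  unfold force
  rw [abs_le] at *
  constructor <;> linarith [e1.1, e1.2, e2.1, e2.2, e3.1, e3.2, e4.1, e4.2]

theorem Admissible.abs_flow_sub_le (h : Admissible W V f δ C) {K D : ℝ} {u : ℤ → ℝ}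
    (hu : HasWidth ρ K u)
    (hD : ∀ t ∈ Icc (0 : ℝ) 1, ∀ j, |force W V f t (flow W V f u t) j| ≤ D) {s t : ℝ}
    (hs : s ∈ Icc (0 : ℝ) 1) (ht : t ∈ Icc (0 : ℝ) 1) (j : ℤ) :
    |flow W V f u t j - flow W V f u s j| ≤ D * |t - s| :=
  (convex_Icc (0 : ℝ) 1).norm_image_sub_le_of_norm_hasDerivWithin_le
    (f := fun r => flow W V f u r j)
    (fun r hr => ((h.flow_isSolution hu).hasDeriv r hr.1 j).mono fun _ hq => hq.1)
    (fun r hr => hD r hr j) hs ht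

/-- The graph of `x` touches the graph of `y` from below near the particle `j`. -/
def Touch (x y : ℝ → ℤ → ℝ) (j : ℤ) : Prop :=
  ∃ t₁ ∈ Ico (0 : ℝ) 1, ∃ t₂ ∈ Ioc t₁ 1, x t₁ j = y t₁ j ∧ x t₁ (j - 1) < y t₁ (j - 1) ∧
    ∀ t ∈ Icc t₁ t₂, x t (j + 1) ≤ y t (j + 1)

/-- At a touching the left neighbour pulls the gap down at a rate bounded away from zero, while the
gap needs a time of order `ε` to leave the window of the tent. The dissipation is thus of order `1 /
ε` during a time of order `ε`, and its integral stays at least `κ * θ` as `ε → 0`. -/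
theorem Touch.exists_dissipation (h : Admissible W V f δ C) {K : ℝ} {u v : ℤ → ℝ}
    (hu : HasWidth ρ K u) (hv : HasWidth ρ K v) {j : ℤ}
    (htouch : Touch (flow W V f u) (flow W V f v) j) :
    ∃ κ θ ε₀ s : ℝ, 0 < κ ∧ 0 < θ ∧ 0 < ε₀ ∧ 0 ≤ s ∧ ∀ ε : ℝ, 0 < ε → ε < ε₀ →
      s + θ * ε ≤ 1 ∧ ∀ t ∈ Icc s (s + θ * ε), κ / ε ≤
        tent ((flow W V f u t j - flow W V f v t j) / ε) / ε *
        (force W V f t (flow W V f u t) j - force W V f t (flow W V f v t) j) *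
        (softSign ((flow W V f u t (j + 1) - flow W V f v t (j + 1)) / ε) +
          softSign ((flow W V f u t (j - 1) - flow W V f v t (j - 1)) / ε)) := by
  obtain ⟨t₁, ht₁, t₂, ht₂, h0, hneg, hpos⟩ := htouch
  obtain ⟨D, hD0, hD⟩ := h.exists_force_bound ρ K
  obtain ⟨L, hL, hlin⟩ := (h.flow_isSolution hu).exists_linearization h (h.flow_isSolution hv)
    (ρ := ρ) (K := K) (K' := K) (by rwa [h.flow_zero hu]) (by rwa [h.flow_zero hv]) 1
  have hδ := h.pos
  have hm := softSign_one_pos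
  set x := flow W V f u
  set y := flow W V f v
  set η := (y t₁ (j - 1) - x t₁ (j - 1)) / 2 with hη
  have hη0 : 0 < η := by rw [hη]; linarith
  have hlip : ∀ t ∈ Icc t₁ 1, ∀ i,
      |(x t i - y t i) - (x t₁ i - y t₁ i)| ≤ 2 * D * (t - t₁) := by
    intro t ht i
    have l1 : t₁ ∈ Icc (0 : ℝ) 1 := ⟨ht₁.1, ht₁.2.le⟩
    have l2 : t ∈ Icc (0 : ℝ) 1 := ⟨ht₁.1.trans ht.1, ht.2⟩
    have e1 := h.abs_flow_sub_le hu (hD u hu) l1 l2 i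
    have e2 := h.abs_flow_sub_le hv (hD v hv) l1 l2 i
    rw [abs_of_nonneg (sub_nonneg.2 ht.1)] at e1 e2
    rw [abs_le] at *
    constructor <;> linarith [e1.1, e1.2, e2.1, e2.2]
  -- A gap changes at speed at most `2 * D`, so it moves by at most `ε / 2` during the time `θ * ε`.
  set θ := 1 / (4 * (D + 1)) with hθ
  have hθ0 : 0 < θ := by positivity
  have hDθ : 2 * D * θ ≤ 1 / 2 := by
    rw [hθ, mul_one_div, div_le_iff₀ (by positivity)]
    linarith
  -- The three bounds on `ε` keep the window inside `[t₁, t₂]`, keep the left gap below `-η ≤ -ε`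
  -- and so saturated, and keep the diagonal term below half of the pull `δ * η`. Then `κ` is the
  -- product of the tent value `1 / 2`, the speed `δ * η / 2` and `softSign 1`.
  refine ⟨δ * η * softSign 1 / 4, θ, min ((t₂ - t₁) / θ) (min η (δ * η / (L + 1))), t₁,
    by positivity, hθ0, ?_, ht₁.1, fun ε hε hε' => ?_⟩
  · have := ht₂.1
    exact lt_min (div_pos (by linarith) hθ0) (lt_min hη0 (by positivity))
  obtain ⟨i1, i2⟩ := lt_min_iff.1 hε'
  obtain ⟨i2, i3⟩ := lt_min_iff.1 i2
  rw [lt_div_iff₀ hθ0] at i1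
  rw [lt_div_iff₀ (by positivity)] at i3
  have hend : t₁ + θ * ε ≤ t₂ := by linarith
  refine ⟨hend.trans ht₂.2, fun t ht => ?_⟩
  have htl : t ∈ Icc t₁ t₂ := ⟨ht.1, ht.2.trans hend⟩
  have ht1 : t ∈ Icc t₁ 1 := ⟨ht.1, htl.2.trans ht₂.2⟩
  have ht0 : t ∈ Icc (0 : ℝ) 1 := ⟨ht₁.1.trans ht.1, ht1.2⟩
  have hdist : 2 * D * (t - t₁) ≤ ε / 2 := by
    have : 2 * D * (t - t₁) ≤ 2 * D * (θ * ε) :=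
      mul_le_mul_of_nonneg_left (by linarith [ht.2]) (by positivity)
    nlinarith
  have wj := (hlip t ht1 j).trans hdist
  rw [h0, sub_self, sub_zero] at wj
  have wl := (abs_le.1 ((hlip t ht1 (j - 1)).trans hdist)).2
  have wl' : x t (j - 1) - y t (j - 1) ≤ -η := by rw [hη] at i2 ⊢; linarith
  have wr := hpos t htl
  obtain ⟨a, b, k, ha, haL, hb, hbL, hk, he⟩ := hlin t ht0 j
  have f1 : a * (x t (j + 1) - y t (j + 1)) ≤ 0 :=
    mul_nonpos_of_nonneg_of_nonpos (by linarith) (by linarith)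
  have f2 : b * (x t (j - 1) - y t (j - 1)) ≤ -(δ * η) := by nlinarith
  have f3 : k * (x t j - y t j) ≤ L * (ε / 2) := by
    refine (le_abs_self _).trans ?_
    rw [abs_mul]
    exact mul_le_mul hk wj (abs_nonneg _) hL
  have hforce : force W V f t (x t) j - force W V f t (y t) j ≤ -(δ * η / 2) := by
    rw [he]
    nlinarith
  have hs1 : softSign ((x t (j + 1) - y t (j + 1)) / ε) ≤ 0 := by
    rw [← softSign_zero]
    exact softSign_mono (div_nonpos_of_nonpos_of_nonneg (by linarith) hε.le)
  have hs2 : softSign ((x t (j - 1) - y t (j - 1)) / ε) = -softSign 1 :=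
    softSign_of_le_neg_one ((div_le_iff₀ hε).2 (by linarith))
  have htent : 1 / 2 ≤ tent ((x t j - y t j) / ε) := by
    refine half_le_tent ?_
    rw [abs_div, abs_of_pos hε, div_le_iff₀ hε]
    linarith
  have g1 : δ * η / 2 * softSign 1 ≤ (force W V f t (x t) j - force W V f t (y t) j) *
      (softSign ((x t (j + 1) - y t (j + 1)) / ε) +
          softSign ((x t (j - 1) - y t (j - 1)) / ε)) := by
    rw [hs2, ← neg_mul_neg (force W V f t (x t) j - force W V f t (y t) j)]
    exact mul_le_mul (by linarith) (by linarith) hm.le (by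
      have : 0 < δ * η := by positivity
      linarith)
  have g2 : 1 / 2 / ε ≤ tent ((x t j - y t j) / ε) / ε := div_le_div_of_nonneg_right htent hε.le
  calc δ * η * softSign 1 / 4 / ε = 1 / 2 / ε * (δ * η / 2 * softSign 1) := by ring
    _ ≤ _ := by
        rw [mul_assoc (tent _ / ε)]
        exact mul_le_mul g2 g1 (by positivity) (by positivity)

end

/-! ### Gaps between a random trajectory and the leaves. -/

section

variable {W V f : ℝ → ℝ} {ρ : ℝ}

/-- A foliation of the space by the configurations with a common hull function, which drift
uniformly in time. -/
structure Foliation (W V f : ℝ → ℝ) (ρ : ℝ) where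
  δ : ℝ
  C : ℝ
  adm : Admissible W V f δ C
  hull : ℝ ≃o ℝ
  hull_add_one : ∀ c, hull (c + 1) = hull c + 1
  drift : ℝ
  flow_leaf : ∀ c, flow W V f (leaf hull ρ c) 1 = leaf hull ρ (c + drift)

namespace Foliation

variable (F : Foliation W V f ρ)

/-- A bound for the width of the leaves. -/
def width : ℝ := 2 * (|F.hull 0| + 1)

theorem leaf_hasWidth {K : ℝ} (hK : F.width ≤ K) (c : ℝ) : HasWidth ρ K (leaf F.hull ρ c) :=
  (hasWidth_leaf F.hull_add_one ρ c).mono hK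

theorem flow_leaf_succ (c t : ℝ) (ht : 0 ≤ t) (i : ℤ) :
    flow W V f (leaf F.hull ρ c) t (i + 1) = flow W V f (leaf F.hull ρ (c + ρ)) t i := by
  have h := leaf_translate F.hull ρ c 1
  rw [Int.cast_one, one_mul] at h
  rw [← h, F.adm.flow_translate (F.leaf_hasWidth le_rfl c) 1 ht]

theorem flow_leaf_add_int (c t : ℝ) (ht : 0 ≤ t) (n i : ℤ) :
    flow W V f (leaf F.hull ρ (c + n)) t i = flow W V f (leaf F.hull ρ c) t i + n := by
  rw [← leaf_add_int F.hull_add_one, F.adm.flow_add_int (F.leaf_hasWidth le_rfl c) n ht]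

end Foliation

/-- The position of the particle `j` as a function of the initial configuration and time, extended
by zero to a Borel function. -/
def traj (W V f : ℝ → ℝ) (ρ K : ℝ) (j : ℤ) : (ℤ → ℝ) × ℝ → ℝ :=
  ({u | HasWidth ρ K u} ×ˢ Icc (0 : ℝ) 1).indicator fun p => flow W V f p.1 p.2 j

theorem traj_eq {K : ℝ} {u : ℤ → ℝ} (hu : HasWidth ρ K u) {t : ℝ} (ht : t ∈ Icc (0 : ℝ) 1)
    (j : ℤ) : traj W V f ρ K j (u, t) = flow W V f u t j :=
  indicator_of_mem (show (u, t) ∈ {u | HasWidth ρ K u} ×ˢ Icc (0 : ℝ) 1 from ⟨hu, ht⟩) _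

namespace Foliation

variable (F : Foliation W V f ρ)

theorem measurable_traj (F : Foliation W V f ρ) (K : ℝ) (j : ℤ) : Measurable (traj W V f ρ K j) := by
  classical
  unfold traj
  rw [← piecewise_eq_indicator]
  exact (F.adm.flow_continuousOn ρ K 1 j).measurable_piecewise continuousOn_const
    ((HasWidth.isClosed ρ K).prod isClosed_Icc).measurableSet

/-- The distance between the trajectory of the class `x` and the leaf with phase `c` at
time `t`. -/
def gap (K : ℝ) (j : ℤ) (p : (StateSpace × ℝ) × ℝ) : ℝ :=
  traj W V f ρ K j (rep p.1.1, p.2) - traj W V f ρ K j (leaf F.hull ρ p.1.2, p.2)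

/-- The velocity of `gap`. -/
def gapVel (K : ℝ) (j : ℤ) (p : (StateSpace × ℝ) × ℝ) : ℝ :=
  force W V f p.2 (fun i => traj W V f ρ K i (rep p.1.1, p.2)) j -
    force W V f p.2 (fun i => traj W V f ρ K i (leaf F.hull ρ p.1.2, p.2)) j

theorem measurable_traj_rep (F : Foliation W V f ρ) (K : ℝ) (j : ℤ) :
    Measurable fun p : (StateSpace × ℝ) × ℝ => traj W V f ρ K j (rep p.1.1, p.2) :=
  (F.measurable_traj K j).comp
    ((measurable_rep.comp (measurable_fst.comp measurable_fst)).prodMk measurable_snd)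

theorem measurable_traj_leaf (K : ℝ) (j : ℤ) :
    Measurable fun p : (StateSpace × ℝ) × ℝ => traj W V f ρ K j (leaf F.hull ρ p.1.2, p.2) :=
  (F.measurable_traj K j).comp
    (((continuous_leaf F.hull ρ).measurable.comp (measurable_snd.comp measurable_fst)).prodMk
      measurable_snd)

theorem measurable_gap (K : ℝ) (j : ℤ) : Measurable (F.gap K j) :=
  (F.measurable_traj_rep K j).sub (F.measurable_traj_leaf K j)

theorem measurable_gapVel (K : ℝ) (j : ℤ) : Measurable (F.gapVel K j) := by
  have key : ∀ g : ℤ → (StateSpace × ℝ) × ℝ → ℝ, (∀ i, Measurable (g i)) →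
      Measurable fun p : (StateSpace × ℝ) × ℝ => force W V f p.2 (fun i => g i p) j := by
    intro g hg
    unfold force
    exact (((F.adm.contW.measurable.comp ((hg _).sub (hg _))).sub
      (F.adm.contW.measurable.comp ((hg _).sub (hg _)))).add
      (F.adm.contV.measurable.comp (hg _))).add (F.adm.contf.measurable.comp measurable_snd)
  exact (key _ (F.measurable_traj_rep K)).sub (key _ (F.measurable_traj_leaf K))

theorem gap_eq {K : ℝ} (hK : F.width ≤ K) {x : StateSpace} (hx : HasWidth ρ K (rep x)) (c : ℝ)
    {t : ℝ} (ht : t ∈ Icc (0 : ℝ) 1) (j : ℤ) :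
    F.gap K j ((x, c), t) = flow W V f (rep x) t j - flow W V f (leaf F.hull ρ c) t j := by
  rw [gap, traj_eq hx ht, traj_eq (F.leaf_hasWidth hK c) ht]

theorem gapVel_eq {K : ℝ} (hK : F.width ≤ K) {x : StateSpace} (hx : HasWidth ρ K (rep x)) (c : ℝ)
    {t : ℝ} (ht : t ∈ Icc (0 : ℝ) 1) (j : ℤ) :
    F.gapVel K j ((x, c), t) = force W V f t (flow W V f (rep x) t) j -
      force W V f t (flow W V f (leaf F.hull ρ c) t) j := by
  simp only [gapVel, traj_eq hx ht, traj_eq (F.leaf_hasWidth hK c) ht]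

/-- The translate of a leaf is a leaf, and the integer `k` renormalizing the representative is
absorbed by the phase as well. Since `b` does not depend on `c`, the change disappears on
integrating over `c`. -/
theorem exists_shift_gap {K : ℝ} (hK : F.width ≤ K) {x : StateSpace} (hx : HasWidth ρ K (rep x)) :
    ∃ b : ℝ, ∀ c : ℝ, ∀ t ∈ Icc (0 : ℝ) 1, ∀ i : ℤ,
      F.gap K (i + 1) ((shift x, c), t) = F.gap K i ((x, c + b), t) ∧
      F.gapVel K (i + 1) ((shift x, c), t) = F.gapVel K i ((x, c + b), t) := by
  obtain ⟨k, hk⟩ := rep_translate (-1) x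
  rw [← shift_eq_translate] at hk
  have hx1 := hx.translate (-1)
  have hSx : HasWidth ρ K (rep (shift x)) := hk ▸ hx1.add_int k
  refine ⟨ρ + (-k : ℤ), fun c t ht i => ?_⟩
  have e1 : ∀ i, flow W V f (rep (shift x)) t (i + 1) = flow W V f (rep x) t i + k := by
    intro i
    rw [hk, F.adm.flow_add_int hx1 k ht.1, F.adm.flow_translate hx (-1) ht.1]
    simp only [add_neg_cancel_right]
  have e2 : ∀ i, flow W V f (leaf F.hull ρ c) t (i + 1) =
      flow W V f (leaf F.hull ρ (c + (ρ + (-k : ℤ)))) t i + k := by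
    intro i
    rw [← add_assoc, F.flow_leaf_add_int _ t ht.1, F.flow_leaf_succ c t ht.1]
    push_cast
    ring
  rw [F.gap_eq hK hSx c ht, F.gapVel_eq hK hSx c ht, F.gap_eq hK hx _ ht, F.gapVel_eq hK hx _ ht]
  refine ⟨by rw [e1, e2]; ring, ?_⟩
  have e3 := e1 (i - 1)
  have e4 := e2 (i - 1)
  rw [sub_add_cancel] at e3 e4
  simp only [force, add_sub_cancel_right, e1, e2, e3, e4, add_sub_add_right_eq_sub, F.adm.pot_per]

/-- The uniform drift of the leaves makes a time step equivalent to a phase translation independent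
of `c`. -/
theorem exists_time_gap {K : ℝ} (hK : F.width ≤ K) {x : StateSpace} (hx : HasWidth ρ K (rep x))
    (hTx : HasWidth ρ K (rep (timeOne W V f x))) :
    ∃ b : ℝ, ∀ c : ℝ, ∀ i : ℤ,
      F.gap K i ((timeOne W V f x, c), 0) = F.gap K i ((x, c + b), 1) := by
  obtain ⟨k, hk⟩ := F.adm.rep_timeOne hx
  have l0 : (0 : ℝ) ∈ Icc (0 : ℝ) 1 := ⟨le_rfl, zero_le_one⟩
  have l1 : (1 : ℝ) ∈ Icc (0 : ℝ) 1 := ⟨zero_le_one, le_rfl⟩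
  refine ⟨-F.drift + (-k : ℤ), fun c i => ?_⟩
  rw [F.gap_eq hK hTx c l0, F.gap_eq hK hx _ l1, F.flow_leaf, F.adm.flow_zero hTx,
    F.adm.flow_zero (F.leaf_hasWidth hK c), hk,
    show c + (-F.drift + ((-k : ℤ) : ℝ)) + F.drift = c + ((-k : ℤ) : ℝ) by ring,
    ← leaf_add_int F.hull_add_one]
  push_cast
  ring

theorem exists_bounds {K : ℝ} (hK : F.width ≤ K) (j : ℤ) :
    ∃ R D : ℝ, 0 ≤ D ∧ ∀ x : StateSpace, HasWidth ρ K (rep x) → ∀ c : ℝ, ∀ t ∈ Icc (0 : ℝ) 1,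
      (∀ i, |F.gapVel K i ((x, c), t)| ≤ D) ∧
      ∀ i : ℤ, |(i : ℝ) - j| ≤ 1 → (R < c → F.gap K i ((x, c), t) ≤ -1) ∧
        (c < -R → 1 ≤ F.gap K i ((x, c), t)) := by
  obtain ⟨D, hD0, hD⟩ := F.adm.exists_force_bound ρ K
  -- The summands of `R` are the displacement of both trajectories in unit time, the range `[0, 1)`
  -- of `rep x 0`, the width, the distance of the hull function from the identity, and a margin 1
  -- that saturates the soft sign.
  refine ⟨2 * D + 1 + K + (|F.hull 0| + 1) + 1, 2 * D, by positivity, fun x hx c t ht => ⟨?_, ?_⟩⟩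
  · intro i
    rw [F.gapVel_eq hK hx c ht]
    have e1 := hD _ hx t ht i
    have e2 := hD _ (F.leaf_hasWidth hK c) t ht i
    rw [abs_le] at *
    constructor <;> linarith [e1.1, e1.2, e2.1, e2.2]
  · intro i hi
    rw [F.gap_eq hK hx c ht]
    have l0 : (0 : ℝ) ∈ Icc (0 : ℝ) 1 := ⟨le_rfl, zero_le_one⟩
    have e1 := F.adm.abs_flow_sub_le hx (hD _ hx) l0 ht i
    have e2 := F.adm.abs_flow_sub_le (F.leaf_hasWidth hK c) (hD _ (F.leaf_hasWidth hK c)) l0 ht i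
    rw [F.adm.flow_zero hx, sub_zero, abs_of_nonneg ht.1] at e1
    rw [F.adm.flow_zero (F.leaf_hasWidth hK c), sub_zero, abs_of_nonneg ht.1] at e2
    have hDt : D * t ≤ D := mul_le_of_le_one_right hD0 ht.2
    have e3 := hx i 0
    push_cast at e3
    rw [sub_zero] at e3
    have e4 := rep_zero_mem x
    have e5 := abs_hull_sub_le F.hull_add_one (c + i * ρ)
    change |leaf F.hull ρ c i - _| ≤ _ at e5
    rw [abs_le] at e1 e2 e3 e5
    constructor <;> intro hc <;> linarith [e1.1, e1.2, e2.1, e2.2, e3.1, e3.2, e4.1, e4.2, e5.1, e5.2]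

end Foliation

theorem integrable_prod_of_bounded {X : Type*} [MeasurableSpace X] {ν : Measure X}
    [IsFiniteMeasure ν] {h : X × ℝ → ℝ} (hm : Measurable h) {R D : ℝ}
    (hb : ∀ᵐ x ∂ν, ∀ c, |h (x, c)| ≤ D ∧ (R < |c| → h (x, c) = 0)) :
    Integrable h (ν.prod volume) := by
  have hD : Integrable ((univ ×ˢ Icc (-R) R : Set (X × ℝ)).indicator fun _ => D)
      (ν.prod volume) := by
    refine (integrable_indicator_iff (MeasurableSet.univ.prod measurableSet_Icc)).2
      (integrableOn_const ?_)
    rw [Measure.prod_prod, Real.volume_Icc]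
    exact ENNReal.mul_ne_top (measure_ne_top _ _) ENNReal.ofReal_ne_top
  refine hD.mono' hm.aestronglyMeasurable ?_
  filter_upwards [Measure.quasiMeasurePreserving_fst.ae hb] with p hp
  by_cases hR : |p.2| ≤ R
  · rw [indicator_of_mem (show p ∈ univ ×ˢ Icc (-R) R from ⟨mem_univ _, abs_le.1 hR⟩)]
    exact (hp p.2).1
  · rw [indicator_of_notMem fun hmem => hR (abs_le.2 hmem.2), show p = (p.1, p.2) from rfl,
      (hp p.2).2 (not_le.1 hR), norm_zero]

theorem integrable_prod_prod_of_bounded {X : Type*} [MeasurableSpace X] {ν : Measure X}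
    [IsFiniteMeasure ν] {h : (X × ℝ) × ℝ → ℝ} (hm : Measurable h) {R D : ℝ}
    (hb : ∀ᵐ x ∂ν, ∀ c, ∀ t ∈ Icc (0 : ℝ) 1, |h ((x, c), t)| ≤ D ∧
      (R < |c| → h ((x, c), t) = 0)) :
    Integrable h ((ν.prod volume).prod (volume.restrict (Ioc 0 1))) := by
  have hD : Integrable (((univ ×ˢ Icc (-R) R) ×ˢ univ : Set ((X × ℝ) × ℝ)).indicator fun _ => D)
      ((ν.prod volume).prod (volume.restrict (Ioc 0 1))) := by
    refine (integrable_indicator_iff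
      ((MeasurableSet.univ.prod measurableSet_Icc).prod MeasurableSet.univ)).2
      (integrableOn_const ?_)
    rw [Measure.prod_prod, Measure.prod_prod, Real.volume_Icc]
    exact ENNReal.mul_ne_top (ENNReal.mul_ne_top (measure_ne_top _ _) ENNReal.ofReal_ne_top)
      (measure_ne_top _ _)
  refine hD.mono' hm.aestronglyMeasurable ?_
  filter_upwards [Measure.quasiMeasurePreserving_fst.ae (Measure.quasiMeasurePreserving_fst.ae hb),
    Measure.quasiMeasurePreserving_snd.ae (ae_restrict_mem measurableSet_Ioc)] with p hp ht
  have hp' := hp p.1.2 p.2 ⟨ht.1.le, ht.2⟩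
  by_cases hR : |p.1.2| ≤ R
  · rw [indicator_of_mem (show p ∈ (univ ×ˢ Icc (-R) R) ×ˢ univ from
      ⟨⟨mem_univ _, abs_le.1 hR⟩, mem_univ _⟩)]
    exact hp'.1
  · rw [indicator_of_notMem fun hmem => hR (abs_le.2 hmem.1.2),
      show p = ((p.1.1, p.1.2), p.2) from rfl, hp'.2 (not_le.1 hR), norm_zero]

end

/-! ### Balance of sign changes for an invariant measure. -/

section

variable {W V f : ℝ → ℝ} {ρ : ℝ}

theorem IsSolution.continuousOn_force {δ C : ℝ} (h : Admissible W V f δ C) {u : ℝ → ℤ → ℝ}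
    (hu : IsSolution W V f u) (j : ℤ) :
    ContinuousOn (fun t => force W V f t (u t) j) (Ici 0) := by
  unfold force
  exact (((h.contW.comp_continuousOn ((hu.continuousOn _).sub (hu.continuousOn _))).sub
    (h.contW.comp_continuousOn ((hu.continuousOn _).sub (hu.continuousOn _)))).add
    (h.contV.comp_continuousOn (hu.continuousOn _))).add h.contf.continuousOn

namespace Foliation

variable (F : Foliation W V f ρ)

/-- The contribution of the particles `j` and `i` to the rate of change of the smoothed number of
sign changes. -/
def flux (K ε : ℝ) (j i : ℤ) (p : (StateSpace × ℝ) × ℝ) : ℝ :=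
  tent (F.gap K j p / ε) / ε * F.gapVel K j p * softSign (F.gap K i p / ε)

theorem measurable_tent_gap (K ε : ℝ) (j : ℤ) :
    Measurable fun p => tent (F.gap K j p / ε) :=
  continuous_tent.measurable.comp ((F.measurable_gap K j).div_const ε)

theorem measurable_softSign_gap (K ε : ℝ) (j : ℤ) :
    Measurable fun p => softSign (F.gap K j p / ε) :=
  continuous_softSign.measurable.comp ((F.measurable_gap K j).div_const ε)

theorem measurable_flux (K ε : ℝ) (j i : ℤ) : Measurable (F.flux K ε j i) :=
  (((F.measurable_tent_gap K ε j).div_const ε).mul (F.measurable_gapVel K j)).mul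
    (F.measurable_softSign_gap K ε i)

theorem exists_saturated {K : ℝ} (hK : F.width ≤ K) (j : ℤ) :
    ∃ R D : ℝ, 0 ≤ D ∧ ∀ x : StateSpace, HasWidth ρ K (rep x) → ∀ c : ℝ, ∀ t ∈ Icc (0 : ℝ) 1,
      (∀ i, |F.gapVel K i ((x, c), t)| ≤ D) ∧
      ∀ ε : ℝ, 0 < ε → ε ≤ 1 → R < |c| →
        tent (F.gap K j ((x, c), t) / ε) = 0 ∧
        softSign (F.gap K j ((x, c), t) / ε) * softSign (F.gap K (j + 1) ((x, c), t) / ε) =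
          softSign 1 * softSign 1 := by
  obtain ⟨R, D, hD, hb⟩ := F.exists_bounds hK j
  refine ⟨R, D, hD, fun x hx c t ht => ⟨(hb x hx c t ht).1, fun ε hε hε1 hR => ?_⟩⟩
  have h0 := (hb x hx c t ht).2 j (by simp)
  have h1 := (hb x hx c t ht).2 (j + 1) (by simp)
  rcases lt_abs.1 hR with hc | hc
  · have g0 : F.gap K j ((x, c), t) / ε ≤ -1 := by
      rw [div_le_iff₀ hε]
      linarith [h0.1 hc]
    have g1 : F.gap K (j + 1) ((x, c), t) / ε ≤ -1 := by
      rw [div_le_iff₀ hε]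
      linarith [h1.1 hc]
    refine ⟨tent_eq_zero (le_abs.2 (Or.inr (by linarith))), ?_⟩
    rw [softSign_of_le_neg_one g0, softSign_of_le_neg_one g1, neg_mul_neg]
  · have g0 : 1 ≤ F.gap K j ((x, c), t) / ε := by
      rw [le_div_iff₀ hε]
      linarith [h0.2 (by linarith)]
    have g1 : 1 ≤ F.gap K (j + 1) ((x, c), t) / ε := by
      rw [le_div_iff₀ hε]
      linarith [h1.2 (by linarith)]
    refine ⟨tent_eq_zero (le_abs.2 (Or.inl g0)), ?_⟩
    rw [softSign_of_one_le g0, softSign_of_one_le g1]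

theorem exists_flux_bound {K : ℝ} (hK : F.width ≤ K) {ε : ℝ} (hε : 0 < ε) (hε1 : ε ≤ 1)
    (j i : ℤ) : ∃ R D : ℝ, ∀ x : StateSpace, HasWidth ρ K (rep x) → ∀ c : ℝ,
      ∀ t ∈ Icc (0 : ℝ) 1, |F.flux K ε j i ((x, c), t)| ≤ D ∧
        (R < |c| → F.flux K ε j i ((x, c), t) = 0) := by
  obtain ⟨R, D, hD, hb⟩ := F.exists_saturated hK j
  refine ⟨R, 1 / ε * D * 1, fun x hx c t ht => ⟨?_, fun hR => ?_⟩⟩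
  · rw [flux, abs_mul, abs_mul, abs_div, abs_of_pos hε, abs_of_nonneg (tent_nonneg _)]
    have := tent_le_one (F.gap K j ((x, c), t) / ε)
    refine mul_le_mul (mul_le_mul (div_le_div_of_nonneg_right this hε.le)
      ((hb x hx c t ht).1 j) (abs_nonneg _) (by positivity)) (abs_softSign_le _) (abs_nonneg _)
      (by positivity)
  · rw [flux, ((hb x hx c t ht).2 ε hε hε1 hR).1]
    simp

variable {ν : Measure StateSpace} [IsFiniteMeasure ν]

theorem integrable_flux {K : ℝ} (hK : F.width ≤ K) (hν : ∀ᵐ x ∂ν, HasWidth ρ K (rep x)) {ε : ℝ}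
    (hε : 0 < ε) (hε1 : ε ≤ 1) (j i : ℤ) :
    Integrable (F.flux K ε j i) ((ν.prod volume).prod (volume.restrict (Ioc 0 1))) := by
  obtain ⟨R, D, hb⟩ := F.exists_flux_bound hK hε hε1 j i
  exact integrable_prod_prod_of_bounded (F.measurable_flux K ε j i)
    (hν.mono fun x hx c t ht => hb x hx c t ht)

theorem integrable_flux_slice {K : ℝ} (hK : F.width ≤ K) (hν : ∀ᵐ x ∂ν, HasWidth ρ K (rep x))
    {ε : ℝ} (hε : 0 < ε) (hε1 : ε ≤ 1) (j i : ℤ) {t : ℝ} (ht : t ∈ Icc (0 : ℝ) 1) :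
    Integrable (fun y => F.flux K ε j i (y, t)) (ν.prod volume) := by
  obtain ⟨R, D, hb⟩ := F.exists_flux_bound hK hε hε1 j i
  exact integrable_prod_of_bounded
    ((F.measurable_flux K ε j i).comp (measurable_id.prodMk measurable_const))
    (hν.mono fun x hx c => hb x hx c t ht)

/-- `S`-invariance of `ν` together with translation invariance of Lebesgue measure in `c`. It moves
the contribution of particle `j + 1` to particle `j`, so that both neighbours of one particle appear
in a single expression. -/
theorem integral_flux_succ {K : ℝ} (hK : F.width ≤ K) (hν : ∀ᵐ x ∂ν, HasWidth ρ K (rep x))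
    (hS : MeasurePreserving shift ν ν) {ε : ℝ} (hε : 0 < ε) (hε1 : ε ≤ 1) (j : ℤ) :
    ∫ p, F.flux K ε (j + 1) j p ∂(ν.prod volume).prod (volume.restrict (Ioc 0 1)) =
      ∫ p, F.flux K ε j (j - 1) p ∂(ν.prod volume).prod (volume.restrict (Ioc 0 1)) := by
  rw [integral_prod_symm _ (F.integrable_flux hK hν hε hε1 _ _),
    integral_prod_symm _ (F.integrable_flux hK hν hε hε1 _ _)]
  refine setIntegral_congr_fun measurableSet_Ioc fun t ht => ?_
  have ht' : t ∈ Icc (0 : ℝ) 1 := ⟨ht.1.le, ht.2⟩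
  rw [integral_prod _ (F.integrable_flux_slice hK hν hε hε1 _ _ ht'),
    integral_prod _ (F.integrable_flux_slice hK hν hε hε1 _ _ ht'),
    ← hS.integral_comp shiftHomeomorph.measurableEmbedding]
  refine integral_congr_ae (hν.mono fun x hx => ?_)
  obtain ⟨b, hb⟩ := F.exists_shift_gap hK hx
  have e : ∀ c, F.flux K ε (j + 1) j ((shift x, c), t) = F.flux K ε j (j - 1) ((x, c + b), t) := by
    intro c
    have h1 := hb c t ht' j
    have h2 := hb c t ht' (j - 1)
    rw [sub_add_cancel] at h2
    simp only [flux, h1.1, h1.2, h2.1]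
  simp only [e]
  exact integral_add_right_eq_self (fun c => F.flux K ε j (j - 1) ((x, c), t)) b

/-- The smoothed indicator of a sign change between the particles `j` and `j + 1`. -/
def signChange (K ε : ℝ) (j : ℤ) (p : (StateSpace × ℝ) × ℝ) : ℝ :=
  softSign 1 * softSign 1 - softSign (F.gap K j p / ε) * softSign (F.gap K (j + 1) p / ε)

theorem integrable_signChange {K : ℝ} (hK : F.width ≤ K) (hν : ∀ᵐ x ∂ν, HasWidth ρ K (rep x))
    {ε : ℝ} (hε : 0 < ε) (hε1 : ε ≤ 1) (j : ℤ) {t : ℝ} (ht : t ∈ Icc (0 : ℝ) 1) :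
    Integrable (fun y => F.signChange K ε j (y, t)) (ν.prod volume) := by
  obtain ⟨R, D, hD, hb⟩ := F.exists_saturated hK j
  refine integrable_prod_of_bounded (R := R) (D := 2) ?_ (hν.mono fun x hx c => ⟨?_, fun hR => ?_⟩)
  · exact ((((F.measurable_softSign_gap K ε j).mul
      (F.measurable_softSign_gap K ε (j + 1))).const_sub _)).comp
      (measurable_id.prodMk measurable_const)
  · refine (abs_sub _ _).trans ?_
    rw [abs_mul, abs_mul]
    have h1 := mul_le_mul (abs_softSign_le 1) (abs_softSign_le 1) (abs_nonneg _) zero_le_one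
    have h2 := mul_le_mul (abs_softSign_le (F.gap K j ((x, c), t) / ε))
      (abs_softSign_le (F.gap K (j + 1) ((x, c), t) / ε)) (abs_nonneg _) zero_le_one
    linarith
  · rw [signChange, ((hb x hx c t ht).2 ε hε hε1 hR).2, sub_self]

/-- `T`-invariance of `ν`; the drift of the leaves is undone by translating `c`. -/
theorem integral_signChange_eq {K : ℝ} (hK : F.width ≤ K) (hν : ∀ᵐ x ∂ν, HasWidth ρ K (rep x))
    (hT : MeasurePreserving (timeOne W V f) ν ν) {ε : ℝ} (hε : 0 < ε) (hε1 : ε ≤ 1) (j : ℤ) :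
    ∫ y, F.signChange K ε j (y, 0) ∂ν.prod volume =
      ∫ y, F.signChange K ε j (y, 1) ∂ν.prod volume := by
  have l0 : (0 : ℝ) ∈ Icc (0 : ℝ) 1 := ⟨le_rfl, zero_le_one⟩
  have l1 : (1 : ℝ) ∈ Icc (0 : ℝ) 1 := ⟨zero_le_one, le_rfl⟩
  have i0 := F.integrable_signChange hK hν hε hε1 j l0
  rw [integral_prod _ i0, integral_prod _ (F.integrable_signChange hK hν hε hε1 j l1)]
  have hm : AEStronglyMeasurable (fun x => ∫ c, F.signChange K ε j ((x, c), 0))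
      (ν.map (timeOne W V f)) := by
    rw [hT.map_eq]
    exact i0.integral_prod_left.aestronglyMeasurable
  have hmap := integral_map hT.measurable.aemeasurable hm
  rw [hT.map_eq] at hmap
  rw [hmap]
  refine integral_congr_ae ?_
  filter_upwards [hν, hT.quasiMeasurePreserving.ae hν] with x hx hTx
  obtain ⟨b, hb⟩ := F.exists_time_gap hK hx hTx
  simp only [signChange, hb]
  exact integral_add_right_eq_self (fun c => F.signChange K ε j ((x, c), 1)) b

/-- The two fluxes are the product-rule terms of the time derivative of the product of the soft
signs at `j` and `j + 1`. -/
theorem integral_flux_time {K : ℝ} (hK : F.width ≤ K) {x : StateSpace} (hx : HasWidth ρ K (rep x))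
    (c : ℝ) (ε : ℝ) (j : ℤ) :
    ∫ t in Ioc (0 : ℝ) 1, (F.flux K ε j (j + 1) ((x, c), t) + F.flux K ε (j + 1) j ((x, c), t)) =
      F.signChange K ε j ((x, c), 0) - F.signChange K ε j ((x, c), 1) := by
  have hsu := F.adm.flow_isSolution hx
  have hsv := F.adm.flow_isSolution (F.leaf_hasWidth hK c)
  set u := flow W V f (rep x)
  set v := flow W V f (leaf F.hull ρ c)
  set w : ℤ → ℝ → ℝ := fun i t => (u t i - v t i) / ε with hw
  set dw : ℤ → ℝ → ℝ := fun i t =>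
    (force W V f t (u t) i - force W V f t (v t) i) / ε with hdw
  have hwc : ∀ i, ContinuousOn (w i) (Icc 0 1) := fun i =>
    (((hsu.continuousOn i).sub (hsv.continuousOn i)).div_const ε).mono fun t ht => ht.1
  have hdwc : ∀ i, ContinuousOn (dw i) (Icc 0 1) := fun i =>
    (((hsu.continuousOn_force F.adm i).sub (hsv.continuousOn_force F.adm i)).div_const ε).mono
      fun t ht => ht.1
  have hwd : ∀ i, ∀ t ∈ Ioo (0 : ℝ) 1, HasDerivAt (w i) (dw i t) t := fun i t ht =>
    (((hsu.hasDeriv t ht.1.le i).sub (hsv.hasDeriv t ht.1.le i)).div_const ε).hasDerivAt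
      (Ici_mem_nhds ht.1)
  have hftc := intervalIntegral.integral_eq_sub_of_hasDerivAt_of_le
    (f := fun t => softSign (w j t) * softSign (w (j + 1) t))
    (f' := fun t => tent (w j t) * dw j t * softSign (w (j + 1) t) +
      softSign (w j t) * (tent (w (j + 1) t) * dw (j + 1) t)) zero_le_one
    ((continuous_softSign.comp_continuousOn (hwc j)).mul
      (continuous_softSign.comp_continuousOn (hwc (j + 1))))
    (fun t ht => ((hasDerivAt_softSign _).comp t (hwd j t ht)).mul
      ((hasDerivAt_softSign _).comp t (hwd (j + 1) t ht)))
    (by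
      refine ContinuousOn.intervalIntegrable ?_
      rw [uIcc_of_le zero_le_one]
      exact (((continuous_tent.comp_continuousOn (hwc j)).mul (hdwc j)).mul
        (continuous_softSign.comp_continuousOn (hwc (j + 1)))).add
        ((continuous_softSign.comp_continuousOn (hwc j)).mul
        ((continuous_tent.comp_continuousOn (hwc (j + 1))).mul (hdwc (j + 1)))))
  have l0 : (0 : ℝ) ∈ Icc (0 : ℝ) 1 := ⟨le_rfl, zero_le_one⟩
  have l1 : (1 : ℝ) ∈ Icc (0 : ℝ) 1 := ⟨zero_le_one, le_rfl⟩
  rw [signChange, signChange, F.gap_eq hK hx c l0, F.gap_eq hK hx c l1, F.gap_eq hK hx c l0,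
    F.gap_eq hK hx c l1, sub_sub_sub_cancel_left]
  refine Eq.trans ?_ hftc
  rw [intervalIntegral.integral_of_le zero_le_one]
  refine setIntegral_congr_fun measurableSet_Ioc fun t ht => ?_
  have ht' : t ∈ Icc (0 : ℝ) 1 := ⟨ht.1.le, ht.2⟩
  simp only [flux, F.gap_eq hK hx c ht', F.gapVel_eq hK hx c ht', hw, hdw]
  ring

theorem integral_dissipation {K : ℝ} (hK : F.width ≤ K) (hν : ∀ᵐ x ∂ν, HasWidth ρ K (rep x))
    (hS : MeasurePreserving shift ν ν) (hT : MeasurePreserving (timeOne W V f) ν ν) {ε : ℝ}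
    (hε : 0 < ε) (hε1 : ε ≤ 1) (j : ℤ) :
    ∫ p, (F.flux K ε j (j + 1) p + F.flux K ε j (j - 1) p)
      ∂(ν.prod volume).prod (volume.restrict (Ioc 0 1)) = 0 := by
  have l0 : (0 : ℝ) ∈ Icc (0 : ℝ) 1 := ⟨le_rfl, zero_le_one⟩
  have l1 : (1 : ℝ) ∈ Icc (0 : ℝ) 1 := ⟨zero_le_one, le_rfl⟩
  have i1 := F.integrable_flux hK hν hε hε1 j (j + 1)
  have i2 := F.integrable_flux hK hν hε hε1 (j + 1) j
  have i3 := F.integrable_flux hK hν hε hε1 j (j - 1)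
  rw [integral_add i1 i3, ← F.integral_flux_succ hK hν hS hε hε1 j, ← integral_add i1 i2,
    integral_prod (fun p => F.flux K ε j (j + 1) p + F.flux K ε (j + 1) j p) (i1.add i2)]
  have hae : ∀ᵐ y ∂ν.prod volume, ∫ t in Ioc (0 : ℝ) 1,
      (F.flux K ε j (j + 1) (y, t) + F.flux K ε (j + 1) j (y, t)) =
      F.signChange K ε j (y, 0) - F.signChange K ε j (y, 1) := by
    filter_upwards [Measure.quasiMeasurePreserving_fst.ae hν] with y hy
    exact F.integral_flux_time hK hy y.2 ε j
  rw [integral_congr_ae hae, integral_sub (F.integrable_signChange hK hν hε hε1 j l0)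
    (F.integrable_signChange hK hν hε hε1 j l1), F.integral_signChange_eq hK hν hT hε hε1 j,
    sub_self]

theorem integrable_tent_gap {K : ℝ} (hK : F.width ≤ K) (hν : ∀ᵐ x ∂ν, HasWidth ρ K (rep x))
    {ε : ℝ} (hε : 0 < ε) (hε1 : ε ≤ 1) (j : ℤ) :
    Integrable (fun p => tent (F.gap K j p / ε))
      ((ν.prod volume).prod (volume.restrict (Ioc 0 1))) := by
  obtain ⟨R, D, hD, hb⟩ := F.exists_saturated hK j
  refine integrable_prod_prod_of_bounded (R := R) (D := 1) (F.measurable_tent_gap K ε j)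
    (hν.mono fun x hx c t ht => ⟨?_, fun hR => ((hb x hx c t ht).2 ε hε hε1 hR).1⟩)
  rw [abs_of_nonneg (tent_nonneg _)]
  exact tent_le_one _

/-- The flow keeps the leaves strictly ordered, so for given `x` and `t` at most one phase gives gap
zero. -/
theorem ae_gap_ne_zero {K : ℝ} (hK : F.width ≤ K) (hν : ∀ᵐ x ∂ν, HasWidth ρ K (rep x)) (j : ℤ) :
    ∀ᵐ p ∂(ν.prod volume).prod (volume.restrict (Ioc 0 1)), F.gap K j p ≠ 0 := by
  have hm : MeasurableSet {p | F.gap K j p = 0} :=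
    measurableSet_eq_fun (F.measurable_gap K j) measurable_const
  have h0 : ((ν.prod volume).prod (volume.restrict (Ioc (0 : ℝ) 1))) {p | F.gap K j p = 0} = 0 := by
    rw [Measure.prod_apply_symm hm, lintegral_eq_zero_iff (measurable_measure_prodMk_right hm)]
    filter_upwards [ae_restrict_mem measurableSet_Ioc] with t ht
    have ht' : t ∈ Icc (0 : ℝ) 1 := ⟨ht.1.le, ht.2⟩
    refine (Measure.measure_prod_null (hm.preimage measurable_prodMk_right)).2 ?_
    filter_upwards [hν] with x hx
    refine Set.Subsingleton.measure_zero ?_ _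
    intro c hc c' hc'
    have hc : F.gap K j ((x, c), t) = 0 := hc
    have hc' : F.gap K j ((x, c'), t) = 0 := hc'
    rw [F.gap_eq hK hx _ ht'] at hc hc'
    have hlt : ∀ a b : ℝ, a < b →
        flow W V f (leaf F.hull ρ a) t j < flow W V f (leaf F.hull ρ b) t j := fun a b hab =>
      F.adm.flow_strictMono (F.leaf_hasWidth hK a) (F.leaf_hasWidth hK b)
        (leaf_strictMono F.hull ρ hab) ht'.1 j
    rcases lt_trichotomy c c' with h | h | h
    · linarith [hlt _ _ h]
    · exact h
    · linarith [hlt _ _ h]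
  exact measure_eq_zero_iff_ae_notMem.1 h0

/-- This is the error term of `neg_tent_le_dissipation`. The tents are dominated by the one of scale
1 and vanish eventually wherever the gap is nonzero. -/
theorem tendsto_integral_tent {K : ℝ} (hK : F.width ≤ K) (hν : ∀ᵐ x ∂ν, HasWidth ρ K (rep x))
    (j : ℤ) : Tendsto (fun n : ℕ => ∫ p, tent (F.gap K j p / (1 / ((n : ℝ) + 1)))
      ∂(ν.prod volume).prod (volume.restrict (Ioc 0 1))) atTop (𝓝 0) := by
  have := tendsto_integral_of_dominated_convergence
    (F := fun (n : ℕ) p => tent (F.gap K j p / (1 / ((n : ℝ) + 1)))) (f := fun _ => 0)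
    (μ := (ν.prod volume).prod (volume.restrict (Ioc (0 : ℝ) 1)))
    (fun p => tent (F.gap K j p / 1))
    (fun n => (F.measurable_tent_gap K _ j).aestronglyMeasurable)
    (F.integrable_tent_gap hK hν one_pos le_rfl j)
    (fun n => ae_of_all _ fun p => by
      rw [Real.norm_of_nonneg (tent_nonneg _)]
      refine max_le_max le_rfl (sub_le_sub_left ?_ _)
      rw [div_one, div_div_eq_mul_div, div_one, abs_mul]
      refine le_mul_of_one_le_right (abs_nonneg _) ?_
      rw [abs_of_pos (by positivity)]
      have : (0 : ℝ) ≤ n := n.cast_nonneg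
      linarith)
    (by
      filter_upwards [F.ae_gap_ne_zero hK hν j] with p hp
      have hp' : 0 < |F.gap K j p| := abs_pos.2 hp
      obtain ⟨N, hN⟩ := exists_nat_gt (1 / |F.gap K j p|)
      rw [div_lt_iff₀ hp'] at hN
      refine tendsto_const_nhds.congr' ?_
      filter_upwards [eventually_ge_atTop N] with n hn
      refine (tent_eq_zero ?_).symm
      rw [div_div_eq_mul_div, div_one, abs_mul, abs_of_pos (by positivity : (0 : ℝ) < (n : ℝ) + 1)]
      have : (N : ℝ) ≤ n := by exact_mod_cast hn
      nlinarith)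
  simpa using this

/-- Almost surely, no leaf is touched from below. -/
theorem ae_not_touch {K : ℝ} (hK : F.width ≤ K) (hν : ∀ᵐ x ∂ν, HasWidth ρ K (rep x))
    (hS : MeasurePreserving shift ν ν) (hT : MeasurePreserving (timeOne W V f) ν ν) (j : ℤ) :
    ∀ᵐ y ∂ν.prod volume,
      ¬ Touch (flow W V f (rep y.1)) (flow W V f (leaf F.hull ρ y.2)) j := by
  obtain ⟨L, hL, hlin⟩ := F.adm.exists_linearization (|ρ| + (2 * K + 2 * F.C))
  set e : ℕ → ℝ := fun n => 1 / ((n : ℝ) + 1) with he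
  have e0 : ∀ n, 0 < e n := fun n => by simp only [he]; positivity
  have e1 : ∀ n, e n ≤ 1 := fun n => by
    simp only [he]
    rw [div_le_one (by positivity)]
    linarith [n.cast_nonneg (α := ℝ)]
  set τ := (ν.prod (volume : Measure ℝ)).prod (volume.restrict (Ioc (0 : ℝ) 1)) with hτ
  -- Dissipation plus its error bound is nonnegative. As the dissipation has mean zero, the integral
  -- of `g n` equals that of the error alone and tends to 0.
  set g : ℕ → (StateSpace × ℝ) × ℝ → ℝ := fun n p =>
    F.flux K (e n) j (j + 1) p + F.flux K (e n) j (j - 1) p +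
      4 * L * tent (F.gap K j p / e n) with hg
  have hgm : ∀ n, Measurable (g n) := fun n =>
    ((F.measurable_flux K _ _ _).add (F.measurable_flux K _ _ _)).add
      ((F.measurable_tent_gap K _ j).const_mul _)
  have hflux : ∀ n p, F.flux K (e n) j (j + 1) p + F.flux K (e n) j (j - 1) p =
      tent (F.gap K j p / e n) / e n * F.gapVel K j p *
      (softSign (F.gap K (j + 1) p / e n) + softSign (F.gap K (j - 1) p / e n)) := fun n p => by
    simp only [flux]
    ring
  have hgnn : ∀ n, 0 ≤ᵐ[τ] g n := by
    intro n
    have ht₀ : ∀ᵐ p ∂τ, p.2 ∈ Ioc (0 : ℝ) 1 :=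
      Measure.quasiMeasurePreserving_snd.ae (ae_restrict_mem measurableSet_Ioc)
    have hx₀ : ∀ᵐ p ∂τ, HasWidth ρ K (rep p.1.1) :=
      Measure.quasiMeasurePreserving_fst.ae (Measure.quasiMeasurePreserving_fst.ae hν)
    filter_upwards [hx₀, ht₀] with p hp ht
    have ht' : p.2 ∈ Icc (0 : ℝ) 1 := ⟨ht.1.le, ht.2⟩
    obtain ⟨⟨x, c⟩, t⟩ := p
    have hinc : ∀ u, HasWidth ρ K u → ∀ i,
        |flow W V f u t (i + 1) - flow W V f u t i| ≤ |ρ| + (2 * K + 2 * F.C) := fun u hu i =>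
      ((F.adm.flow_hasWidth hu ht'.1).mono (by
        have := mul_le_mul_of_nonneg_left ht'.2 F.adm.bound_nonneg
        linarith)).increment_le i
    obtain ⟨a, b, k, ha, haL, hb, hbL, hk, hv⟩ := hlin t _ _ (hinc _ hp)
      (hinc _ (F.leaf_hasWidth hK c)) j
    have hδ := F.adm.pos
    have hd := neg_tent_le_dissipation (e0 n) (p := F.gap K (j + 1) ((x, c), t))
      (q := F.gap K (j - 1) ((x, c), t)) (r := F.gap K j ((x, c), t))
      (by linarith) haL (by linarith) hbL hk
    have hv' : F.gapVel K j ((x, c), t) = a * F.gap K (j + 1) ((x, c), t) +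
        b * F.gap K (j - 1) ((x, c), t) + k * F.gap K j ((x, c), t) := by
      rw [F.gapVel_eq hK hp c ht', F.gap_eq hK hp c ht', F.gap_eq hK hp c ht',
        F.gap_eq hK hp c ht']
      exact hv
    rw [← hv', ← hflux] at hd
    simp only [hg, Pi.zero_apply]
    linarith
  have hgi : ∀ n, Integrable (g n) τ := fun n =>
    ((F.integrable_flux hK hν (e0 n) (e1 n) _ _).add
      (F.integrable_flux hK hν (e0 n) (e1 n) _ _)).add
      ((F.integrable_tent_gap hK hν (e0 n) (e1 n) j).const_mul _)
  have hgint : ∀ n, ∫ p, g n p ∂τ = 4 * L * ∫ p, tent (F.gap K j p / e n) ∂τ := by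
    intro n
    have i1 : Integrable (fun p => F.flux K (e n) j (j + 1) p + F.flux K (e n) j (j - 1) p) τ :=
      (F.integrable_flux hK hν (e0 n) (e1 n) _ _).add (F.integrable_flux hK hν (e0 n) (e1 n) _ _)
    have i2 : Integrable (fun p => 4 * L * tent (F.gap K j p / e n)) τ :=
      (F.integrable_tent_gap hK hν (e0 n) (e1 n) j).const_mul _
    have h1 := integral_add i1 i2
    rw [F.integral_dissipation hK hν hS hT (e0 n) (e1 n), zero_add, integral_const_mul] at h1
    exact h1
  set H : ℕ → StateSpace × ℝ → ENNReal := fun n y =>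
    ∫⁻ t in Ioc (0 : ℝ) 1, ENNReal.ofReal (g n (y, t)) with hH
  have hHm : ∀ n, Measurable (H n) := fun n => (hgm n).ennreal_ofReal.lintegral_prod_right'
  have hHint : Tendsto (fun n => ∫⁻ y, H n y ∂ν.prod volume) atTop (𝓝 0) := by
    have h1 : ∀ n, ∫⁻ y, H n y ∂ν.prod volume =
        ENNReal.ofReal (4 * L * ∫ p, tent (F.gap K j p / e n) ∂τ) := by
      intro n
      rw [← hgint, ofReal_integral_eq_lintegral_ofReal (hgi n) (hgnn n), hτ,
        lintegral_prod _ (hgm n).ennreal_ofReal.aemeasurable]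
    simp only [h1]
    have h2 := ENNReal.tendsto_ofReal ((F.tendsto_integral_tent hK hν j).const_mul (4 * L))
    rwa [mul_zero, ENNReal.ofReal_zero] at h2
  -- Fatou's lemma; a touching would keep this lower limit at least `κ * θ > 0`.
  have hlim : ∫⁻ y, liminf (fun n => H n y) atTop ∂ν.prod volume = 0 := by
    refine le_antisymm ((lintegral_liminf_le hHm).trans ?_) zero_le
    rw [hHint.liminf_eq]
  rw [lintegral_eq_zero_iff (Measurable.liminf hHm)] at hlim
  filter_upwards [hlim, Measure.quasiMeasurePreserving_fst.ae hν] with y hy hx htouch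
  obtain ⟨x, c⟩ := y
  obtain ⟨κ, θ, ε₀, s, hκ, hθ, hε₀, hs, hdis⟩ := htouch.exists_dissipation F.adm hx
    (F.leaf_hasWidth hK c)
  have hev : ∀ᶠ n in atTop, ENNReal.ofReal (κ * θ) ≤ H n (x, c) := by
    have : Tendsto e atTop (𝓝 0) := tendsto_one_div_add_atTop_nhds_zero_nat
    filter_upwards [this.eventually (gt_mem_nhds hε₀)] with n hn
    obtain ⟨hend, hwin⟩ := hdis (e n) (e0 n) hn
    calc ENNReal.ofReal (κ * θ)
        = ENNReal.ofReal (κ / e n) * volume (Ioc s (s + θ * e n)) := by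
          rw [Real.volume_Ioc, ← ENNReal.ofReal_mul (by have := e0 n; positivity)]
          congr 1
          have := (e0 n).ne'
          field_simp
          ring
      _ = ∫⁻ _ in Ioc s (s + θ * e n), ENNReal.ofReal (κ / e n) := (setLIntegral_const _ _).symm
      _ ≤ ∫⁻ t in Ioc s (s + θ * e n), ENNReal.ofReal (g n ((x, c), t)) := by
          refine setLIntegral_mono' measurableSet_Ioc fun t ht => ENNReal.ofReal_le_ofReal ?_
          have ht' : t ∈ Icc (0 : ℝ) 1 := ⟨hs.trans ht.1.le, ht.2.trans hend⟩
          have h1 := hwin t ⟨ht.1.le, ht.2⟩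
          have h2 : 0 ≤ 4 * L * tent (F.gap K j ((x, c), t) / e n) :=
            mul_nonneg (by positivity) (tent_nonneg _)
          simp only [hg, hflux]
          rw [F.gap_eq hK hx c ht', F.gapVel_eq hK hx c ht', F.gap_eq hK hx c ht',
            F.gap_eq hK hx c ht'] at *
          linarith
      _ ≤ H n (x, c) := lintegral_mono_set (Ioc_subset_Ioc hs hend)
  have h3 : ENNReal.ofReal (κ * θ) ≤ liminf (fun n => H n (x, c)) atTop := le_liminf_of_le (by isBoundedDefault) hev
  have h4 : liminf (fun n => H n (x, c)) atTop = 0 := hy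
  rw [h4] at h3
  have : 0 < ENNReal.ofReal (κ * θ) := ENNReal.ofReal_pos.2 (by positivity)
  exact absurd h3 (not_le.2 this)

end Foliation

end

/-! ### Maximum principles on blocks, and touchings from local maxima of the phase. -/

section

variable {W V f : ℝ → ℝ} {δ C ρ : ℝ}

/-- Weak maximum principle on a block of particles whose ends stay ordered. -/
theorem Admissible.flow_le_of_block (h : Admissible W V f δ C) {K : ℝ} {u v : ℤ → ℝ}
    (hu : HasWidth ρ K u) (hv : HasWidth ρ K v) {i l : ℤ} {τ : ℝ} (hτ : τ ≤ 1)
    (hi : ∀ t ∈ Icc 0 τ, flow W V f u t i ≤ flow W V f v t i)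
    (hl : ∀ t ∈ Icc 0 τ, flow W V f u t l ≤ flow W V f v t l)
    (h0 : ∀ j ∈ Ioo i l, u j ≤ v j) :
    ∀ t ∈ Icc 0 τ, ∀ j ∈ Icc i l, flow W V f u t j ≤ flow W V f v t j := by
  classical
  have hsu := h.flow_isSolution hu
  have hsv := h.flow_isSolution hv
  obtain ⟨L, hL, hlin⟩ := hsu.exists_linearization h hsv (ρ := ρ) (K := K) (K' := K)
    (by rwa [h.flow_zero hu]) (by rwa [h.flow_zero hv]) τ
  obtain ⟨D, hD0, hD⟩ := h.exists_force_bound ρ K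
  have hδ := h.pos
  set x := flow W V f u with hx
  set y := flow W V f v with hy
  -- Replacing the difference by zero outside the block preserves the subsolution inequality, as the
  -- end differences are nonpositive. The bound `2 * D` is the nonpositive initial value plus the
  -- displacement of two particles in time at most 1.
  have key := nonpos_of_subsolution (I := Ioo i l) (τ := τ) (L := L) (B := 2 * D)
    (y := fun t j => if j ∈ Ioo i l then x t j - y t j else 0)
    (y' := fun t j => force W V f t (x t) j - force W V f t (y t) j) hL
    (fun j hj => by
      simp only [if_pos hj]
      exact ((hsu.continuousOn j).sub (hsv.continuousOn j)).mono fun s hs => hs.1)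
    (fun j hj t ht => by
      simp only [if_pos hj]
      exact ((hsu.hasDeriv t ht.1 j).sub (hsv.hasDeriv t ht.1 j)).mono
        (Ici_subset_Ici.2 ht.1))
    (fun j hj t ht => by
      have ht' : t ∈ Icc 0 τ := ⟨ht.1, ht.2.le⟩
      obtain ⟨a, b, k, ha, haL, hb, hbL, hk, he⟩ := hlin t ht' j
      refine ⟨a, b, k, by linarith, haL, by linarith, hbL, hk, ?_⟩
      have e1 : x t (j + 1) - y t (j + 1) ≤
          if j + 1 ∈ Ioo i l then x t (j + 1) - y t (j + 1) else 0 := by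
        split_ifs with hm
        · exact le_rfl
        · have : j + 1 = l := by
            simp only [mem_Ioo] at hj hm
            omega
          rw [this]
          linarith [hl t ht']
      have e2 : x t (j - 1) - y t (j - 1) ≤
          if j - 1 ∈ Ioo i l then x t (j - 1) - y t (j - 1) else 0 := by
        split_ifs with hm
        · exact le_rfl
        · have : j - 1 = i := by
            simp only [mem_Ioo] at hj hm
            omega
          rw [this]
          linarith [hi t ht']
      simp only [if_pos hj]
      rw [he]
      have := mul_le_mul_of_nonneg_left e1 (by linarith : 0 ≤ a)
      have := mul_le_mul_of_nonneg_left e2 (by linarith : 0 ≤ b)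
      linarith)
    (fun t ht j => by
      have l0 : (0 : ℝ) ∈ Icc (0 : ℝ) 1 := ⟨le_rfl, zero_le_one⟩
      have ht' : t ∈ Icc (0 : ℝ) 1 := ⟨ht.1, ht.2.trans hτ⟩
      split_ifs with hj
      · have e1 := h.abs_flow_sub_le hu (hD u hu) l0 ht' j
        have e2 := h.abs_flow_sub_le hv (hD v hv) l0 ht' j
        rw [h.flow_zero hu, sub_zero, abs_of_nonneg ht.1] at e1
        rw [h.flow_zero hv, sub_zero, abs_of_nonneg ht.1] at e2
        have := mul_le_of_le_one_right hD0 ht'.2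
        have := h0 j hj
        rw [abs_le] at e1 e2
        linarith [e1.2, e2.1]
      · positivity)
    (fun j hj => by
      simp only [if_pos hj]
      rw [hx, hy, h.flow_zero hu, h.flow_zero hv]
      linarith [h0 j hj])
    (fun j hj t _ => by simp only [if_neg hj, le_refl])
  intro t ht j hj
  by_cases hm : j ∈ Ioo i l
  · have := key t ht j
    simp only [if_pos hm] at this
    linarith
  · have : j = i ∨ j = l := by
      simp only [mem_Ioo, mem_Icc] at hj hm
      omega
    rcases this with rfl | rfl
    exacts [hi t ht, hl t ht]

/-- Strong maximum principle on a block of particles whose ends stay strictly ordered. -/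
theorem Admissible.flow_lt_of_block (h : Admissible W V f δ C) {K : ℝ} {u v : ℤ → ℝ}
    (hu : HasWidth ρ K u) (hv : HasWidth ρ K v) {i l : ℤ} {τ : ℝ} (hτ : τ ≤ 1)
    (hi : ∀ t ∈ Icc 0 τ, flow W V f u t i < flow W V f v t i)
    (hl : ∀ t ∈ Icc 0 τ, flow W V f u t l < flow W V f v t l)
    (h0 : ∀ j ∈ Ioo i l, u j ≤ v j) :
    ∀ j ∈ Ioo i l, ∀ t ∈ Ioc 0 τ, flow W V f u t j < flow W V f v t j := by
  have hw := h.flow_le_of_block hu hv hτ (fun t ht => (hi t ht).le) (fun t ht => (hl t ht).le) h0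
  have key : ∀ n : ℕ, i + n < l → ∀ t ∈ Ioc 0 τ,
      flow W V f u t (i + n) < flow W V f v t (i + n) := by
    intro n
    induction n with
    | zero =>
      intro _ t ht
      rw [Nat.cast_zero, add_zero]
      exact hi t ⟨ht.1.le, ht.2⟩
    | succ n ih =>
      intro hn t ht
      push_cast at hn ⊢
      have hsub : ∀ s ∈ Icc 0 t, s ∈ Icc 0 τ := fun s hs => ⟨hs.1, hs.2.trans ht.2⟩
      refine h.lt_of_le_of_lt (ρ := ρ) (K := K) (K' := K) (h.flow_isSolution hu)
        (h.flow_isSolution hv) (by rwa [h.flow_zero hu]) (by rwa [h.flow_zero hv])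
        (fun s hs => hw s (hsub s hs) _ ?_) (fun s hs => hw s (hsub s hs) _ ?_)
        (fun s hs => hw s (hsub s hs) _ ?_) (Or.inr fun s hs => ?_) ht.1
      · rw [mem_Icc]; omega
      · rw [mem_Icc]; omega
      · rw [mem_Icc]; omega
      · rw [show i + (n + 1) - 1 = i + (n : ℤ) by ring]
        exact ih (by omega) s ⟨hs.1, hs.2.le.trans ht.2⟩
  intro j hj t ht
  have hj' := hj
  rw [mem_Ioo] at hj'
  have e : i + ((j - i).toNat : ℤ) = j := by omega
  have := key (j - i).toNat (by omega) t ht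
  rwa [e] at this

namespace Foliation

variable (F : Foliation W V f ρ)

/-- The phase of the leaf through the particle `j` of `u`. -/
def phase (u : ℤ → ℝ) (j : ℤ) : ℝ := F.hull.symm (u j) - j * ρ

theorem leaf_phase (u : ℤ → ℝ) (j : ℤ) : leaf F.hull ρ (F.phase u j) j = u j := by
  rw [leaf, phase, sub_add_cancel, OrderIso.apply_symm_apply]

theorem phase_lt_iff {u : ℤ → ℝ} {j : ℤ} {c : ℝ} : F.phase u j < c ↔ u j < leaf F.hull ρ c j := by
  rw [leaf, phase, sub_lt_iff_lt_add, ← F.hull.symm_apply_lt]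

theorem phase_le_iff {u : ℤ → ℝ} {j : ℤ} {c : ℝ} : F.phase u j ≤ c ↔ u j ≤ leaf F.hull ρ c j := by
  rw [leaf, phase, sub_le_iff_le_add, ← F.hull.symm_apply_le]

theorem phase_leaf (c : ℝ) (j : ℤ) : F.phase (leaf F.hull ρ c) j = c := by
  rw [phase, leaf, OrderIso.symm_apply_apply, add_sub_cancel_right]

/-- A configuration whose phase has a local maximum touches a family of leaves from below. -/
theorem exists_touch {K : ℝ} (hK : F.width ≤ K) {u : ℤ → ℝ} (hu : HasWidth ρ K u) {i k l : ℤ}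
    (hik : i < k) (hkl : k < l) (hi : F.phase u i < F.phase u k)
    (hl : F.phase u l < F.phase u k) :
    ∃ a b : ℝ, a < b ∧ ∀ c ∈ Ioo a b, ∃ j, Touch (flow W V f u) (flow W V f (leaf F.hull ρ c)) j := by
  have hsu := F.adm.flow_isSolution hu
  have hv := F.leaf_hasWidth hK
  have hsv := fun c => F.adm.flow_isSolution (hv c)
  have hmono : ∀ c c' t, c ≤ c' → 0 ≤ t → ∀ j,
      flow W V f (leaf F.hull ρ c) t j ≤ flow W V f (leaf F.hull ρ c') t j := fun c c' t hc ht j =>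
    F.adm.flow_mono (hv c) (hv c') (fun j => F.hull.monotone (by linarith)) ht j
  -- On the block, `u` lies weakly below the leaf through its particle `m` of maximal phase, while
  -- both ends lie strictly below the lower leaf `c₁`, and remain so for a short time.
  obtain ⟨m, hm, hmax⟩ := (Finset.Ioo i l).exists_max_image (F.phase u) ⟨k, by simp [hik, hkl]⟩
  have hkm := hmax k (by simp [hik, hkl])
  obtain ⟨c₁, hc₁, hc₁m⟩ := exists_between
    (max_lt (hi.trans_le hkm) (hl.trans_le hkm))
  have end_lt : ∀ j, F.phase u j < c₁ →
      ∀ᶠ t in 𝓝[≥] (0 : ℝ), flow W V f u t j < flow W V f (leaf F.hull ρ c₁) t j := by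
    intro j hj
    have e1 := hsu.continuousOn j 0 self_mem_Ici
    have e2 := hsv c₁ |>.continuousOn j 0 self_mem_Ici
    refine e1.eventually_lt e2 ?_
    simp only [F.adm.flow_zero hu, F.adm.flow_zero (hv c₁)]
    exact F.phase_lt_iff.1 hj
  obtain ⟨t₀, ht₀, ht₀'⟩ := mem_nhdsGE_iff_exists_Icc_subset.1
    ((end_lt i ((le_max_left _ _).trans_lt hc₁)).and (end_lt l ((le_max_right _ _).trans_lt hc₁)))
  set τ := min t₀ 1 with hτ
  have hτ0 : 0 < τ := lt_min ht₀ one_pos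
  have hτ1 : τ ≤ 1 := min_le_right _ _
  have hends : ∀ c, c₁ ≤ c → ∀ t ∈ Icc 0 τ,
      flow W V f u t i < flow W V f (leaf F.hull ρ c) t i ∧
      flow W V f u t l < flow W V f (leaf F.hull ρ c) t l := fun c hc t ht => by
    have := ht₀' ⟨ht.1, ht.2.trans (min_le_left _ _)⟩
    exact ⟨this.1.trans_le (hmono _ _ t hc ht.1 i), this.2.trans_le (hmono _ _ t hc ht.1 l)⟩
  have lτ : τ ∈ Icc (0 : ℝ) τ := ⟨hτ0.le, le_rfl⟩
  have hlt := F.adm.flow_lt_of_block hu (hv (F.phase u m)) hτ1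
    (fun t ht => (hends _ hc₁m.le t ht).1) (fun t ht => (hends _ hc₁m.le t ht).2)
    (fun j hj => F.phase_le_iff.1 (hmax j (Finset.mem_Ioo.2 hj)))
  -- At time `τ` the block is strictly below the top leaf, hence by continuity below slightly lower
  -- leaves too. At time 0 particle `m` is still above those, so a last contact must occur in
  -- between.
  have hev : ∀ᶠ c in 𝓝 (F.phase u m), ∀ j ∈ Finset.Ioo i l,
      flow W V f u τ j < flow W V f (leaf F.hull ρ c) τ j := by
    rw [Filter.eventually_all_finset]
    intro j hj
    have hcont : Continuous fun c => flow W V f (leaf F.hull ρ c) τ j := by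
      refine (F.adm.flow_continuousOn ρ K 1 j).comp_continuous
        ((continuous_leaf F.hull ρ).prodMk continuous_const) fun c => ⟨hv c, hτ0.le, hτ1⟩
    exact hcont.continuousAt.eventually_const_lt (hlt j (Finset.mem_Ioo.1 hj) τ ⟨hτ0, le_rfl⟩)
  obtain ⟨a, ha, ha'⟩ := (mem_nhdsLT_iff_exists_Ioo_subset' hc₁m).1
    (mem_nhdsWithin_of_mem_nhds hev)
  refine ⟨max a c₁, F.phase u m, max_lt ha hc₁m, fun c hc => ?_⟩
  have hca : a < c := (le_max_left _ _).trans_lt hc.1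
  have hcc : c₁ < c := (le_max_right _ _).trans_lt hc.1
  have hτlt : ∀ j ∈ Ioo i l, flow W V f u τ j < flow W V f (leaf F.hull ρ c) τ j :=
    fun j hj => ha' ⟨hca, hc.2⟩ j (Finset.mem_Ioo.2 hj)
  have hce := hends c hcc.le
  set x := flow W V f u with hx
  set y := flow W V f (leaf F.hull ρ c) with hy
  have hxc : ∀ j, ContinuousOn (fun t => x t j) (Icc 0 τ) := fun j =>
    (hsu.continuousOn j).mono fun s hs => hs.1
  have hyc : ∀ j, ContinuousOn (fun t => y t j) (Icc 0 τ) := fun j =>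
    ((hsv c).continuousOn j).mono fun s hs => hs.1
  set A : Set ℝ := ⋃ j ∈ Finset.Ioo i l, {t ∈ Icc 0 τ | y t j ≤ x t j} with hA
  have hAc : IsCompact A := (Finset.Ioo i l).isCompact_biUnion fun j _ =>
    isCompact_Icc.of_isClosed_subset (isClosed_Icc.isClosed_le (hyc j) (hxc j))
      fun t ht => ht.1
  have hm' : m ∈ Ioo i l := Finset.mem_Ioo.1 hm
  have hAne : A.Nonempty := by
    refine ⟨0, mem_iUnion₂.2 ⟨m, hm, ⟨le_rfl, hτ0.le⟩, ?_⟩⟩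
    rw [hx, hy, F.adm.flow_zero hu, F.adm.flow_zero (hv c)]
    rw [← not_lt, ← F.phase_lt_iff, not_lt]
    exact hc.2.le
  obtain ⟨t₁, ht₁, hgreat⟩ := hAc.exists_isGreatest hAne
  obtain ⟨j₀, hj₀, ht₁I, hj₀'⟩ := mem_iUnion₂.1 ht₁
  have ht₁τ : t₁ < τ := by
    refine ht₁I.2.lt_of_ne fun e => ?_
    rw [e] at hj₀'
    exact absurd hj₀' (not_le.2 (hτlt j₀ (Finset.mem_Ioo.1 hj₀)))
  have hafter : ∀ j ∈ Ioo i l, ∀ t ∈ Ioc t₁ τ, x t j < y t j := by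
    intro j hj t ht
    by_contra hcon
    have : t ∈ A := mem_iUnion₂.2 ⟨j, Finset.mem_Ioo.2 hj, ⟨ht₁I.1.trans ht.1.le, ht.2⟩,
      not_lt.1 hcon⟩
    exact absurd (hgreat this) (not_le.2 ht.1)
  have hle : ∀ j ∈ Ioo i l, ∀ t ∈ Icc t₁ τ, x t j ≤ y t j := by
    intro j hj t ht
    rcases ht.1.eq_or_lt with rfl | hlt'
    · refine ContinuousWithinAt.closure_le (s := Ioc t₁ τ) ?_ (((hxc j) t₁ ht₁I).mono ?_)
        (((hyc j) t₁ ht₁I).mono ?_) (fun s hs => (hafter j hj s hs).le)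
      · rw [closure_Ioc ht₁τ.ne]
        exact ⟨le_rfl, ht₁τ.le⟩
      · exact fun s hs => ⟨ht₁I.1.trans hs.1.le, hs.2⟩
      · exact fun s hs => ⟨ht₁I.1.trans hs.1.le, hs.2⟩
    · exact (hafter j hj t ⟨hlt', ht.2⟩).le
  -- The leftmost contact at the last contact time has a strictly ordered left neighbour, by
  -- induction from the strictly ordered end `i`.
  have hjex : ∃ j ∈ Ioo i l, y t₁ j ≤ x t₁ j ∧ x t₁ (j - 1) < y t₁ (j - 1) := by
    by_contra! hcon
    have : ∀ n : ℕ, i + n < l → x t₁ (i + n) < y t₁ (i + n) := by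
      intro n
      induction n with
      | zero =>
        intro _
        rw [Nat.cast_zero, add_zero]
        exact (hce t₁ ht₁I).1
      | succ n ih =>
        intro hn
        push_cast at hn ⊢
        by_contra hge
        have := hcon (i + (n + 1)) ⟨by omega, hn⟩ (not_lt.1 hge)
        rw [show i + ((n : ℤ) + 1) - 1 = i + n by ring] at this
        exact absurd (ih (by omega)) (not_lt.2 this)
    have hj := Finset.mem_Ioo.1 hj₀
    have h2 := this (j₀ - i).toNat (by omega)
    rw [show i + ((j₀ - i).toNat : ℤ) = j₀ by omega] at h2
    exact absurd h2 (not_lt.2 hj₀')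
  obtain ⟨j, hj, hge, hleft⟩ := hjex
  have hj' := hj
  rw [mem_Ioo] at hj'
  have lt₁ : t₁ ∈ Icc t₁ τ := ⟨le_rfl, ht₁τ.le⟩
  refine ⟨j, t₁, ⟨ht₁I.1, ht₁τ.trans_le hτ1⟩, τ, ⟨ht₁τ, hτ1⟩, le_antisymm (hle j hj t₁ lt₁) hge,
    hleft, fun t ht => ?_⟩
  by_cases hjl : j + 1 = l
  · rw [hjl]
    exact (hce t ⟨ht₁I.1.trans ht.1, ht.2⟩).2.le
  · exact hle (j + 1) ⟨by omega, by omega⟩ t ht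

end Foliation

end

/-! ### Phases are almost surely constant, so invariant measures live on the leaves. -/

section

variable {W V f : ℝ → ℝ} {δ C ρ : ℝ}

/-- The total variation of a sequence without strict interior maxima on blocks. -/
theorem sum_abs_sub_le_of_le_max {p : ℤ → ℝ} {N : ℝ}
    (hp : ∀ i k l : ℤ, i < k → k < l → p k ≤ max (p i) (p l)) (hN : ∀ i j, |p i - p j| ≤ N) (n : ℕ) :
    ∑ j ∈ Finset.range n, |p ((j : ℤ) + 1) - p j| ≤ 2 * N := by
  -- The sequence decreases up to a minimum and increases after it, so its variation telescopes on
  -- both sides.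
  obtain ⟨m, hm, hmin⟩ := (Finset.range (n + 1)).exists_min_image (fun j : ℕ => p j) ⟨0, by simp⟩
  rw [Finset.mem_range] at hm
  obtain ⟨r, rfl⟩ := Nat.exists_eq_add_of_le (Nat.lt_succ_iff.1 hm)
  have hmin' : ∀ j : ℕ, j ≤ m + r → p m ≤ p j := fun j hj =>
    hmin j (Finset.mem_range.2 (by omega))
  rw [Finset.sum_range_add]
  have e1 : ∑ j ∈ Finset.range m, |p ((j : ℤ) + 1) - p j| = p 0 - p m := by
    have := Finset.sum_range_sub' (fun j : ℕ => p j) m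
    rw [Nat.cast_zero] at this
    rw [← this]
    refine Finset.sum_congr rfl fun j hj => ?_
    rw [Finset.mem_range] at hj
    have : p ((j : ℤ) + 1) ≤ p j := by
      have h1 := hmin' j (by omega)
      rcases Nat.lt_or_eq_of_le (Nat.succ_le_of_lt hj) with h | h
      · have := hp j (j + 1) m (by omega) (by omega)
        rwa [max_eq_left h1] at this
      · rw [← h] at h1
        push_cast at h1
        exact h1
    rw [abs_of_nonpos (by linarith)]
    push_cast
    ring
  have e2 : ∑ j ∈ Finset.range r, |p (((m + j : ℕ) : ℤ) + 1) - p ((m + j : ℕ) : ℤ)| =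
      p ((m + r : ℕ) : ℤ) - p m := by
    have := Finset.sum_range_sub (fun j : ℕ => p ((m + j : ℕ) : ℤ)) r
    rw [add_zero] at this
    rw [← this]
    refine Finset.sum_congr rfl fun j hj => ?_
    rw [Finset.mem_range] at hj
    have : p ((m + j : ℕ) : ℤ) ≤ p (((m + j : ℕ) : ℤ) + 1) := by
      have h1 := hmin' (m + j + 1) (by omega)
      push_cast at h1 ⊢
      rcases Nat.eq_zero_or_pos j with h | h
      · rw [h] at h1 ⊢
        simpa using h1
      · have := hp m (m + j) (m + j + 1) (by omega) (by omega)
        rwa [max_eq_right h1] at this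
    rw [abs_of_nonneg (by linarith)]
    push_cast
    rw [add_assoc]
  rw [e1, e2]
  have h1 := (abs_le.1 (hN 0 m)).2
  have h2 := (abs_le.1 (hN ((m + r : ℕ) : ℤ) m)).2
  linarith

theorem measurePreserving_translate {ν : Measure StateSpace} (hS : MeasurePreserving shift ν ν)
    (n : ℤ) : MeasurePreserving (translate n) ν ν := by
  have hS' : MeasurePreserving (translate 1) ν ν :=
    MeasurePreserving.symm shiftHomeomorph.toMeasurableEquiv hS
  induction n using Int.induction_on with
  | zero =>
    rw [show translate 0 = id from funext translate_zero]
    exact MeasurePreserving.id ν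
  | succ k ih =>
    rw [show translate ((k : ℤ) + 1) = translate 1 ∘ translate k from
      funext fun x => by rw [Function.comp_apply, translate_translate, add_comm]]
    exact hS'.comp ih
  | pred k ih =>
    rw [show translate (-(k : ℤ) - 1) = shift ∘ translate (-k) from
      funext fun x => by
        rw [Function.comp_apply, shift_eq_translate, translate_translate, sub_eq_add_neg, add_comm]]
    exact hS.comp ih

namespace Foliation

variable (F : Foliation W V f ρ)

theorem phase_add_int (u : ℤ → ℝ) (n j : ℤ) : F.phase (fun j => u j + n) j = F.phase u j + n := by
  have h : F.hull.symm (u j + n) = F.hull.symm (u j) + n := by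
    rw [OrderIso.symm_apply_eq, hull_add_int F.hull_add_one, OrderIso.apply_symm_apply]
  rw [phase, phase, h]
  ring

theorem phase_translate (u : ℤ → ℝ) (n j : ℤ) :
    F.phase (fun j => u (j + n)) j = F.phase u (j + n) + n * ρ := by
  rw [phase, phase]
  push_cast
  ring

theorem phase_rep_translate (n : ℤ) (x : StateSpace) :
    ∃ k : ℤ, ∀ j, F.phase (rep (translate n x)) j = F.phase (rep x) (j + n) + n * ρ + k := by
  obtain ⟨k, hk⟩ := rep_translate n x
  exact ⟨k, fun j => by rw [hk, F.phase_add_int, F.phase_translate]⟩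

theorem abs_phase_sub_le (u : ℤ → ℝ) (j : ℤ) : |u j - (F.phase u j + j * ρ)| ≤ |F.hull 0| + 1 := by
  have := abs_hull_sub_le F.hull_add_one (F.phase u j + j * ρ)
  rwa [show F.hull (F.phase u j + j * ρ) = u j from F.leaf_phase u j] at this

theorem hasWidth_of_phase {N : ℝ} {u : ℤ → ℝ} (h : ∀ i j, |F.phase u i - F.phase u j| ≤ N) :
    HasWidth ρ (N + F.width) u := by
  intro m n
  have h1 := abs_le.1 (F.abs_phase_sub_le u m)
  have h2 := abs_le.1 (F.abs_phase_sub_le u n)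
  have h3 := abs_le.1 (h m n)
  rw [width, abs_le]
  constructor <;> linarith [h1.1, h1.2, h2.1, h2.2, h3.1, h3.2]

theorem abs_phase_sub_phase_le {K : ℝ} {u : ℤ → ℝ} (h : HasWidth ρ K u) (m n : ℤ) :
    |F.phase u m - F.phase u n| ≤ K + F.width := by
  have h1 := abs_le.1 (F.abs_phase_sub_le u m)
  have h2 := abs_le.1 (F.abs_phase_sub_le u n)
  have h3 := abs_le.1 (h m n)
  rw [width, abs_le]
  constructor <;> linarith [h1.1, h1.2, h2.1, h2.2, h3.1, h3.2]

theorem measurable_phase_rep (j : ℤ) : Measurable fun x => F.phase (rep x) j :=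
  (F.hull.symm.continuous.measurable.comp
    ((measurable_pi_apply j).comp measurable_rep)).sub_const _

/-- The classes of configurations between two leaves with phases differing by `N`. -/
def band (N : ℕ) : Set StateSpace := {x | ∀ i j, |F.phase (rep x) i - F.phase (rep x) j| ≤ N}

theorem measurableSet_band (N : ℕ) : MeasurableSet (F.band N) := by
  simp only [band, ofPred_forall]
  exact MeasurableSet.iInter fun i => MeasurableSet.iInter fun j =>
    measurableSet_le ((F.measurable_phase_rep i).sub (F.measurable_phase_rep j)).abs measurable_const

theorem translate_mem_band {N : ℕ} {x : StateSpace} (hx : x ∈ F.band N) (n : ℤ) :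
    translate n x ∈ F.band N := by
  obtain ⟨k, hk⟩ := F.phase_rep_translate n x
  intro i j
  rw [hk, hk, add_sub_add_right_eq_sub, add_sub_add_right_eq_sub]
  exact hx _ _

/-- The configuration lies between the leaves of phases `a` and `a + N`. Monotonicity keeps it
between their images, whose phases have both moved by the drift. -/
theorem timeOne_mem_band {N : ℕ} {x : StateSpace} (hx : x ∈ F.band N) :
    timeOne W V f x ∈ F.band N := by
  have hw := F.hasWidth_of_phase hx
  obtain ⟨k, hk⟩ := F.adm.rep_timeOne hw
  have hbdd : BddBelow (range (F.phase (rep x))) :=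
    ⟨F.phase (rep x) 0 - N, by
      rintro _ ⟨j, rfl⟩
      linarith [(abs_le.1 (hx j 0)).1]⟩
  set a := ⨅ j, F.phase (rep x) j with ha
  have h1 : ∀ j, a ≤ F.phase (rep x) j := ciInf_le hbdd
  have h2 : ∀ j, F.phase (rep x) j ≤ a + N := fun j => by
    have : F.phase (rep x) j - N ≤ a := le_ciInf fun i => by linarith [(abs_le.1 (hx j i)).2]
    linarith
  have h3 : ∀ j, leaf F.hull ρ (a + F.drift) j ≤ flow W V f (rep x) 1 j := fun j => by
    rw [← F.flow_leaf]
    refine F.adm.flow_mono (F.leaf_hasWidth le_rfl a) hw (fun i => ?_) zero_le_one j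
    rw [← F.leaf_phase (rep x) i]
    exact F.hull.monotone (by linarith [h1 i])
  have h4 : ∀ j, flow W V f (rep x) 1 j ≤ leaf F.hull ρ (a + N + F.drift) j := fun j => by
    rw [← F.flow_leaf]
    exact F.adm.flow_mono hw (F.leaf_hasWidth le_rfl _) (fun i => F.phase_le_iff.1 (h2 i))
      zero_le_one j
  intro i j
  rw [hk, F.phase_add_int, F.phase_add_int, add_sub_add_right_eq_sub]
  have g1 : ∀ j, a + F.drift ≤ F.phase (flow W V f (rep x) 1) j := fun j => by
    rw [← not_lt, F.phase_lt_iff, not_lt]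
    exact h3 j
  have g2 : ∀ j, F.phase (flow W V f (rep x) 1) j ≤ a + N + F.drift := fun j =>
    F.phase_le_iff.2 (h4 j)
  rw [abs_le]
  constructor <;> linarith [g1 i, g1 j, g2 i, g2 j]

theorem shift_preimage_band (N : ℕ) : shift ⁻¹' F.band N = F.band N := by
  ext x
  refine ⟨fun hx => ?_, fun hx => F.translate_mem_band hx (-1)⟩
  have := F.translate_mem_band hx 1
  rwa [shift_eq_translate, translate_translate, show (1 : ℤ) + -1 = 0 by norm_num,
    translate_zero] at this

/-- By Fubini, almost every trajectory touches leaves only for a null set of phases, whereas a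
violation would produce touchings on a whole interval of phases. -/
theorem ae_phase_le_max {ν : Measure StateSpace} [IsFiniteMeasure ν] {K : ℝ} (hK : F.width ≤ K)
    (hν : ∀ᵐ x ∂ν, HasWidth ρ K (rep x)) (hS : MeasurePreserving shift ν ν)
    (hT : MeasurePreserving (timeOne W V f) ν ν) :
    ∀ᵐ x ∂ν, ∀ i k l : ℤ, i < k → k < l →
      F.phase (rep x) k ≤ max (F.phase (rep x) i) (F.phase (rep x) l) := by
  have h := Measure.ae_ae_of_ae_prod (ae_all_iff.2 (F.ae_not_touch hK hν hS hT))
  filter_upwards [h, hν] with x hx hw i k l hik hkl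
  by_contra! hlt
  obtain ⟨hi, hl⟩ := max_lt_iff.1 hlt
  obtain ⟨a, b, hab, ht⟩ := F.exists_touch hK hw hik hkl hi hl
  have : Ioo a b ⊆ {c | ¬ ∀ j, ¬ Touch (flow W V f (rep x)) (flow W V f (leaf F.hull ρ c)) j} :=
    fun c hc hcon => by
      obtain ⟨j, hj⟩ := ht c hc
      exact hcon j hj
  have h0 := measure_mono_null this (ae_iff.1 hx)
  rw [Real.volume_Ioo, ENNReal.ofReal_eq_zero] at h0
  linarith

/-- By `S`-invariance the mean variation over `n` bonds is `n` times that of one bond, yet it stays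
below `2 * N` times the total mass. So the mean variation of a bond is zero. -/
theorem ae_phase_eq {ν : Measure StateSpace} [IsFiniteMeasure ν] {N : ℕ}
    (hν : ∀ᵐ x ∂ν, x ∈ F.band N) (hS : MeasurePreserving shift ν ν)
    (hT : MeasurePreserving (timeOne W V f) ν ν) :
    ∀ᵐ x ∂ν, ∀ j, F.phase (rep x) (j + 1) = F.phase (rep x) j := by
  have hmax := F.ae_phase_le_max (K := N + F.width)
    (le_add_of_nonneg_left N.cast_nonneg) (hν.mono fun x hx => F.hasWidth_of_phase hx) hS hT
  set g : StateSpace → ENNReal := fun x =>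
    ENNReal.ofReal |F.phase (rep x) 1 - F.phase (rep x) 0| with hg
  have hgm : Measurable g :=
    ((F.measurable_phase_rep 1).sub (F.measurable_phase_rep 0)).abs.ennreal_ofReal
  have hgt : ∀ (n : ℤ) x, g (translate n x) =
      ENNReal.ofReal |F.phase (rep x) (n + 1) - F.phase (rep x) n| := fun n x => by
    obtain ⟨k, hk⟩ := F.phase_rep_translate n x
    simp only [hg]
    rw [hk, hk, add_sub_add_right_eq_sub, add_sub_add_right_eq_sub, zero_add, add_comm]
  have hle : ∀ n : ℕ, (n : ENNReal) * ∫⁻ x, g x ∂ν ≤ ENNReal.ofReal (2 * N) * ν univ := fun n => by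
    calc (n : ENNReal) * ∫⁻ x, g x ∂ν
        = ∑ j ∈ Finset.range n, ∫⁻ x, g (translate j x) ∂ν := by
          rw [Finset.sum_congr rfl fun (j : ℕ) _ =>
            (measurePreserving_translate hS j).lintegral_comp hgm, Finset.sum_const,
            Finset.card_range, nsmul_eq_mul]
      _ = ∫⁻ x, ∑ j ∈ Finset.range n, g (translate j x) ∂ν :=
          (lintegral_finsetSum (f := fun (j : ℕ) x => g (translate j x)) _ fun j _ => hgm.comp (continuous_translate j).measurable).symm
      _ ≤ ∫⁻ _, ENNReal.ofReal (2 * N) ∂ν := by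
          refine lintegral_mono_ae ?_
          filter_upwards [hmax, hν] with x hx hxN
          simp only [hgt]
          rw [← ENNReal.ofReal_sum_of_nonneg fun _ _ => abs_nonneg _]
          exact ENNReal.ofReal_le_ofReal (sum_abs_sub_le_of_le_max hx hxN n)
      _ = _ := lintegral_const _
  have hzero : ∫⁻ x, g x ∂ν = 0 := by
    by_contra hne
    have hfin : ENNReal.ofReal (2 * N) * ν univ ≠ ⊤ :=
      ENNReal.mul_ne_top ENNReal.ofReal_ne_top (measure_ne_top _ _)
    obtain ⟨n, hn⟩ := ENNReal.exists_nat_mul_gt hne hfin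
    exact absurd (hle n) (not_le.2 hn)
  rw [lintegral_eq_zero_iff hgm] at hzero
  rw [ae_all_iff]
  intro j
  filter_upwards [(measurePreserving_translate hS j).quasiMeasurePreserving.ae hzero] with x hx
  rw [hgt, Pi.zero_apply, ENNReal.ofReal_eq_zero] at hx
  exact sub_eq_zero.1 (abs_nonpos_iff.1 hx)

/-- An invariant measure with the mean spacing of a foliation is carried by the leaves. -/
theorem ae_eq_leaf {μ : Measure StateSpace} (hμ : IsInvariant W V f ρ μ) :
    ∀ᵐ x ∂μ, rep x = leaf F.hull ρ (F.phase (rep x) 0) := by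
  have := hμ.prob
  have hN : ∀ N : ℕ, ∀ᵐ x ∂μ, x ∈ F.band N →
      ∀ j, F.phase (rep x) (j + 1) = F.phase (rep x) j := by
    intro N
    have hB := F.measurableSet_band N
    have hS := hμ.shift.restrict_preimage hB
    rw [F.shift_preimage_band] at hS
    have hT := hμ.time.restrict_preimage hB
    -- The band is only known to be mapped into itself by `T`; equality of finite measures makes it
    -- invariant up to a null set, so that `μ` can be restricted to it.
    have hae : F.band N =ᵐ[μ] timeOne W V f ⁻¹' F.band N :=
      ae_eq_of_subset_of_measure_ge (fun x hx => F.timeOne_mem_band hx)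
        (hμ.time.measure_preimage hB.nullMeasurableSet).le hB.nullMeasurableSet
        (measure_ne_top _ _)
    rw [← Measure.restrict_congr_set hae] at hT
    exact (ae_restrict_iff' hB).1 (F.ae_phase_eq (ae_restrict_mem hB) hS hT)
  filter_upwards [ae_all_iff.2 hN, hμ.spacing] with x hx hsp
  obtain ⟨K, hK⟩ := mem_withSpacing_iff.1 hsp
  obtain ⟨N, hNK⟩ := exists_nat_ge (K + F.width)
  have hstep := hx N fun i j => (F.abs_phase_sub_phase_le hK i j).trans hNK
  have hconst : ∀ j, F.phase (rep x) j = F.phase (rep x) 0 := fun j => by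
    induction j using Int.induction_on with
    | zero => rfl
    | succ k ih => rw [hstep, ih]
    | pred k ih => rw [← ih, ← hstep, sub_add_cancel]
  ext j
  rw [← hconst j, F.leaf_phase]

end Foliation

end

/-! ### Unique ergodicity of the rotation and transfer to the state space. -/

section

variable {W V f : ℝ → ℝ} {δ C ρ : ℝ}

open scoped BoundedContinuousFunction in
/-- Irrational rotations of the circle are uniquely ergodic. -/
theorem eq_volume_of_measurePreserving_rotation {a : UnitAddCircle}
    (ha : DenseRange (· • a : ℤ → UnitAddCircle)) {κ : Measure UnitAddCircle}
    [IsProbabilityMeasure κ] (hκ : MeasurePreserving (a + ·) κ κ) : κ = volume := by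
  have hneg : MeasurePreserving (-a + ·) κ κ :=
    MeasurePreserving.symm (MeasurableEquiv.addLeft a) hκ
  have hz : ∀ n : ℤ, MeasurePreserving (n • a + ·) κ κ := by
    intro n
    induction n using Int.induction_on with
    | zero =>
      convert MeasurePreserving.id κ using 1
      ext s
      rw [zero_smul, zero_add, id_eq]
    | succ k ih =>
      convert hκ.comp ih using 1
      ext s
      rw [Function.comp_apply, add_smul, one_smul, ← add_assoc, add_comm a]
    | pred k ih =>
      convert hneg.comp ih using 1
      ext s
      rw [Function.comp_apply, sub_smul, one_smul, ← add_assoc, sub_eq_neg_add]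
  -- Invariance along the dense orbit extends to all rotations by continuity in `b`; uniqueness of
  -- normalized Haar measure then identifies `κ`.
  have hinv : ∀ b (g : UnitAddCircle →ᵇ ℝ), ∫ s, g (b + s) ∂κ = ∫ s, g s ∂κ := by
    intro b g
    have hc : Continuous fun b => ∫ s, g (b + s) ∂κ :=
      continuous_of_dominated (bound := fun _ => ‖g‖)
        (fun b => (g.continuous.comp (continuous_const.add continuous_id)).aestronglyMeasurable)
        (fun b => ae_of_all _ fun s => g.norm_coe_le_norm _) (integrable_const _)
        (ae_of_all _ fun s => g.continuous.comp (continuous_id.add continuous_const))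
    refine congrFun (ha.equalizer hc continuous_const (funext fun n => ?_)) b
    exact (hz n).integral_comp (MeasurableEquiv.addLeft (n • a)).measurableEmbedding g
  have hleft : κ.IsAddLeftInvariant := ⟨fun b => by
    have : IsProbabilityMeasure (κ.map (b + ·)) :=
      Measure.isProbabilityMeasure_map (measurable_const_add b).aemeasurable
    refine ext_of_forall_integral_eq_of_IsFiniteMeasure fun g => ?_
    rw [integral_map (measurable_const_add b).aemeasurable
      g.continuous.aestronglyMeasurable, hinv]⟩
  have hhaar : κ.IsAddHaarMeasure :=
    Measure.isAddHaarMeasure_of_isCompact_nonempty_interior κ univ isCompact_univ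
      (by rw [interior_univ]; exact univ_nonempty) (by rw [measure_univ]; exact one_ne_zero)
      (measure_ne_top _ _)
  have hvol : IsProbabilityMeasure (volume : Measure UnitAddCircle) := ⟨UnitAddCircle.measure_univ⟩
  exact Measure.isAddHaarMeasure_eq_of_isProbabilityMeasure _ _

namespace Foliation

variable (F : Foliation W V f ρ)

/-- The class of the leaf with phase `c`. -/
def leafClass (c : ℝ) : StateSpace := proj (F.leaf_hasWidth le_rfl c).config

theorem continuous_leafClass : Continuous F.leafClass :=
  continuous_proj.comp (continuous_config fun j =>
    (continuous_apply j).comp (continuous_leaf F.hull ρ))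

theorem leafClass_add_int (c : ℝ) (n : ℤ) : F.leafClass (c + n) = F.leafClass c :=
  (proj_eq_iff.2 ⟨n, fun j => (congrFun (leaf_add_int F.hull_add_one ρ c n) j).symm⟩).symm

theorem shift_leafClass (c : ℝ) : shift (F.leafClass c) = F.leafClass (-ρ + c) := by
  rw [leafClass, shift_proj]
  refine congrArg proj (Subtype.ext ?_)
  refine (leaf_translate F.hull ρ c (-1)).trans ?_
  push_cast
  rw [neg_one_mul, add_comm]
  rfl

/-- The leaves, parametrized by the circle. -/
def circleLeaf : UnitAddCircle → StateSpace :=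
  Quotient.lift F.leafClass (by
    intro c c' h
    obtain ⟨n, hn⟩ := AddSubgroup.mem_zmultiples_iff.1 (QuotientAddGroup.leftRel_apply.1 h)
    have : c' = c + n := by
      rw [zsmul_one] at hn
      linarith
    rw [this, F.leafClass_add_int])

theorem circleLeaf_coe (c : ℝ) : F.circleLeaf (c : UnitAddCircle) = F.leafClass c := rfl

theorem continuous_circleLeaf : Continuous F.circleLeaf :=
  F.continuous_leafClass.quotient_lift _

theorem shift_circleLeaf (s : UnitAddCircle) :
    shift (F.circleLeaf s) = F.circleLeaf (((-ρ : ℝ) : UnitAddCircle) + s) := by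
  obtain ⟨c, rfl⟩ := QuotientAddGroup.mk_surjective s
  exact F.shift_leafClass c

/-- The phase at the particle `0`, as a point of the circle. -/
def circlePhase (x : StateSpace) : UnitAddCircle := (F.phase (rep x) 0 : ℝ)

theorem measurable_circlePhase : Measurable F.circlePhase :=
  (AddCircle.continuous_mk' 1).measurable.comp (F.measurable_phase_rep 0)

theorem circleLeaf_circlePhase {x : StateSpace}
    (hx : rep x = leaf F.hull ρ (F.phase (rep x) 0)) : F.circleLeaf (F.circlePhase x) = x := by
  obtain ⟨u, hu, hux⟩ := exists_proj_rep x
  rw [circlePhase, circleLeaf_coe, ← hux, leafClass]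
  refine congrArg proj (Subtype.ext ?_)
  rw [hux]
  exact hx.symm.trans hu.symm

theorem circlePhase_shift {x : StateSpace} (hx : rep x = leaf F.hull ρ (F.phase (rep x) 0)) :
    F.circlePhase (shift x) = ((-ρ : ℝ) : UnitAddCircle) + F.circlePhase x := by
  obtain ⟨k, hk⟩ := F.phase_rep_translate (-1) x
  have h1 : F.phase (rep x) (0 + -1) = F.phase (rep x) 0 := by
    conv_lhs => rw [hx]
    exact F.phase_leaf _ _
  rw [circlePhase, circlePhase, shift_eq_translate, hk, h1, ← AddCircle.coe_add]
  refine QuotientAddGroup.eq.2 (AddSubgroup.mem_zmultiples_iff.2 ⟨-k, ?_⟩)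
  rw [zsmul_one]
  push_cast
  ring

theorem denseRange_rotation (hρ : Irrational ρ) :
    DenseRange (· • ((-ρ : ℝ) : UnitAddCircle) : ℤ → UnitAddCircle) := by
  rw [AddCircle.denseRange_zsmul_coe_iff, div_one]
  exact hρ.neg

/-- An invariant measure with the mean spacing of a foliation is the uniform distribution on the
leaves. -/
theorem eq_map_volume (hρ : Irrational ρ) {μ : Measure StateSpace} (hμ : IsInvariant W V f ρ μ) :
    μ = (volume : Measure UnitAddCircle).map F.circleLeaf := by
  have := hμ.prob
  have hleaf := F.ae_eq_leaf hμ
  have hm := F.measurable_circlePhase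
  have hprob : IsProbabilityMeasure (μ.map F.circlePhase) :=
    Measure.isProbabilityMeasure_map hm.aemeasurable
  -- On leaves the phase conjugates `S` to the rotation by `-ρ`, so the phase distribution is
  -- uniform, and `circleLeaf` recovers `μ` from it.
  have hrot : MeasurePreserving (((-ρ : ℝ) : UnitAddCircle) + ·) (μ.map F.circlePhase)
      (μ.map F.circlePhase) := by
    refine ⟨measurable_const_add _, ?_⟩
    rw [Measure.map_map (measurable_const_add _) hm]
    conv_rhs => rw [← hμ.shift.map_eq, Measure.map_map hm hμ.shift.measurable]
    exact Measure.map_congr (hleaf.mono fun x hx => (F.circlePhase_shift hx).symm)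
  rw [← eq_volume_of_measurePreserving_rotation (denseRange_rotation hρ) hrot,
    Measure.map_map F.continuous_circleLeaf.measurable hm]
  conv_lhs => rw [← Measure.map_id (μ := μ)]
  exact Measure.map_congr (hleaf.mono fun x hx => (F.circleLeaf_circlePhase hx).symm)

/-- The uniform distribution on the leaves is ergodic under the spatial translation. -/
theorem map_volume_eq_zero_or_one (hρ : Irrational ρ) {A : Set StateSpace} (hA : MeasurableSet A)
    (hS : shift ⁻¹' A = A) :
    (volume : Measure UnitAddCircle).map F.circleLeaf A = 0 ∨
      (volume : Measure UnitAddCircle).map F.circleLeaf A = 1 := by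
  rw [Measure.map_apply F.continuous_circleLeaf.measurable hA]
  have herg : Ergodic (((-ρ : ℝ) : UnitAddCircle) + ·) := by
    rw [AddCircle.ergodic_add_left, ← AddCircle.denseRange_zsmul_iff]
    exact denseRange_rotation hρ
  have hvol : IsProbabilityMeasure (volume : Measure UnitAddCircle) := ⟨UnitAddCircle.measure_univ⟩
  refine herg.toPreErgodic.prob_eq_zero_or_one
    (hA.preimage F.continuous_circleLeaf.measurable) ?_
  ext s
  simp only [mem_preimage]
  rw [← F.shift_circleLeaf, ← mem_preimage, hS]

end Foliation

theorem Depinned.exists_isInvariant_and_foliation (hρ : Irrational ρ) (h : Admissible W V f δ C)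
    (hdep : Depinned W V f ρ) : ∃ μ, IsInvariant W V f ρ μ ∧ Nonempty (Foliation W V f ρ) := by
  obtain ⟨μ, hμ, honto⟩ := hdep
  obtain ⟨ψ, α, h1, h2, -⟩ := h.exists_foliation hρ hμ honto
  exact ⟨μ, hμ.toIsInvariant, ⟨⟨δ, C, h, ψ, h1, α, h2⟩⟩⟩

end

end FrenkelKontorova

end

theorem mainTheorem5 (W V f : ℝ → ℝ) (ρ : ℝ)
    (hW : ContDiff ℝ 2 W)
    (hconvex : ∃ δ : ℝ, 0 < δ ∧ ∀ p : ℝ, δ ≤ deriv (deriv W) p)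
    (hV : ContDiff ℝ 2 V)
    (hVper : ∀ x : ℝ, V (x + 1) = V x)
    (hf : (∃ c : ℝ, ∀ t : ℝ, f t = c) ∨
      ((∀ t : ℝ, f (t + 1) = f t) ∧ AnalyticOnNhd ℝ W Set.univ ∧
        AnalyticOnNhd ℝ V Set.univ ∧ AnalyticOnNhd ℝ f Set.univ))
    (hρ : Irrational ρ)
    (hdepinned : FrenkelKontorova.Depinned W V f ρ) :
    ∃! μ : MeasureTheory.Measure FrenkelKontorova.StateSpace,
      FrenkelKontorova.IsErgodicInvariant W V f ρ μ := by
  have hfc : Continuous f := by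
    rcases hf with ⟨c, hc⟩ | ⟨-, -, -, ha⟩
    · rw [show f = fun _ => c from funext hc]
      exact continuous_const
    · exact continuousOn_univ.1 ha.continuousOn
  obtain ⟨δ, C, h⟩ := FrenkelKontorova.exists_admissible hW hconvex hV hVper hfc
  obtain ⟨μ, hμ, ⟨F⟩⟩ := hdepinned.exists_isInvariant_and_foliation hρ h
  refine ⟨μ, ⟨hμ, fun A hA hS _ => ?_⟩, fun ν hν => ?_⟩
  · rw [F.eq_map_volume hρ hμ]
    exact F.map_volume_eq_zero_or_one hρ hA hS
  · rw [F.eq_map_volume hρ hμ, F.eq_map_volume hρ hν.toIsInvariant]
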